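/- Let $\Bbbk$ be a commutative ring and let $A=A_{\bar 0}\oplus A_{\bar 1}$ be a symmetric Frobenius superalgebra over $\Bbbk$: an associative unital superalgebra with a $\Bbbk$-linear trace map $\operatorname{tr}\colon A\to\Bbbk$ that is homogeneous of parity $p\in\mathbb Z/2$ and satisfies $\operatorname{tr}(ab)=(-1)^{\bar a\bar b}\operatorname{tr}(ba)$ for homogeneous $a,b$, together with a finite homogeneous basis $\mathbf B_A$ and a dual basis $\{b^\vee : b\in \mathbf B_A\}$, $\operatorname{tr}(a^\vee b)=\delta_{a,b}$ for $a,b\in\mathbf B_A$. Let $\mathcal{NH}(A)$ be the $\Bbbk$-linear strict monoidal supercategory (with super interchange law $(f'\otimes g)\circ(f\otimes g')=(-1)^{\bar f\bar g}(f'\circ f)\otimes(g\circ g')$) generated by one object $X$ and the morphisms $u\colon X^{\otimes 2}\to X^{\otimes 2}$ (even), $x\colon X\to X$ (of parity $p$) and $t_a\colon X\to X$ for $a\in A$ (of the parity of $a$), subject to the relations, with $1=1_X$ and $\tau:=\sum_{b\in \mathbf B_A}(-1)^{p\bar b}\,t_b\otimes t_{b^\vee}$: \begin{gather*} t_1=1,\qquad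 \lambda t_a+\mu t_b=t_{\lambda a+\mu b},\qquad t_a\circ t_b=t_{ab}\qquad (a,b\in A,\ \lambda,\mu\in\Bbbk),\\ u\circ u=0,\qquad (u\otimes 1)(1\otimes u)(u\otimes 1)=(1\otimes u)(u\otimes 1)(1\otimes u),\\ u\circ(t_a\otimes 1)=(1\otimes t_a)\circ u,\qquad u\circ(1\otimes t_a)=(t_a\otimes 1)\circ u,\\ u\circ(x\otimes 1)-(1\otimes x)\circ u=\tau,\qquad (x\otimes 1)\circ u-u\circ(1\otimes x)=(-1)^p\tau,\\ t_a\circ x=(-1)^{p\bar a}\,x\circ t_a\quad (a\in A\text{ homogeneous}). \end{gather*} For $n\ge 0$, the Frobenius nilHecke algebra is $NH_n(A):=\operatorname{End}_{\mathcal{NH}(A)}(X^{\otimes n})$. In it put $$x_i:=1^{\otimes(n-i)}\otimes x\otimes 1^{\otimes(i-1)}\ (1\le i\le n),\qquad u_i:=1^{\otimes(n-i-1)}\otimes u\otimes 1^{\otimes(i-1)}\ (1\le i\le n-1).$$ For $a_1,\dots,a_n\in A$, the image in $NH_n(A)$ of $a_n\otimes\cdots\otimes a_1\in A^{\otimes n}$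 is $t_{a_n}\otimes\cdots\otimes t_{a_1}$, that is, the product $t^{(n)}_{a_n}\cdots t^{(1)}_{a_1}$ with $t^{(i)}_a:=1^{\otimes(n-i)}\otimes t_a\otimes 1^{\otimes(i-1)}$. For $w\in S_n$ let $u_w:=u_{i_1}\cdots u_{i_l}$, where $w=s_{i_1}\cdots s_{i_l}$ is a reduced expression in the simple transpositions $s_i=(i,i+1)$. Then $u_w$ does not depend on the choice of the reduced expression, and for every $n\ge 0$ the algebra $NH_n(A)$ is a free $\Bbbk$-module with basis $$\mathbf a\,x_1^{k_1}\cdots x_n^{k_n}\,u_w,\qquad \mathbf a=b_n\otimes\cdots\otimes b_1 \text{ with } b_1,\dots,b_n\in\mathbf B_A,\quad k_1,\dots,k_n\in\mathbb N,\quad w\in S_n,$$ regarded as a family indexed by the tuples $(b_1,\dots,b_n,k_1,\dots,k_n,w)$. -/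

import Mathlib

/-!  Frobenius nilHecke algebras, as the endomorphism algebras of a strict monoidal supercategory
presented by generators and relations. -/

namespace FrobNilHecke

universe u v w

/-- The sign `(-1) ^ i` for a parity `i`. -/
def sgn (k : Type u) [CommRing k] (i : ZMod 2) : k := (-1) ^ i.val

/-- The structure of a symmetric Frobenius superalgebra on a superalgebra `A` over `k` whose even
and odd parts are `𝒜 0` and `𝒜 1`: a supersymmetric trace map of parity `trp`, a (finite) basis
`basis` of homogeneous elements, and a dual basis `dual`. -/
structure SymmFrobenius (k : Type u) {A : Type v} [CommRing k] [Ring A] [Algebra k A]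
    (𝒜 : ZMod 2 → Submodule k A) [GradedAlgebra 𝒜] (ι : Type w) [Fintype ι] [DecidableEq ι] where
  /-- the trace map -/
  tr : A →ₗ[k] k
  /-- the parity of the trace map -/
  trp : ZMod 2
  /-- `tr` is homogeneous of parity `trp`, where `k` is purely even -/
  tr_parity : ∀ (i : ZMod 2) (a : A), a ∈ 𝒜 i → i + trp ≠ 0 → tr a = 0
  /-- `tr` is supersymmetric -/
  tr_symm : ∀ (i j : ZMod 2) (a b : A), a ∈ 𝒜 i → b ∈ 𝒜 j →
    tr (a * b) = sgn k (i * j) * tr (b * a)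
  /-- the chosen homogeneous basis of `A` -/
  basis : Module.Basis ι k A
  /-- the parities of the basis elements -/
  par : ι → ZMod 2
  basis_mem : ∀ i, basis i ∈ 𝒜 (par i)
  /-- the dual basis -/
  dual : Module.Basis ι k A
  tr_dual_mul : ∀ i j, tr (dual i * basis j) = if i = j then 1 else 0

/-- Formal expressions for morphisms of a `k`-linear strict monoidal supercategory with one
generating object `X` and the generating morphisms `cross` (crossing), `dot`, and `tok a`
(token labelled `a ∈ A`). `Tm k A m n` consists of the expressions for morphisms
`X^{⊗ m} → X^{⊗ n}`. In string diagrams, `comp g f` is `g` above `f`, and `tensor f g` is `f` to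
the left of `g`. -/
inductive Tm (k : Type u) (A : Type v) : ℕ → ℕ → Type (max u v)
  | id (n : ℕ) : Tm k A n n
  | comp {l m n : ℕ} (g : Tm k A m n) (f : Tm k A l m) : Tm k A l n
  | tensor {m n m' n' : ℕ} (f : Tm k A m n) (g : Tm k A m' n') : Tm k A (m + m') (n + n')
  | zero (m n : ℕ) : Tm k A m n
  | add {m n : ℕ} (f g : Tm k A m n) : Tm k A m n
  | smul {m n : ℕ} (r : k) (f : Tm k A m n) : Tm k A m n
  | cross : Tm k A 2 2
  | dot : Tm k A 1 1
  | tok (a : A) : Tm k A 1 1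

namespace Tm

/-- Transport along equalities of source and target (tensoring of objects is strict). -/
def cast {k : Type u} {A : Type v} {m n m' n' : ℕ} (hm : m = m') (hn : n = n') :
    Tm k A m n → Tm k A m' n' :=
  match m', n', hm, hn with
  | _, _, rfl, rfl => fun t => t

/-- The crossing of the two left strands among three. -/
def crossLeft {k : Type u} {A : Type v} : Tm k A 3 3 := tensor (m := 2) (n := 2) cross (id 1)

/-- The crossing of the two right strands among three. -/
def crossRight {k : Type u} {A : Type v} : Tm k A 3 3 := tensor (m' := 2) (n' := 2) (id 1) cross

/-- The sum of a list of expressions. -/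
def listSum {k : Type u} {A : Type v} {m n : ℕ} (l : List (Tm k A m n)) : Tm k A m n :=
  l.foldr add (zero m n)

end Tm

section

variable {k : Type u} {A : Type v} [CommRing k] [Ring A] [Algebra k A]
  {𝒜 : ZMod 2 → Submodule k A} [GradedAlgebra 𝒜] {ι : Type w} [Fintype ι] [DecidableEq ι]

/-- The expressions that are homogeneous of a given parity: crossings are even, the dot has the
parity of the trace map, and a token has the parity of its label. -/
inductive HasParity (F : SymmFrobenius k 𝒜 ι) : ∀ {m n : ℕ}, Tm k A m n → ZMod 2 → Prop
  | id (n : ℕ) : HasParity F (.id n) 0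
  | comp {l m n : ℕ} {g : Tm k A m n} {f : Tm k A l m} {i j : ZMod 2} :
      HasParity F g i → HasParity F f j → HasParity F (.comp g f) (i + j)
  | tensor {m n m' n' : ℕ} {f : Tm k A m n} {g : Tm k A m' n'} {i j : ZMod 2} :
      HasParity F f i → HasParity F g j → HasParity F (.tensor f g) (i + j)
  | zero (m n : ℕ) (i : ZMod 2) : HasParity F (.zero m n) i
  | add {m n : ℕ} {f g : Tm k A m n} {i : ZMod 2} :
      HasParity F f i → HasParity F g i → HasParity F (.add f g) i
  | smul {m n : ℕ} (r : k) {f : Tm k A m n} {i : ZMod 2} :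
      HasParity F f i → HasParity F (.smul r f) i
  | cross : HasParity F .cross 0
  | dot : HasParity F .dot F.trp
  | tok (a : A) (i : ZMod 2) : a ∈ 𝒜 i → HasParity F (.tok a) i

/-- The teleporter `∑_b (-1)^{trp * |b|} b ⊗ b^∨` joining two strands. -/
noncomputable def teleporter (F : SymmFrobenius k 𝒜 ι) : Tm k A 2 2 :=
  Tm.listSum ((Finset.univ : Finset ι).toList.map fun b =>
    .smul (sgn k (F.trp * F.par b)) (.tensor (.tok (F.basis b)) (.tok (F.dual b))))

/-- Equality of morphisms in the Frobenius nilHecke category: the congruence on expressions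
generated by the axioms of a `k`-linear strict monoidal supercategory and by the defining
relations of the Frobenius nilHecke category. -/
inductive Rel (F : SymmFrobenius k 𝒜 ι) : ∀ {m n : ℕ}, Tm k A m n → Tm k A m n → Prop
  -- equivalence relation
  | refl {m n : ℕ} (f : Tm k A m n) : Rel F f f
  | symm {m n : ℕ} {f g : Tm k A m n} : Rel F f g → Rel F g f
  | trans {m n : ℕ} {f g h : Tm k A m n} : Rel F f g → Rel F g h → Rel F f h
  -- compatibility with the operations
  | comp_congr {l m n : ℕ} {g g' : Tm k A m n} {f f' : Tm k A l m} :
      Rel F g g' → Rel F f f' → Rel F (.comp g f) (.comp g' f')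
  | tensor_congr {m n m' n' : ℕ} {f f' : Tm k A m n} {g g' : Tm k A m' n'} :
      Rel F f f' → Rel F g g' → Rel F (.tensor f g) (.tensor f' g')
  | add_congr {m n : ℕ} {f f' g g' : Tm k A m n} :
      Rel F f f' → Rel F g g' → Rel F (.add f g) (.add f' g')
  | smul_congr {m n : ℕ} (r : k) {f f' : Tm k A m n} :
      Rel F f f' → Rel F (.smul r f) (.smul r f')
  -- morphism spaces are `k`-modules
  | add_assoc {m n : ℕ} (f g h : Tm k A m n) : Rel F (.add (.add f g) h) (.add f (.add g h))
  | add_comm {m n : ℕ} (f g : Tm k A m n) : Rel F (.add f g) (.add g f)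
  | zero_add {m n : ℕ} (f : Tm k A m n) : Rel F (.add (.zero m n) f) f
  | one_smul {m n : ℕ} (f : Tm k A m n) : Rel F (.smul 1 f) f
  | mul_smul {m n : ℕ} (r s : k) (f : Tm k A m n) :
      Rel F (.smul (r * s) f) (.smul r (.smul s f))
  | smul_add {m n : ℕ} (r : k) (f g : Tm k A m n) :
      Rel F (.smul r (.add f g)) (.add (.smul r f) (.smul r g))
  | add_smul {m n : ℕ} (r s : k) (f : Tm k A m n) :
      Rel F (.smul (r + s) f) (.add (.smul r f) (.smul s f))
  | zero_smul {m n : ℕ} (f : Tm k A m n) : Rel F (.smul 0 f) (.zero m n)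
  -- composition is bilinear
  | comp_add {l m n : ℕ} (g : Tm k A m n) (f f' : Tm k A l m) :
      Rel F (.comp g (.add f f')) (.add (.comp g f) (.comp g f'))
  | add_comp {l m n : ℕ} (g g' : Tm k A m n) (f : Tm k A l m) :
      Rel F (.comp (.add g g') f) (.add (.comp g f) (.comp g' f))
  | comp_smul {l m n : ℕ} (r : k) (g : Tm k A m n) (f : Tm k A l m) :
      Rel F (.comp g (.smul r f)) (.smul r (.comp g f))
  | smul_comp {l m n : ℕ} (r : k) (g : Tm k A m n) (f : Tm k A l m) :
      Rel F (.comp (.smul r g) f) (.smul r (.comp g f))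
  -- the tensor product is bilinear
  | tensor_add {m n m' n' : ℕ} (f : Tm k A m n) (g g' : Tm k A m' n') :
      Rel F (.tensor f (.add g g')) (.add (.tensor f g) (.tensor f g'))
  | add_tensor {m n m' n' : ℕ} (f f' : Tm k A m n) (g : Tm k A m' n') :
      Rel F (.tensor (.add f f') g) (.add (.tensor f g) (.tensor f' g))
  | tensor_smul {m n m' n' : ℕ} (r : k) (f : Tm k A m n) (g : Tm k A m' n') :
      Rel F (.tensor f (.smul r g)) (.smul r (.tensor f g))
  | smul_tensor {m n m' n' : ℕ} (r : k) (f : Tm k A m n) (g : Tm k A m' n') :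
      Rel F (.tensor (.smul r f) g) (.smul r (.tensor f g))
  -- category axioms
  | id_comp {m n : ℕ} (f : Tm k A m n) : Rel F (.comp (.id n) f) f
  | comp_id {m n : ℕ} (f : Tm k A m n) : Rel F (.comp f (.id m)) f
  | comp_assoc {l m n p : ℕ} (h : Tm k A n p) (g : Tm k A m n) (f : Tm k A l m) :
      Rel F (.comp (.comp h g) f) (.comp h (.comp g f))
  -- strict monoidal axioms, with the super interchange law
  | id_tensor_id (m n : ℕ) : Rel F (.tensor (.id m) (.id n)) (.id (m + n))
  | unit_tensor {m n : ℕ} (f : Tm k A m n) :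
      Rel F ((Tm.tensor (.id 0) f).cast (Nat.zero_add m) (Nat.zero_add n)) f
  | tensor_unit {m n : ℕ} (f : Tm k A m n) :
      Rel F ((Tm.tensor f (.id 0)).cast (Nat.add_zero m) (Nat.add_zero n)) f
  | tensor_assoc {m n m' n' m'' n'' : ℕ}
      (f : Tm k A m n) (g : Tm k A m' n') (h : Tm k A m'' n'') :
      Rel F ((Tm.tensor (.tensor f g) h).cast (Nat.add_assoc m m' m'') (Nat.add_assoc n n' n''))
        (.tensor f (.tensor g h))
  | interchange {l m n l' m' n' : ℕ} (f' : Tm k A m n) (f : Tm k A l m)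
      (g : Tm k A m' n') (g' : Tm k A l' m') (i j : ZMod 2) :
      HasParity F f i → HasParity F g j →
      Rel F (.comp (.tensor f' g) (.tensor f g'))
        (.smul (sgn k (i * j)) (.tensor (.comp f' f) (.comp g g')))
  -- relations between tokens
  | tok_one : Rel F (.tok 1) (.id 1)
  | tok_linear (r s : k) (a b : A) :
      Rel F (.add (.smul r (.tok a)) (.smul s (.tok b))) (.tok (r • a + s • b))
  | tok_mul (a b : A) : Rel F (.comp (.tok a) (.tok b)) (.tok (a * b))
  -- nilCoxeter relations
  | cross_sq : Rel F (.comp .cross .cross) (.zero 2 2)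
  | braid :
      Rel F (.comp .crossLeft (.comp .crossRight .crossLeft))
        (.comp .crossRight (.comp .crossLeft .crossRight))
  | cross_tok_left (a : A) :
      Rel F (.comp .cross (.tensor (.tok a) (.id 1))) (.comp (.tensor (.id 1) (.tok a)) .cross)
  | cross_tok_right (a : A) :
      Rel F (.comp .cross (.tensor (.id 1) (.tok a))) (.comp (.tensor (.tok a) (.id 1)) .cross)
  -- relations of dots with crossings and tokens
  | cross_dot :
      Rel F (.add (.comp .cross (.tensor .dot (.id 1)))
          (.smul (-1) (.comp (.tensor (.id 1) .dot) .cross)))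
        (teleporter F)
  | dot_cross :
      Rel F (.add (.comp (.tensor .dot (.id 1)) .cross)
          (.smul (-1) (.comp .cross (.tensor (.id 1) .dot))))
        (.smul (sgn k F.trp) (teleporter F))
  | tok_dot (a : A) (i : ZMod 2) : a ∈ 𝒜 i →
      Rel F (.comp (.tok a) .dot) (.smul (sgn k (F.trp * i)) (.comp .dot (.tok a)))

/-- The setoid of expressions for morphisms `X^{⊗ m} → X^{⊗ n}`. -/
def relSetoid (F : SymmFrobenius k 𝒜 ι) (m n : ℕ) : Setoid (Tm k A m n) where
  r := Rel F
  iseqv := ⟨.refl, .symm, .trans⟩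

/-- Morphisms `X^{⊗ m} → X^{⊗ n}` of the Frobenius nilHecke category. -/
def Mor (F : SymmFrobenius k 𝒜 ι) (m n : ℕ) : Type (max u v) := Quotient (relSetoid F m n)

/-- The morphism given by an expression. -/
def Mor.mk (F : SymmFrobenius k 𝒜 ι) {m n : ℕ} (t : Tm k A m n) : Mor F m n :=
  Quotient.mk (relSetoid F m n) t

instance (F : SymmFrobenius k 𝒜 ι) (m n : ℕ) : Zero (Mor F m n) :=
  ⟨Mor.mk F (.zero m n)⟩

instance (F : SymmFrobenius k 𝒜 ι) (m n : ℕ) : Add (Mor F m n) :=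
  ⟨Quotient.map₂ Tm.add fun _ _ h _ _ h' => Rel.add_congr h h'⟩

instance (F : SymmFrobenius k 𝒜 ι) (m n : ℕ) : SMul k (Mor F m n) :=
  ⟨fun r => Quotient.map (Tm.smul r) fun _ _ h => Rel.smul_congr r h⟩

instance (F : SymmFrobenius k 𝒜 ι) (m n : ℕ) : Neg (Mor F m n) :=
  ⟨fun f => (-1 : k) • f⟩

instance (F : SymmFrobenius k 𝒜 ι) (m n : ℕ) : AddCommGroup (Mor F m n) where
  nsmul := nsmulRec
  zsmul := zsmulRec
  add_assoc := by
    rintro ⟨f⟩ ⟨g⟩ ⟨h⟩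
    exact Quotient.sound (Rel.add_assoc f g h)
  zero_add := by
    rintro ⟨f⟩
    exact Quotient.sound (Rel.zero_add f)
  add_zero := by
    rintro ⟨f⟩
    exact Quotient.sound ((Rel.add_comm _ _).trans (Rel.zero_add f))
  add_comm := by
    rintro ⟨f⟩ ⟨g⟩
    exact Quotient.sound (Rel.add_comm f g)
  neg_add_cancel := by
    rintro ⟨f⟩
    refine Quotient.sound (((Rel.refl _).add_congr (Rel.one_smul f).symm).trans
      ((Rel.add_smul (-1) 1 f).symm.trans ?_))
    rw [neg_add_cancel]
    exact Rel.zero_smul f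

instance (F : SymmFrobenius k 𝒜 ι) (m n : ℕ) : Module k (Mor F m n) where
  one_smul := by
    rintro ⟨f⟩
    exact Quotient.sound (Rel.one_smul f)
  mul_smul := by
    rintro r s ⟨f⟩
    exact Quotient.sound (Rel.mul_smul r s f)
  smul_add := by
    rintro r ⟨f⟩ ⟨g⟩
    exact Quotient.sound (Rel.smul_add r f g)
  smul_zero := by
    intro r
    refine Quotient.sound ((Rel.smul_congr r (Rel.zero_smul (.zero m n)).symm).trans
      ((Rel.mul_smul r 0 _).symm.trans ?_))
    rw [mul_zero]
    exact Rel.zero_smul _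
  add_smul := by
    rintro r s ⟨f⟩
    exact Quotient.sound (Rel.add_smul r s f)
  zero_smul := by
    rintro ⟨f⟩
    exact Quotient.sound (Rel.zero_smul f)

/-- The Frobenius nilHecke category attached to `F`; its object `⟨n⟩` is `X^{⊗ n}`. -/
structure NilHeckeCat (F : SymmFrobenius k 𝒜 ι) where
  /-- the tensor power of the generating object -/
  power : ℕ

instance (F : SymmFrobenius k 𝒜 ι) : CategoryTheory.Category.{max u v} (NilHeckeCat F) where
  Hom X Y := Mor F X.power Y.power
  id X := Mor.mk F (.id X.power)
  comp f g := Quotient.map₂ (fun f g => Tm.comp g f) (fun _ _ h _ _ h' => Rel.comp_congr h' h) f g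
  id_comp := by
    rintro _ _ ⟨f⟩
    exact Quotient.sound (Rel.comp_id f)
  comp_id := by
    rintro _ _ ⟨f⟩
    exact Quotient.sound (Rel.id_comp f)
  assoc := by
    rintro _ _ _ _ ⟨f⟩ ⟨g⟩ ⟨h⟩
    exact Quotient.sound (Rel.comp_assoc h g f).symm

instance (F : SymmFrobenius k 𝒜 ι) : CategoryTheory.Preadditive (NilHeckeCat F) where
  homGroup X Y := inferInstanceAs (AddCommGroup (Mor F X.power Y.power))
  add_comp := by
    rintro _ _ _ ⟨f⟩ ⟨f'⟩ ⟨g⟩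
    exact Quotient.sound (Rel.comp_add g f f')
  comp_add := by
    rintro _ _ _ ⟨f⟩ ⟨g⟩ ⟨g'⟩
    exact Quotient.sound (Rel.add_comp g g' f)

instance (F : SymmFrobenius k 𝒜 ι) : CategoryTheory.Linear k (NilHeckeCat F) where
  homModule X Y := inferInstanceAs (Module k (Mor F X.power Y.power))
  smul_comp := by
    rintro _ _ _ r ⟨f⟩ ⟨g⟩
    exact Quotient.sound (Rel.comp_smul r g f)
  comp_smul := by
    rintro _ _ _ ⟨f⟩ r ⟨g⟩
    exact Quotient.sound (Rel.smul_comp r g f)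

/-- The Frobenius nilHecke algebra `NH_n(A)`, the endomorphism algebra of `X^{⊗ n}`. The product
`f * g` is the composite `f ∘ g`. -/
abbrev NilHecke (F : SymmFrobenius k 𝒜 ι) (n : ℕ) : Type (max u v) :=
  CategoryTheory.End (⟨n⟩ : NilHeckeCat F)

/-- The element `1_X^{⊗ l} ⊗ t ⊗ 1_X^{⊗ r}` of `NH_n(A)`, where `l + d + r = n`. -/
def place (F : SymmFrobenius k 𝒜 ι) {n d : ℕ} (l r : ℕ) (h : l + d + r = n) (t : Tm k A d d) :
    NilHecke F n :=
  Mor.mk F ((Tm.tensor (.tensor (.id l) t) (.id r)).cast h h)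

/- Strands are numbered from right to left. Indices start at `0`, so that `i : Fin n` stands for
strand number `i + 1`. -/

/-- A token labelled `a` on strand `i`, i.e. `1^{⊗ (n-1-i)} ⊗ a ⊗ 1^{⊗ i} ∈ A^{⊗ n}` viewed in
`NH_n(A)`. -/
def tokenAt (F : SymmFrobenius k 𝒜 ι) {n : ℕ} (i : Fin n) (a : A) : NilHecke F n :=
  place F (n - 1 - i) i (by omega) (.tok a)

/-- The generator `x` on strand `i`: a dot on that strand. -/
def xAt (F : SymmFrobenius k 𝒜 ι) {n : ℕ} (i : Fin n) : NilHecke F n :=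
  place F (n - 1 - i) i (by omega) .dot

/-- The generator `u` at `i`: the crossing of the strands `i` and `i + 1`. -/
def uAt (F : SymmFrobenius k 𝒜 ι) {n : ℕ} (i : Fin (n - 1)) : NilHecke F n :=
  place F (n - 2 - i) i (by omega) .cross

/-- The image in `NH_n(A)` of `a_{n-1} ⊗ ⋯ ⊗ a_0 ∈ A^{⊗ n}` (factors numbered from right to
left), that is, the product of the tokens labelled `a_{n-1}, …, a_0` on the strands
`n-1, …, 0`, in this order. -/
def pureTensor (F : SymmFrobenius k 𝒜 ι) {n : ℕ} (a : Fin n → A) : NilHecke F n :=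
  (List.ofFn fun i : Fin n => tokenAt F i.rev (a i.rev)).prod

/-- The monomial `x_0^{e_0} ⋯ x_{n-1}^{e_{n-1}}`. -/
def xMonomial (F : SymmFrobenius k 𝒜 ι) {n : ℕ} (e : Fin n → ℕ) : NilHecke F n :=
  (List.ofFn fun i : Fin n => xAt F i ^ e i).prod

/-- The product `u_{i_1} ⋯ u_{i_l}`. -/
def uWord (F : SymmFrobenius k 𝒜 ι) {n : ℕ} (l : List (Fin (n - 1))) : NilHecke F n :=
  (l.map (uAt F)).prod

end

/-- The simple transposition of `i` and `i + 1`. -/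
def simpleTransposition {n : ℕ} (i : Fin (n - 1)) : Equiv.Perm (Fin n) :=
  Equiv.swap ⟨i, by omega⟩ ⟨i + 1, by omega⟩

/-- `s_{i_1} ⋯ s_{i_l}` is a reduced expression for `w`. -/
def IsReducedWord {n : ℕ} (l : List (Fin (n - 1))) (w : Equiv.Perm (Fin n)) : Prop :=
  (l.map simpleTransposition).prod = w ∧
    ∀ l' : List (Fin (n - 1)), (l'.map simpleTransposition).prod = w → l.length ≤ l'.length

theorem exists_word : ∀ {n : ℕ} (w : Equiv.Perm (Fin n)),
    ∃ l : List (Fin (n - 1)), (l.map simpleTransposition).prod = w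
  | 0, w => ⟨[], Subsingleton.elim _ _⟩
  | n + 1, w => by
    have hw : w ∈ Submonoid.closure
        (Set.range fun i : Fin n => Equiv.swap i.castSucc i.succ) := by
      rw [Equiv.Perm.mclosure_swap_castSucc_succ]
      trivial
    induction hw using Submonoid.closure_induction with
    | mem x hx =>
      obtain ⟨i, rfl⟩ := hx
      refine ⟨[i], ?_⟩
      simp only [List.map_cons, List.map_nil, List.prod_cons, List.prod_nil, mul_one]
      rfl
    | one => exact ⟨[], rfl⟩
    | mul x y _ _ hx hy =>
      obtain ⟨l, rfl⟩ := hx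
      obtain ⟨l', rfl⟩ := hy
      exact ⟨l ++ l', by simp⟩

theorem exists_isReducedWord {n : ℕ} (w : Equiv.Perm (Fin n)) :
    ∃ l : List (Fin (n - 1)), IsReducedWord l w := by
  classical
  have h : ∃ d : ℕ, ∃ l : List (Fin (n - 1)),
      (l.map simpleTransposition).prod = w ∧ l.length = d := by
    obtain ⟨l, hl⟩ := exists_word w
    exact ⟨l.length, l, hl, rfl⟩
  obtain ⟨l, hl, hd⟩ := Nat.find_spec h
  refine ⟨l, hl, fun l' hl' => ?_⟩
  rw [hd]
  exact Nat.find_min' h ⟨l', hl', rfl⟩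

/-- `u_w = u_{i_1} ⋯ u_{i_l}` for a chosen reduced expression `w = s_{i_1} ⋯ s_{i_l}`. -/
noncomputable def uPerm {k : Type u} {A : Type v} [CommRing k] [Ring A] [Algebra k A]
    {𝒜 : ZMod 2 → Submodule k A} [GradedAlgebra 𝒜] {ι : Type w} [Fintype ι] [DecidableEq ι]
    (F : SymmFrobenius k 𝒜 ι) {n : ℕ} (w : Equiv.Perm (Fin n)) : NilHecke F n :=
  uWord F (exists_isReducedWord w).choose

end FrobNilHecke

/-! The proof is a diamond-type argument: the standard monomials span because every relation can be
used to sort a product, and they are independent because a faithful enough representation exists.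

Spanning. Every diagram is a linear combination of products of generators placed on single strands
or pairs of neighbours (`adjoin_generators_eq_top`). Tokens supercommute with dots, and generators
on different strands supercommute, so tokens and dots can be sorted. A crossing moves to the right
past dots and tokens at the cost of a teleporter, which is again made of tokens. Finally the span of
the `u_w` is stable under left multiplication by crossings, thanks to Matsumoto's theorem
(`prod_eq_of_isReducedWord`) and `u_i ^ 2 = 0`. This is `span_monomial_eq_top`, valid in any algebra
with a family satisfying the relations.

Independence. Let `P` be the algebra presented by dots and tokens alone. For each `i` there are an
endomorphism `s_i` of `P` permuting strands and an `s_i`-twisted derivation `∂_i` with values `± τ`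
on the two dots involved; both come from one homomorphism of `P` to upper triangular matrices. On
the free `P`-module with basis `S_n`, thought of as the sum of the `P u_w`, a crossing acts by `f
u_w ↦ s_i(f) u_i u_w + ∂_i(f) u_w`. Each relation between crossings, written as an operator that has
to vanish, can be moved past dots and tokens, so it is enough to test it on the `u_w`
(`eq_zero_of_commutes`), where it is a relation of the nilCoxeter algebra. Evaluating diagrams in
this representation (`evalHom`) and applying them to `u_1` sends the standard monomial `a x^e u_w`
to `a x^e` in the summand of `w`. It remains to see that the monomials `a x^e` are independent in
`P`; for this `P` acts on functions of exponents with values in multilinear forms on `A`, and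
coordinate functionals separate the monomials (`linearIndependent_monomial`). -/

namespace FrobNilHecke

universe u v w

/-! ### Reduced words in symmetric groups and Matsumoto's theorem. -/

section Perm

variable {n : ℕ}

/-- The right strand of the two strands crossed by the `i`-th crossing. -/
def lo (i : Fin (n - 1)) : Fin n := ⟨i, by omega⟩

/-- The left strand of the two strands crossed by the `i`-th crossing. -/
def hi (i : Fin (n - 1)) : Fin n := ⟨i + 1, by omega⟩

theorem simpleTransposition_eq (i : Fin (n - 1)) :
    simpleTransposition i = Equiv.swap (lo i) (hi i) := rfl

theorem lo_lt_hi (i : Fin (n - 1)) : lo i < hi i := by simp [lo, hi]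

theorem lo_ne_hi (i : Fin (n - 1)) : lo i ≠ hi i := (lo_lt_hi i).ne

@[simp] theorem simpleTransposition_lo (i : Fin (n - 1)) : simpleTransposition i (lo i) = hi i :=
  Equiv.swap_apply_left _ _

@[simp] theorem simpleTransposition_hi (i : Fin (n - 1)) : simpleTransposition i (hi i) = lo i :=
  Equiv.swap_apply_right _ _

theorem simpleTransposition_of_ne {i : Fin (n - 1)} {j : Fin n} (h : j ≠ lo i) (h' : j ≠ hi i) :
    simpleTransposition i j = j :=
  Equiv.swap_apply_of_ne_of_ne h h'

@[simp] theorem simpleTransposition_apply_apply (i : Fin (n - 1)) (j : Fin n) :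
    simpleTransposition i (simpleTransposition i j) = j :=
  Equiv.swap_apply_self _ _ _

@[simp] theorem simpleTransposition_mul_self (i : Fin (n - 1)) :
    simpleTransposition i * simpleTransposition i = 1 :=
  Equiv.swap_mul_self _ _

@[simp] theorem simpleTransposition_mul_cancel (i : Fin (n - 1)) (w : Equiv.Perm (Fin n)) :
    simpleTransposition i * (simpleTransposition i * w) = w := by
  rw [← mul_assoc, simpleTransposition_mul_self, one_mul]

@[simp] theorem simpleTransposition_inv (i : Fin (n - 1)) :
    (simpleTransposition i)⁻¹ = simpleTransposition i :=
  Equiv.swap_inv _ _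

/-- Left multiplication by the `i`-th simple transposition increases the length of `w`. -/
def IsAscent (i : Fin (n - 1)) (w : Equiv.Perm (Fin n)) : Prop := w⁻¹ (lo i) < w⁻¹ (hi i)

instance (i : Fin (n - 1)) (w : Equiv.Perm (Fin n)) : Decidable (IsAscent i w) :=
  inferInstanceAs (Decidable (_ < _))

theorem isAscent_mul_iff (i : Fin (n - 1)) (w : Equiv.Perm (Fin n)) :
    IsAscent i (simpleTransposition i * w) ↔ ¬ IsAscent i w := by
  have h : w⁻¹ (lo i) ≠ w⁻¹ (hi i) := fun h => lo_ne_hi i (w⁻¹.injective h)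
  simp only [IsAscent, mul_inv_rev, simpleTransposition_inv, Equiv.Perm.mul_apply,
    simpleTransposition_lo, simpleTransposition_hi, not_lt]
  exact ⟨le_of_lt, fun h' => lt_of_le_of_ne h' h.symm⟩

/-- The inversions of a permutation. -/
def inversions (w : Equiv.Perm (Fin n)) : Finset (Fin n × Fin n) :=
  {q | q.1 < q.2 ∧ w q.2 < w q.1}

theorem mem_inversions {w : Equiv.Perm (Fin n)} {a b : Fin n} :
    (a, b) ∈ inversions w ↔ a < b ∧ w b < w a := by
  simp [inversions]

theorem simpleTransposition_lt_iff (i : Fin (n - 1)) {a b : Fin n}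
    (h : ¬ (a = lo i ∧ b = hi i)) (h' : ¬ (a = hi i ∧ b = lo i)) :
    simpleTransposition i a < simpleTransposition i b ↔ a < b := by
  rw [simpleTransposition_eq]
  simp only [Equiv.swap_apply_def, lo, hi, Fin.ext_iff, Fin.lt_def] at *
  split_ifs <;> simp only <;> omega

/-- The transposition preserves the order of every pair of values other than the two neighbours it
exchanges, so only the pair of positions of these two values changes its status. -/
theorem inversions_simpleTransposition_mul {i : Fin (n - 1)} {w : Equiv.Perm (Fin n)}
    (h : IsAscent i w) :
    inversions (simpleTransposition i * w) =
      insert (w⁻¹ (lo i), w⁻¹ (hi i)) (inversions w) := by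
  ext ⟨a, b⟩
  rw [Finset.mem_insert, mem_inversions, mem_inversions, Prod.mk.injEq, Equiv.Perm.mul_apply,
    Equiv.Perm.mul_apply]
  rw [Equiv.Perm.eq_inv_iff_eq, Equiv.Perm.eq_inv_iff_eq]
  by_cases h1 : w a = lo i ∧ w b = hi i
  · obtain ⟨ha, hb⟩ := h1
    have hab : a < b := by
      have := h
      rw [IsAscent, ← ha, ← hb] at this
      simpa using this
    simp [ha, hb, hab, lo_lt_hi]
  · by_cases h2 : w a = hi i ∧ w b = lo i
    · obtain ⟨ha, hb⟩ := h2
      have hab : b < a := by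
        have := h
        rw [IsAscent, ← ha, ← hb] at this
        simpa using this
      simp [ha, hb, hab.not_gt, (lo_ne_hi i).symm]
    · rw [simpleTransposition_lt_iff i (fun h => h2 ⟨h.2, h.1⟩) (fun h => h1 ⟨h.2, h.1⟩)]
      tauto

/-- The number of inversions of a permutation. -/
def inv (w : Equiv.Perm (Fin n)) : ℕ := (inversions w).card

theorem inv_mul_of_isAscent {i : Fin (n - 1)} {w : Equiv.Perm (Fin n)} (h : IsAscent i w) :
    inv (simpleTransposition i * w) = inv w + 1 := by
  rw [inv, inversions_simpleTransposition_mul h, Finset.card_insert_of_notMem, inv]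
  simp [inversions, (lo_lt_hi i).le]

theorem inv_of_not_isAscent {i : Fin (n - 1)} {w : Equiv.Perm (Fin n)} (h : ¬ IsAscent i w) :
    inv w = inv (simpleTransposition i * w) + 1 := by
  have := inv_mul_of_isAscent ((isAscent_mul_iff i w).2 h)
  rwa [simpleTransposition_mul_cancel] at this

theorem inv_one : inv (1 : Equiv.Perm (Fin n)) = 0 := by
  simp only [inv, inversions, Finset.card_eq_zero, Finset.filter_eq_empty_iff]
  intro q _ h
  exact absurd h.1 h.2.not_gt

theorem inv_prod_le (l : List (Fin (n - 1))) : inv (l.map simpleTransposition).prod ≤ l.length := by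
  induction l with
  | nil => simp [inv_one]
  | cons i l ih =>
    simp only [List.map_cons, List.prod_cons, List.length_cons]
    by_cases h : IsAscent i (l.map simpleTransposition).prod
    · rw [inv_mul_of_isAscent h]; omega
    · have := inv_of_not_isAscent h; omega

/-- Without descents `w⁻¹` is a strictly increasing bijection of `Fin n`, and the identity is the
only one. -/
theorem eq_one_of_forall_isAscent {w : Equiv.Perm (Fin n)} (h : ∀ i, IsAscent i w) : w = 1 := by
  have hm : StrictMono (w⁻¹ : Equiv.Perm (Fin n)) := by
    cases n with
    | zero => exact fun a => a.elim0
    | succ n => exact Fin.strictMono_iff_lt_succ.2 fun i => h i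
  have h1 : (w⁻¹ : Equiv.Perm (Fin n)) = 1 := by
    ext1 a
    have := hm.range_inj (g := id) strictMono_id
    exact congrFun (this.1 (by simp)) a
  simpa using h1

theorem exists_word_length_eq_inv (w : Equiv.Perm (Fin n)) :
    ∃ l : List (Fin (n - 1)), (l.map simpleTransposition).prod = w ∧ l.length = inv w := by
  induction hd : inv w generalizing w with
  | zero =>
    refine ⟨[], ?_, by simp⟩
    refine (eq_one_of_forall_isAscent fun i => ?_).symm
    by_contra h
    have := inv_of_not_isAscent h
    omega
  | succ d ih =>
    by_cases hw : ∀ i, IsAscent i w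
    · rw [eq_one_of_forall_isAscent hw, inv_one] at hd
      omega
    · push Not at hw
      obtain ⟨i, hi⟩ := hw
      have := inv_of_not_isAscent hi
      obtain ⟨l, hl, hl'⟩ := ih (simpleTransposition i * w) (by omega)
      exact ⟨i :: l, by simp [hl], by simp [hl']⟩

/-- Each letter changes `inv` by exactly one, so no word is shorter than `inv w`; removing descents
until none is left produces a word attaining this bound. -/
theorem isReducedWord_iff {l : List (Fin (n - 1))} {w : Equiv.Perm (Fin n)} :
    IsReducedWord l w ↔ (l.map simpleTransposition).prod = w ∧ l.length = inv w := by
  refine and_congr_right fun h => ⟨fun hl => ?_, fun hl l' hl' => ?_⟩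
  · obtain ⟨l', h1, h2⟩ := exists_word_length_eq_inv w
    exact le_antisymm (h2 ▸ hl l' h1) (h ▸ inv_prod_le l)
  · rw [hl, ← hl']
    exact inv_prod_le l'

theorem isReducedWord_cons {i : Fin (n - 1)} {l : List (Fin (n - 1))} {w : Equiv.Perm (Fin n)} :
    IsReducedWord (i :: l) w ↔ ¬ IsAscent i w ∧ IsReducedWord l (simpleTransposition i * w) := by
  simp only [isReducedWord_iff, List.map_cons, List.prod_cons, List.length_cons]
  constructor
  · rintro ⟨rfl, h⟩
    have h2 := inv_prod_le l
    have h3 : ¬ IsAscent i (simpleTransposition i * (l.map simpleTransposition).prod) := by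
      rw [isAscent_mul_iff, not_not]
      by_contra h'
      have := inv_of_not_isAscent h'
      omega
    have := inv_of_not_isAscent h3
    rw [simpleTransposition_mul_cancel] at *
    exact ⟨h3, rfl, by omega⟩
  · rintro ⟨h, hl, hl'⟩
    have := inv_of_not_isAscent h
    exact ⟨by rw [hl, simpleTransposition_mul_cancel], by omega⟩

theorem isReducedWord_cons_mul {i : Fin (n - 1)} {l : List (Fin (n - 1))} {w : Equiv.Perm (Fin n)}
    (h : IsAscent i w) (hl : IsReducedWord l w) :
    IsReducedWord (i :: l) (simpleTransposition i * w) := by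
  rw [isReducedWord_cons, isAscent_mul_iff, not_not, simpleTransposition_mul_cancel]
  exact ⟨h, hl⟩

theorem isAscent_simpleTransposition_mul (i j : Fin (n - 1)) (w : Equiv.Perm (Fin n)) :
    IsAscent i (simpleTransposition j * w) ↔
      w⁻¹ (simpleTransposition j (lo i)) < w⁻¹ (simpleTransposition j (hi i)) := by
  simp [IsAscent]

theorem simpleTransposition_far {i j : Fin (n - 1)} (h : (i : ℕ) + 1 < j) :
    simpleTransposition i (lo j) = lo j ∧ simpleTransposition i (hi j) = hi j ∧
      simpleTransposition j (lo i) = lo i ∧ simpleTransposition j (hi i) = hi i := by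
  refine ⟨?_, ?_, ?_, ?_⟩ <;> apply simpleTransposition_of_ne <;>
    simp only [lo, hi, ne_eq, Fin.ext_iff] <;> omega

theorem simpleTransposition_near {i j : Fin (n - 1)} (h : (i : ℕ) + 1 = j) :
    lo j = hi i ∧ simpleTransposition i (hi j) = hi j ∧ simpleTransposition j (lo i) = lo i := by
  refine ⟨by simp [lo, hi, ← h], ?_, ?_⟩ <;> apply simpleTransposition_of_ne <;>
    simp only [lo, hi, ne_eq, Fin.ext_iff] <;> omega

theorem simpleTransposition_comm {i j : Fin (n - 1)} (h : (i : ℕ) + 1 < j) :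
    simpleTransposition i * simpleTransposition j =
      simpleTransposition j * simpleTransposition i := by
  rw [simpleTransposition_eq j, Equiv.mul_swap_eq_swap_mul, (simpleTransposition_far h).1,
    (simpleTransposition_far h).2.1]

theorem simpleTransposition_braid {i j : Fin (n - 1)} (h : (i : ℕ) + 1 = j) :
    simpleTransposition i * (simpleTransposition j * simpleTransposition i) =
      simpleTransposition j * (simpleTransposition i * simpleTransposition j) := by
  obtain ⟨h1, h2, h3⟩ := simpleTransposition_near h
  have e1 : simpleTransposition i * (simpleTransposition j * simpleTransposition i) =
      Equiv.swap (lo i) (hi j) := by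
    rw [simpleTransposition_eq j, ← mul_assoc, Equiv.mul_swap_eq_swap_mul, h1,
      simpleTransposition_hi, h2, mul_assoc, simpleTransposition_mul_self, mul_one]
  have e2 : simpleTransposition j * (simpleTransposition i * simpleTransposition j) =
      Equiv.swap (lo i) (hi j) := by
    rw [simpleTransposition_eq i, ← mul_assoc, Equiv.mul_swap_eq_swap_mul, ← h1,
      simpleTransposition_lo, h3, mul_assoc, simpleTransposition_mul_self, mul_one]
  rw [e1, e2]

/-- Matsumoto's theorem for symmetric groups. -/
theorem prod_eq_of_isReducedWord {M : Type*} [Monoid M] (U : Fin (n - 1) → M)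
    (braid : ∀ i j : Fin (n - 1), (i : ℕ) + 1 = j → U i * (U j * U i) = U j * (U i * U j))
    (far : ∀ i j : Fin (n - 1), (i : ℕ) + 1 < j → U i * U j = U j * U i)
    {l l' : List (Fin (n - 1))} {w : Equiv.Perm (Fin n)}
    (hl : IsReducedWord l w) (hl' : IsReducedWord l' w) : (l.map U).prod = (l'.map U).prod := by
  induction hd : l.length using Nat.strong_induction_on generalizing l l' w with
  | _ d ih =>
    have hlen : l.length = l'.length :=
      (isReducedWord_iff.1 hl).2.trans (isReducedWord_iff.1 hl').2.symm
    match l, l', hlen with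
    | [], [], _ => rfl
    | i :: l, j :: l', hlen =>
      simp only [List.length_cons, add_left_inj] at hlen hd
      -- The case of different first letters is symmetric in the two words, so it is treated once
      -- with `i < j`.
      have key : ∀ (i j : Fin (n - 1)) (l l' : List (Fin (n - 1))), l.length < d →
          l'.length < d → (i : ℕ) < j → IsReducedWord (i :: l) w → IsReducedWord (j :: l') w →
          ((i :: l).map U).prod = ((j :: l').map U).prod := by
        intro i j l l' hld hld' hij hl hl'
        rw [isReducedWord_cons] at hl hl'
        obtain ⟨hi, hl⟩ := hl
        obtain ⟨hj, hl'⟩ := hl'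
        simp only [List.map_cons, List.prod_cons]
        rcases Nat.lt_or_eq_of_le (show (i : ℕ) + 1 ≤ j from hij) with h | h
        -- Since `i` and `j` are both descents of `w`, there are reduced words `i j m` and `j i m`
        -- of `w`. By induction they may replace the given ones, and they differ by a commutation.
        · obtain ⟨h1, h2, h3, h4⟩ := simpleTransposition_far h
          obtain ⟨m, hm⟩ := exists_isReducedWord
            (simpleTransposition j * (simpleTransposition i * w))
          have r1 : IsReducedWord (j :: m) (simpleTransposition i * w) :=
            isReducedWord_cons.2 ⟨by
              rw [isAscent_simpleTransposition_mul, h1, h2]; exact hj, hm⟩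
          have r2 : IsReducedWord (i :: m) (simpleTransposition j * w) :=
            isReducedWord_cons.2 ⟨by
              rw [isAscent_simpleTransposition_mul, h3, h4]; exact hi, by
              rwa [← mul_assoc, simpleTransposition_comm h, mul_assoc]⟩
          rw [ih _ hld hl r1 rfl, ih _ hld' hl' r2 rfl]
          simp only [List.map_cons, List.prod_cons]
          rw [← mul_assoc, far i j h, mul_assoc]
        · obtain ⟨h1, h2, h3⟩ := simpleTransposition_near h
          -- Two adjacent descents mean that `w⁻¹` decreases on three consecutive strands, so `w`
          -- has reduced words `i j i m` and `j i j m`. By induction these may replace the given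
          -- words, and they differ by a braid relation.
          obtain ⟨m, hm⟩ := exists_isReducedWord
            (simpleTransposition i * (simpleTransposition j * (simpleTransposition i * w)))
          have hi' : w⁻¹ (FrobNilHecke.hi i) < w⁻¹ (lo i) :=
            lt_of_le_of_ne (not_lt.1 hi) fun h => lo_ne_hi i (w⁻¹.injective h).symm
          have hj' : w⁻¹ (FrobNilHecke.hi j) < w⁻¹ (FrobNilHecke.hi i) := by
            have := lt_of_le_of_ne (not_lt.1 hj) fun h => lo_ne_hi j (w⁻¹.injective h).symm
            rwa [h1] at this
          have r1 : IsReducedWord (j :: i :: m) (simpleTransposition i * w) := by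
            refine isReducedWord_cons.2 ⟨?_, isReducedWord_cons.2 ⟨?_, hm⟩⟩
            · rw [isAscent_simpleTransposition_mul, h1, h2, simpleTransposition_hi]
              exact (hj'.trans hi').not_gt
            · rw [isAscent_simpleTransposition_mul, h3, ← h1, simpleTransposition_lo, mul_inv_rev]
              simp only [simpleTransposition_inv, Equiv.Perm.mul_apply, h2, simpleTransposition_lo]
              exact hj'.not_gt
          have r2 : IsReducedWord (i :: j :: m) (simpleTransposition j * w) := by
            refine isReducedWord_cons.2 ⟨?_, isReducedWord_cons.2 ⟨?_, ?_⟩⟩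
            · rw [isAscent_simpleTransposition_mul, h3, ← h1, simpleTransposition_lo]
              exact (hj'.trans hi').not_gt
            · rw [isAscent_simpleTransposition_mul, h2, h1, simpleTransposition_hi, mul_inv_rev]
              simp only [simpleTransposition_inv, Equiv.Perm.mul_apply, h3]
              rw [simpleTransposition_hi, h1]
              exact hi'.not_gt
            · have := simpleTransposition_braid h
              have e : simpleTransposition j * (simpleTransposition i * (simpleTransposition j * w))
                  = simpleTransposition i * (simpleTransposition j * (simpleTransposition i * w)) := by
                calc _ = (simpleTransposition j * (simpleTransposition i * simpleTransposition j)) * w := by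
                      simp only [mul_assoc]
                  _ = _ := by rw [← this]; simp only [mul_assoc]
              rwa [e]
          rw [ih _ hld hl r1 rfl, ih _ hld' hl' r2 rfl]
          simp only [List.map_cons, List.prod_cons]
          calc _ = (U i * (U j * U i)) * (m.map U).prod := by simp only [mul_assoc]
            _ = _ := by rw [braid i j h]; simp only [mul_assoc]
      rcases lt_trichotomy (i : ℕ) j with h | h | h
      · exact key i j l l' (by omega) (by omega) h hl hl'
      · obtain rfl : i = j := Fin.ext h
        simp only [List.map_cons, List.prod_cons]
        rw [ih l.length (by omega) (isReducedWord_cons.1 hl).2 (isReducedWord_cons.1 hl').2 rfl]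
      · exact (key j i l' l (by omega) (by omega) h hl' hl).symm

end Perm

end FrobNilHecke
-- Signs, dual bases and the calculus of teleporters.
namespace FrobNilHecke

universe u v w

section Sign

variable {k : Type u} [CommRing k]

@[simp] theorem sgn_zero : sgn k 0 = 1 := by simp [sgn]

@[simp] theorem sgn_one : sgn k 1 = -1 := by
  simp [sgn, ZMod.val_one]

theorem sgn_add (i j : ZMod 2) : sgn k (i + j) = sgn k i * sgn k j := by
  have h : ∀ i : ZMod 2, i = 0 ∨ i = 1 := by decide
  have h' : (1 + 1 : ZMod 2) = 0 := rfl
  rcases h i with rfl | rfl <;> rcases h j with rfl | rfl <;> simp [h']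

@[simp] theorem sgn_mul_self (i : ZMod 2) : sgn k i * sgn k i = 1 := by
  rw [← sgn_add, show i + i = 0 by revert i; decide, sgn_zero]

end Sign

variable {k : Type u} {A : Type v} [CommRing k] [Ring A] [Algebra k A]
  {𝒜 : ZMod 2 → Submodule k A} [GradedAlgebra 𝒜] {ι : Type w} [Fintype ι] [DecidableEq ι]

theorem exists_add_of_parity (𝒜 : ZMod 2 → Submodule k A) [GradedAlgebra 𝒜] (s : ZMod 2) (a : A) :
    ∃ x ∈ 𝒜 s, ∃ y ∈ 𝒜 (s + 1), a = x + y := by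
  induction a using DirectSum.Decomposition.inductionOn 𝒜 with
  | zero => exact ⟨0, zero_mem _, 0, zero_mem _, by simp⟩
  | @homogeneous i a =>
    have h : ∀ i s : ZMod 2, i = s ∨ i = s + 1 := by decide
    rcases h i s with rfl | rfl
    · exact ⟨a, a.2, 0, zero_mem _, by simp⟩
    · exact ⟨0, zero_mem _, a, a.2, by simp⟩
  | add a b ha hb =>
    obtain ⟨x, hx, y, hy, rfl⟩ := ha
    obtain ⟨x', hx', y', hy', rfl⟩ := hb
    exact ⟨x + x', add_mem hx hx', y + y', add_mem hy hy', by abel⟩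

/-- Induction on elements of a superalgebra: homogeneous elements and sums. -/
theorem parity_induction (𝒜 : ZMod 2 → Submodule k A) [GradedAlgebra 𝒜] {q : A → Prop}
    (hom : ∀ (i : ZMod 2) (a : A), a ∈ 𝒜 i → q a) (add : ∀ a b, q a → q b → q (a + b)) (a : A) :
    q a := by
  obtain ⟨x, hx, y, hy, rfl⟩ := exists_add_of_parity 𝒜 0 a
  exact add _ _ (hom _ _ hx) (hom _ _ hy)

namespace SymmFrobenius

variable (F : SymmFrobenius k 𝒜 ι)

theorem tr_eq_zero {i : ZMod 2} {a : A} (ha : a ∈ 𝒜 i) (h : i ≠ F.trp) : F.tr a = 0 :=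
  F.tr_parity i a ha fun h' => h (by
    clear ha h
    generalize F.trp = p at h'
    revert i p; decide)

theorem sum_tr_dual_mul_smul_basis (a : A) :
    ∑ c, F.tr (F.dual c * a) • F.basis c = a := by
  conv_rhs => rw [← F.basis.sum_repr a]
  refine Finset.sum_congr rfl fun c _ => ?_
  congr 1
  conv_lhs => rw [← F.basis.sum_repr a]
  simp [-Module.Basis.sum_repr, Finset.mul_sum, F.tr_dual_mul]

theorem sum_tr_mul_basis_smul_dual (a : A) :
    ∑ c, F.tr (a * F.basis c) • F.dual c = a := by
  conv_rhs => rw [← F.dual.sum_repr a]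
  refine Finset.sum_congr rfl fun c _ => ?_
  congr 1
  conv_lhs => rw [← F.dual.sum_repr a]
  simp [-Module.Basis.sum_repr, Finset.sum_mul, F.tr_dual_mul]

/-- The component `y` of the wrong parity pairs to zero with every basis element `c`: either `y * c`
has a parity on which the trace vanishes, or `x * c` has, and then `y * c` has the trace of `dual i
* basis c`, which is zero because the parities exclude `i = c`. -/
theorem dual_mem (i : ι) : F.dual i ∈ 𝒜 (F.par i + F.trp) := by
  obtain ⟨x, hx, y, hy, hxy⟩ := exists_add_of_parity 𝒜 (F.par i + F.trp) (F.dual i)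
  have hy0 : y = 0 := by
    rw [← F.sum_tr_mul_basis_smul_dual y]
    refine Finset.sum_eq_zero fun c _ => ?_
    have hyc := SetLike.mul_mem_graded hy (F.basis_mem c)
    have hxc := SetLike.mul_mem_graded hx (F.basis_mem c)
    by_cases h : F.par i + F.trp + 1 + F.par c = F.trp
    · have hic : i ≠ c := by
        rintro rfl
        generalize F.trp = p at h
        generalize F.par i = q at h
        revert p q; decide
      have h1 := F.tr_dual_mul i c
      rw [if_neg hic, hxy, add_mul, map_add, F.tr_eq_zero hxc, zero_add] at h1
      · rw [h1, zero_smul]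
      · generalize F.trp = p at h ⊢
        generalize F.par i = q at h ⊢
        generalize F.par c = r at h ⊢
        revert p q r; decide
    · rw [F.tr_eq_zero hyc h, zero_smul]
  rw [hxy, hy0, add_zero]
  exact hx

end SymmFrobenius

/-- A family of dots and tokens on strands labelled by `J`, in an algebra `E`. -/
structure DotTokens (F : SymmFrobenius k 𝒜 ι) (J : Type*) (E : Type*) [Ring E] [Algebra k E] where
  /-- the dot on a strand -/
  X : J → E
  /-- the tokens on a strand -/
  T : J → A →ₗ[k] E
  T_one : ∀ j, T j 1 = 1
  T_mul : ∀ j a b, T j (a * b) = T j a * T j b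
  T_T : ∀ {i j : J} {c d : ZMod 2} {a b : A}, i ≠ j → a ∈ 𝒜 c → b ∈ 𝒜 d →
    T i a * T j b = sgn k (c * d) • (T j b * T i a)
  T_X : ∀ (i j : J) {c : ZMod 2} {a : A}, a ∈ 𝒜 c →
    T i a * X j = sgn k (F.trp * c) • (X j * T i a)
  X_X : ∀ {i j : J}, i ≠ j → X i * X j = sgn k F.trp • (X j * X i)

namespace DotTokens

variable {F : SymmFrobenius k 𝒜 ι} {J E : Type*} [Ring E] [Algebra k E] (D : DotTokens F J E)

/-- The teleporter between two strands. -/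
noncomputable def tau (i j : J) : E :=
  ∑ b, sgn k (F.trp * F.par b) • (D.T i (F.basis b) * D.T j (F.dual b))

/-- Expressing the dual basis through the basis turns both sides into sums of `T i (basis c) * T j
(basis b)`, whose coefficients are signs times the traces of `dual c * dual b` and of `dual b * dual
c`; supersymmetry of the trace compares them. -/
theorem tau_swap {i j : J} (h : i ≠ j) : D.tau j i = sgn k F.trp • D.tau i j := by
  have e1 : D.tau j i = ∑ b, ∑ c, (sgn k (F.par b) * F.tr (F.dual c * F.dual b)) •
      (D.T i (F.basis c) * D.T j (F.basis b)) := by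
    refine Finset.sum_congr rfl fun b _ => ?_
    rw [D.T_T h.symm (F.basis_mem b) (F.dual_mem b), smul_smul, ← sgn_add,
      show F.trp * F.par b + F.par b * (F.par b + F.trp) = F.par b by
        generalize F.trp = p; generalize F.par b = q; revert p q; decide]
    conv_lhs => rw [← F.sum_tr_dual_mul_smul_basis (F.dual b)]
    simp only [map_sum, map_smul, Finset.sum_mul, Finset.smul_sum, smul_mul_assoc, smul_smul]
  rw [e1, Finset.sum_comm, tau, Finset.smul_sum]
  refine Finset.sum_congr rfl fun c _ => ?_
  conv_rhs => rw [← F.sum_tr_dual_mul_smul_basis (F.dual c)]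
  simp only [map_sum, map_smul, Finset.mul_sum, Finset.smul_sum, mul_smul_comm, smul_smul]
  refine Finset.sum_congr rfl fun b _ => ?_
  congr 1
  rw [F.tr_symm _ _ _ _ (F.dual_mem c) (F.dual_mem b)]
  -- The signs have to agree only for those parities where the trace can be nonzero; otherwise both
  -- coefficients vanish.
  by_cases hbc : F.par b + F.trp + (F.par c + F.trp) = F.trp
  · rw [← mul_assoc, ← mul_assoc, ← sgn_add, ← sgn_add]
    congr 2
    generalize F.trp = p at *
    generalize F.par c = q at *
    generalize F.par b = r at *
    revert p q r; decide
  · rw [F.tr_eq_zero (SetLike.mul_mem_graded (F.dual_mem b) (F.dual_mem c)) hbc]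
    simp

/-- Tokens teleport: with `basis b * a` expanded in the basis and `a * dual d` in the dual basis,
the coefficients are the traces of `dual d * basis b * a` and of `a * dual d * basis b`, which agree
up to sign by supersymmetry. -/
theorem T_mul_tau {i j : J} (h : i ≠ j) {c : ZMod 2} {a : A} (ha : a ∈ 𝒜 c) :
    D.T j a * D.tau i j = sgn k (F.trp * c) • (D.tau i j * D.T i a) := by
  have e1 : sgn k (F.trp * c) • (D.tau i j * D.T i a) = ∑ b, ∑ d,
      (sgn k (F.trp * F.par b + F.par b * c) * F.tr (F.dual d * (F.basis b * a))) •
        (D.T i (F.basis d) * D.T j (F.dual b)) := by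
    rw [tau, Finset.sum_mul, Finset.smul_sum]
    refine Finset.sum_congr rfl fun b _ => ?_
    rw [smul_mul_assoc, mul_assoc, D.T_T h.symm (F.dual_mem b) ha, mul_smul_comm, ← mul_assoc,
      ← D.T_mul, smul_smul, smul_smul, ← sgn_add, ← sgn_add]
    conv_lhs => rw [← F.sum_tr_dual_mul_smul_basis (F.basis b * a)]
    simp only [map_sum, map_smul, Finset.sum_mul, Finset.smul_sum, smul_mul_assoc, smul_smul]
    refine Finset.sum_congr rfl fun d _ => ?_
    congr 3
    generalize F.trp = p
    generalize F.par b = q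
    clear ha
    revert p q c; decide
  rw [e1, Finset.sum_comm, tau, Finset.mul_sum]
  refine Finset.sum_congr rfl fun d _ => ?_
  rw [mul_smul_comm, ← mul_assoc, D.T_T h.symm ha (F.basis_mem d), smul_mul_assoc, mul_assoc,
    ← D.T_mul, smul_smul]
  conv_lhs => rw [← F.sum_tr_mul_basis_smul_dual (a * F.dual d)]
  simp only [map_sum, map_smul, Finset.mul_sum, Finset.smul_sum, mul_smul_comm, smul_smul]
  refine Finset.sum_congr rfl fun b _ => ?_
  congr 1
  have hdb := SetLike.mul_mem_graded (F.dual_mem d) (F.basis_mem b)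
  rw [mul_assoc a, F.tr_symm _ _ _ _ ha hdb, ← mul_assoc, ← sgn_add, ← sgn_add]
  rw [← mul_assoc (F.dual d)]
  by_cases hz : F.par d + F.trp + F.par b + c = F.trp
  · congr 2
    generalize F.trp = p at *
    generalize F.par b = q at *
    generalize F.par d = r at *
    clear ha e1 hdb
    revert p q r c; decide
  · rw [F.tr_eq_zero (SetLike.mul_mem_graded hdb ha) hz]
    simp

theorem T_mul_tau' {i j : J} (h : i ≠ j) {c : ZMod 2} {a : A} (ha : a ∈ 𝒜 c) :
    D.T i a * D.tau i j = sgn k (F.trp * c) • (D.tau i j * D.T j a) := by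
  rw [D.tau_swap h.symm, mul_smul_comm, D.T_mul_tau h.symm ha, smul_mul_assoc, smul_comm]

theorem T_mul_tau_of_ne {i j l : J} (hi : l ≠ i) (hj : l ≠ j) {c : ZMod 2} {a : A}
    (ha : a ∈ 𝒜 c) : D.T l a * D.tau i j = sgn k (F.trp * c) • (D.tau i j * D.T l a) := by
  rw [tau, Finset.mul_sum, Finset.sum_mul, Finset.smul_sum]
  refine Finset.sum_congr rfl fun b _ => ?_
  rw [mul_smul_comm, ← mul_assoc, D.T_T hi ha (F.basis_mem b), smul_mul_assoc, mul_assoc,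
    D.T_T hj ha (F.dual_mem b), mul_smul_comm, smul_mul_assoc, ← mul_assoc, smul_smul, smul_smul,
    smul_smul, mul_assoc, ← sgn_add, ← sgn_add, ← sgn_add]
  congr 2
  generalize F.trp = p
  generalize F.par b = q
  clear ha
  revert p q c; decide

/-- Each summand of the teleporter has parity `trp`, as does a dot, and both tokens supercommute
with dots even on the same strand. -/
theorem tau_mul_X (i j l : J) : D.tau i j * D.X l = sgn k F.trp • (D.X l * D.tau i j) := by
  rw [tau, Finset.mul_sum, Finset.sum_mul, Finset.smul_sum]
  refine Finset.sum_congr rfl fun b _ => ?_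
  rw [smul_mul_assoc, mul_assoc, D.T_X j l (F.dual_mem b), mul_smul_comm, ← mul_assoc,
    D.T_X i l (F.basis_mem b), smul_mul_assoc, mul_smul_comm, mul_assoc, smul_smul, smul_smul,
    smul_smul, mul_assoc, ← sgn_add, ← sgn_add, ← sgn_add]
  congr 2
  generalize F.trp = p
  generalize F.par b = q
  revert p q; decide

/-- The image of a family of dots and tokens under a homomorphism of algebras. -/
def map {E' : Type*} [Ring E'] [Algebra k E'] (f : E →ₐ[k] E') : DotTokens F J E' where
  X j := f (D.X j)
  T j := f.toLinearMap ∘ₗ D.T j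
  T_one j := by simp [D.T_one]
  T_mul j a b := by simp [D.T_mul]
  T_T h ha hb := by simp [← map_mul, D.T_T h ha hb]
  T_X i j _ _ ha := by simp [← map_mul, D.T_X i j ha]
  X_X h := by simp [← map_mul, D.X_X h]

theorem map_tau {E' : Type*} [Ring E'] [Algebra k E'] (f : E →ₐ[k] E') (i j : J) :
    (D.map f).tau i j = f (D.tau i j) := by
  simp [tau, map]

end DotTokens

end FrobNilHecke
-- Sorting products: the standard monomials span.
namespace FrobNilHecke

universe u v w

section Adjoin

variable {k E : Type*} [CommRing k] [Ring E] [Algebra k E]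

theorem adjoin_mul_mem {S : Submodule k E} {G : Set E} (h : ∀ g ∈ G, ∀ y ∈ S, g * y ∈ S) {f y : E}
    (hf : f ∈ Algebra.adjoin k G) (hy : y ∈ S) : f * y ∈ S := by
  induction hf using Algebra.adjoin_induction generalizing y with
  | mem g hg => exact h g hg y hy
  | algebraMap r => rw [← Algebra.smul_def]; exact S.smul_mem r hy
  | add f g _ _ hf hg => rw [add_mul]; exact add_mem (hf hy) (hg hy)
  | mul f g _ _ hf hg => rw [mul_assoc]; exact hf (hg hy)

theorem adjoin_le_of_mul_mem {S : Submodule k E} {G : Set E} (h1 : 1 ∈ S)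
    (h : ∀ g ∈ G, ∀ y ∈ S, g * y ∈ S) : Subalgebra.toSubmodule (Algebra.adjoin k G) ≤ S := by
  intro f hf
  have := adjoin_mul_mem h hf h1
  rwa [mul_one] at this

end Adjoin

variable {k : Type u} {A : Type v} [CommRing k] [Ring A] [Algebra k A]
  {𝒜 : ZMod 2 → Submodule k A} [GradedAlgebra 𝒜] {ι : Type w} [Fintype ι] [DecidableEq ι]

namespace DotTokens

variable {F : SymmFrobenius k 𝒜 ι} {J E : Type*} [Ring E] [Algebra k E] (D : DotTokens F J E)

/-- The dots and the tokens. -/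
def gens : Set E := Set.range D.X ∪ {y | ∃ j a, D.T j a = y}

/-- A product of tokens, one on each strand in the list `L`. -/
def tokenMon (L : List J) (c : J → A) : E := (L.map fun j => D.T j (c j)).prod

/-- A product of powers of dots, one on each strand in the list `L`. -/
def dotMon (L : List J) (e : J → ℕ) : E := (L.map fun j => D.X j ^ e j).prod

/-- The span of products of tokens labelled by basis elements. -/
noncomputable def tokenSpan (L : List J) : Submodule k E :=
  Submodule.span k (Set.range fun c : J → ι => D.tokenMon L fun j => F.basis (c j))

/-- The span of the monomials in dots. -/
def dotSpan (L : List J) : Submodule k E :=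
  Submodule.span k (Set.range fun e : J → ℕ => D.dotMon L e)

theorem tokenMon_cons (i : J) (L : List J) (c : J → A) :
    D.tokenMon (i :: L) c = D.T i (c i) * D.tokenMon L c := by
  simp [tokenMon]

theorem dotMon_cons (i : J) (L : List J) (e : J → ℕ) :
    D.dotMon (i :: L) e = D.X i ^ e i * D.dotMon L e := by
  simp [dotMon]

theorem T_mul_mem_tokenSpan_cons [DecidableEq J] {i : J} {L : List J} (hi : i ∉ L) (a : A) {y : E}
    (hy : y ∈ D.tokenSpan L) : D.T i a * y ∈ D.tokenSpan (i :: L) := by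
  induction hy using Submodule.span_induction with
  | mem y hy =>
    obtain ⟨c, rfl⟩ := hy
    rw [← F.basis.sum_repr a, map_sum, Finset.sum_mul]
    refine sum_mem fun d _ => ?_
    rw [map_smul, smul_mul_assoc]
    -- Strand `i` does not occur in `L`, so overwriting its label leaves the rest of the product
    -- unchanged.
    refine Submodule.smul_mem _ _ (Submodule.subset_span ⟨Function.update c i d, ?_⟩)
    simp only [tokenMon, List.map_cons, List.prod_cons, Function.update_self]
    congr 2
    refine List.map_congr_left fun j hj => ?_
    rw [Function.update_of_ne (ne_of_mem_of_not_mem hj hi)]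
  | zero => rw [mul_zero]; exact zero_mem _
  | add x y _ _ hx hy => rw [mul_add]; exact add_mem hx hy
  | smul r x _ hx => rw [mul_smul_comm]; exact Submodule.smul_mem _ r hx

theorem T_mul_mem_tokenSpan [DecidableEq J] {L : List J} (hL : L.Nodup) {i : J} (hi : i ∈ L) (a : A)
    {y : E} (hy : y ∈ D.tokenSpan L) : D.T i a * y ∈ D.tokenSpan L := by
  induction L generalizing a y with
  | nil => simp at hi
  | cons j L ih =>
    rw [List.nodup_cons] at hL
    induction hy using Submodule.span_induction with
    | mem y hy =>
      obtain ⟨c, rfl⟩ := hy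
      have hc : D.tokenMon L (fun j => F.basis (c j)) ∈ D.tokenSpan L :=
        Submodule.subset_span ⟨c, rfl⟩
      simp only [D.tokenMon_cons]
      by_cases hij : i = j
      · subst hij
        rw [← mul_assoc, ← D.T_mul]
        exact D.T_mul_mem_tokenSpan_cons hL.1 _ hc
      · induction a using parity_induction 𝒜 with
        | hom s a ha =>
          rw [← mul_assoc, D.T_T hij ha (F.basis_mem _), smul_mul_assoc, mul_assoc]
          refine Submodule.smul_mem _ _ (D.T_mul_mem_tokenSpan_cons hL.1 _ (ih hL.2 ?_ a hc))
          simpa [hij] using hi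
        | add a b ha hb => rw [map_add, add_mul]; exact add_mem ha hb
    | zero => rw [mul_zero]; exact zero_mem _
    | add x y _ _ hx hy => rw [mul_add]; exact add_mem hx hy
    | smul r x _ hx => rw [mul_smul_comm]; exact Submodule.smul_mem _ r hx

theorem X_pow_mul_mem_dotSpan_cons [DecidableEq J] {i : J} {L : List J} (hi : i ∉ L) (d : ℕ) {y : E}
    (hy : y ∈ D.dotSpan L) : D.X i ^ d * y ∈ D.dotSpan (i :: L) := by
  induction hy using Submodule.span_induction with
  | mem y hy =>
    obtain ⟨c, rfl⟩ := hy
    refine Submodule.subset_span ⟨Function.update c i d, ?_⟩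
    simp only [dotMon, List.map_cons, List.prod_cons, Function.update_self]
    congr 2
    refine List.map_congr_left fun j hj => ?_
    rw [Function.update_of_ne (ne_of_mem_of_not_mem hj hi)]
  | zero => rw [mul_zero]; exact zero_mem _
  | add x y _ _ hx hy => rw [mul_add]; exact add_mem hx hy
  | smul r x _ hx => rw [mul_smul_comm]; exact Submodule.smul_mem _ r hx

/-- Only membership in a span is at stake, so the sign is left as an unspecified scalar. -/
theorem X_mul_X_pow {i j : J} (h : i ≠ j) (d : ℕ) :
    ∃ r : k, D.X i * D.X j ^ d = r • (D.X j ^ d * D.X i) := by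
  induction d with
  | zero => exact ⟨1, by simp⟩
  | succ d ih =>
    obtain ⟨r, hr⟩ := ih
    refine ⟨r * sgn k F.trp, ?_⟩
    rw [pow_succ, ← mul_assoc, hr, smul_mul_assoc, mul_assoc, D.X_X h, mul_smul_comm, smul_smul,
      mul_assoc]

theorem X_mul_mem_dotSpan [DecidableEq J] {L : List J} (hL : L.Nodup) {i : J} (hi : i ∈ L)
    {y : E} (hy : y ∈ D.dotSpan L) : D.X i * y ∈ D.dotSpan L := by
  induction L generalizing y with
  | nil => simp at hi
  | cons j L ih =>
    rw [List.nodup_cons] at hL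
    induction hy using Submodule.span_induction with
    | mem y hy =>
      obtain ⟨c, rfl⟩ := hy
      have hc : D.dotMon L c ∈ D.dotSpan L := Submodule.subset_span ⟨c, rfl⟩
      simp only [D.dotMon_cons]
      by_cases hij : i = j
      · subst hij
        rw [← mul_assoc, ← pow_succ']
        exact D.X_pow_mul_mem_dotSpan_cons hL.1 _ hc
      · obtain ⟨r, hr⟩ := D.X_mul_X_pow hij (c j)
        rw [← mul_assoc, hr, smul_mul_assoc, mul_assoc]
        refine Submodule.smul_mem _ _ (D.X_pow_mul_mem_dotSpan_cons hL.1 _ (ih hL.2 ?_ hc))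
        simpa [hij] using hi
    | zero => rw [mul_zero]; exact zero_mem _
    | add x y _ _ hx hy => rw [mul_add]; exact add_mem hx hy
    | smul r x _ hx => rw [mul_smul_comm]; exact Submodule.smul_mem _ r hx

theorem X_mul_tokenMon (i : J) (L : List J) (c : J → ι) :
    ∃ r : k, D.X i * D.tokenMon L (fun j => F.basis (c j)) =
      r • (D.tokenMon L (fun j => F.basis (c j)) * D.X i) := by
  induction L with
  | nil => exact ⟨1, by simp [tokenMon]⟩
  | cons j L ih =>
    obtain ⟨r, hr⟩ := ih
    have h : D.X i * D.T j (F.basis (c j)) =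
        sgn k (F.trp * F.par (c j)) • (D.T j (F.basis (c j)) * D.X i) := by
      rw [D.T_X j i (F.basis_mem (c j)), smul_smul, sgn_mul_self, one_smul]
    refine ⟨sgn k (F.trp * F.par (c j)) * r, ?_⟩
    rw [D.tokenMon_cons, ← mul_assoc, h, smul_mul_assoc, mul_assoc, hr, mul_smul_comm, smul_smul,
      mul_assoc]

theorem one_mem_tokenSpan [DecidableEq J] {L : List J} (hL : L.Nodup) : 1 ∈ D.tokenSpan L := by
  induction L with
  | nil =>
    by_cases h : Nonempty (J → ι)
    · exact Submodule.subset_span ⟨h.some, by simp [tokenMon]⟩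
    -- If there is no labelling, some strand exists but the basis of `A` is empty; then `A` is zero,
    -- and `E` is zero because `T j` is unital.
    · have : ∃ j : J, IsEmpty ι := by
        by_contra h'
        push Not at h'
        exact h ⟨fun j => (h' j).some⟩
      obtain ⟨j, hj⟩ := this
      have h1 : (1 : A) = 0 := by
        rw [← F.basis.sum_repr 1, Finset.univ_eq_empty, Finset.sum_empty]
      have : (1 : E) = 0 := by rw [← D.T_one j, h1, map_zero]
      rw [this]
      exact zero_mem _
  | cons j L ih =>
    rw [List.nodup_cons] at hL
    have := D.T_mul_mem_tokenSpan_cons hL.1 1 (ih hL.2)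
    rwa [D.T_one, one_mul] at this

/-- The product of the two spans contains `1` and is stable under left multiplication by generators:
a token is absorbed by the token part, and a dot passes through the tokens up to sign and is
absorbed by the dot part. -/
theorem adjoin_gens_le [DecidableEq J] {L L' : List J} (hL : L.Nodup) (hL' : L'.Nodup)
    (h : ∀ j, j ∈ L) (h' : ∀ j, j ∈ L') :
    Subalgebra.toSubmodule (Algebra.adjoin k D.gens) ≤ D.tokenSpan L * D.dotSpan L' := by
  refine adjoin_le_of_mul_mem ?_ ?_
  · rw [← mul_one (1 : E)]
    exact Submodule.mul_mem_mul (D.one_mem_tokenSpan hL)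
      (Submodule.subset_span ⟨0, by simp [dotMon]⟩)
  · rintro _ (⟨i, rfl⟩ | ⟨i, a, rfl⟩) y hy
    · induction hy using Submodule.mul_induction_on' with
      | mem_mul_mem y hy z hz =>
        induction hy using Submodule.span_induction with
        | mem y hy =>
          obtain ⟨c, rfl⟩ := hy
          obtain ⟨r, hr⟩ := D.X_mul_tokenMon i L c
          simp only
          rw [← mul_assoc, hr, smul_mul_assoc, mul_assoc]
          exact Submodule.smul_mem _ _ (Submodule.mul_mem_mul (Submodule.subset_span ⟨c, rfl⟩)
            (D.X_mul_mem_dotSpan hL' (h' i) hz))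
        | zero => rw [zero_mul, mul_zero]; exact zero_mem _
        | add x y _ _ hx hy => rw [add_mul, mul_add]; exact add_mem hx hy
        | smul r x _ hx =>
          rw [smul_mul_assoc, mul_smul_comm]; exact Submodule.smul_mem _ r hx
      | add x _ y _ hx hy => rw [mul_add]; exact add_mem hx hy
    · induction hy using Submodule.mul_induction_on' with
      | mem_mul_mem y hy z hz =>
        rw [← mul_assoc]
        exact Submodule.mul_mem_mul (D.T_mul_mem_tokenSpan hL (h i) a hy) hz
      | add x _ y _ hx hy => rw [mul_add]; exact add_mem hx hy

/-- The correction term for moving a dot on strand `j` through the `i`-th crossing. -/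
noncomputable def delta {n : ℕ} (D : DotTokens F (Fin n) E) (i : Fin (n - 1)) (j : Fin n) : E :=
  if j = hi i then D.tau (hi i) (lo i) else if j = lo i then -D.tau (lo i) (hi i) else 0

end DotTokens

/-- Families of dots, tokens and crossings which satisfy all the relations of the Frobenius nilHecke
algebra that involve at most one crossing. -/
structure CrossingFamily (F : SymmFrobenius k 𝒜 ι) (n : ℕ) (E : Type*) [Ring E] [Algebra k E]
    extends DotTokens F (Fin n) E where
  /-- the crossings -/
  U : Fin (n - 1) → E
  U_T : ∀ i j a, U i * T j a = T (simpleTransposition i j) a * U i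
  U_X : ∀ i j, U i * X j = X (simpleTransposition i j) * U i + toDotTokens.delta i j

/-- Families of dots, tokens and crossings which satisfy the relations of the Frobenius nilHecke
algebra. -/
structure NilHeckeFamily (F : SymmFrobenius k 𝒜 ι) (n : ℕ) (E : Type*) [Ring E] [Algebra k E]
    extends CrossingFamily F n E where
  U_sq : ∀ i, U i * U i = 0
  U_braid : ∀ i j : Fin (n - 1), (i : ℕ) + 1 = j → U i * (U j * U i) = U j * (U i * U j)
  U_far : ∀ i j : Fin (n - 1), (i : ℕ) + 1 < j → U i * U j = U j * U i

namespace DotTokens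

variable {F : SymmFrobenius k 𝒜 ι} {n : ℕ} {E : Type*} [Ring E] [Algebra k E]
  (D : DotTokens F (Fin n) E)

theorem delta_hi (i : Fin (n - 1)) : D.delta i (hi i) = D.tau (hi i) (lo i) := if_pos rfl

theorem delta_lo (i : Fin (n - 1)) : D.delta i (lo i) = -D.tau (lo i) (hi i) := by
  rw [delta, if_neg (lo_ne_hi i), if_pos rfl]

theorem delta_of_ne {i : Fin (n - 1)} {j : Fin n} (h : j ≠ lo i) (h' : j ≠ hi i) :
    D.delta i j = 0 := by
  rw [delta, if_neg h', if_neg h]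

theorem T_mem (j : Fin n) (a : A) : D.T j a ∈ Algebra.adjoin k D.gens :=
  Algebra.subset_adjoin (Or.inr ⟨j, a, rfl⟩)

theorem X_mem (j : Fin n) : D.X j ∈ Algebra.adjoin k D.gens :=
  Algebra.subset_adjoin (Or.inl ⟨j, rfl⟩)

theorem tau_mem (i j : Fin n) : D.tau i j ∈ Algebra.adjoin k D.gens :=
  sum_mem fun _ _ => Subalgebra.smul_mem _ (mul_mem (D.T_mem _ _) (D.T_mem _ _)) _

theorem delta_mem (i : Fin (n - 1)) (j : Fin n) : D.delta i j ∈ Algebra.adjoin k D.gens := by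
  rw [delta]
  split_ifs
  exacts [D.tau_mem _ _, neg_mem (D.tau_mem _ _), zero_mem _]

end DotTokens

namespace CrossingFamily

variable {F : SymmFrobenius k 𝒜 ι} {n : ℕ} {E : Type*} [Ring E] [Algebra k E]
  (D : CrossingFamily F n E)

theorem U_tau (i : Fin (n - 1)) (p q : Fin n) :
    D.U i * D.tau p q = D.tau (simpleTransposition i p) (simpleTransposition i q) * D.U i := by
  rw [DotTokens.tau, DotTokens.tau, Finset.mul_sum, Finset.sum_mul]
  refine Finset.sum_congr rfl fun b _ => ?_
  rw [mul_smul_comm, ← mul_assoc, D.U_T, mul_assoc, D.U_T, smul_mul_assoc, mul_assoc]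

/-- The set of `f` that a crossing can be moved past, with a remainder free of crossings, is a
subalgebra containing the generators. -/
theorem U_mul_adjoin (i : Fin (n - 1)) {f : E} (hf : f ∈ Algebra.adjoin k D.gens) :
    ∃ f' ∈ Algebra.adjoin k D.gens, ∃ f'' ∈ Algebra.adjoin k D.gens,
      D.U i * f = f' * D.U i + f'' := by
  induction hf using Algebra.adjoin_induction with
  | mem g hg =>
    obtain ⟨j, rfl⟩ | ⟨j, a, rfl⟩ := hg
    · exact ⟨_, D.X_mem _, _, D.delta_mem i j, D.U_X i j⟩
    · exact ⟨_, D.T_mem _ _, 0, zero_mem _, by rw [D.U_T, add_zero]⟩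
  | algebraMap r =>
    exact ⟨_, Subalgebra.algebraMap_mem _ r, 0, zero_mem _, by rw [← Algebra.commutes, add_zero]⟩
  | add f g _ _ hf hg =>
    obtain ⟨f', hf', f'', hf'', h⟩ := hf
    obtain ⟨g', hg', g'', hg'', h'⟩ := hg
    exact ⟨_, add_mem hf' hg', _, add_mem hf'' hg'', by rw [mul_add, h, h', add_mul]; abel⟩
  | mul f g hf0 hg0 hf hg =>
    obtain ⟨f', hf', f'', hf'', h⟩ := hf
    obtain ⟨g', hg', g'', hg'', h'⟩ := hg
    refine ⟨_, mul_mem hf' hg', _, add_mem (mul_mem hf' hg'') (mul_mem hf'' hg0), ?_⟩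
    rw [← mul_assoc, h, add_mul, mul_assoc, h', mul_add, mul_assoc, add_assoc]

end CrossingFamily

namespace NilHeckeFamily

variable {F : SymmFrobenius k 𝒜 ι} {n : ℕ} {E : Type*} [Ring E] [Algebra k E]
  (D : NilHeckeFamily F n E)

/-- The product of crossings along the chosen reduced word of a permutation. -/
noncomputable def permCrossing (w : Equiv.Perm (Fin n)) : E :=
  ((exists_isReducedWord w).choose.map D.U).prod

theorem prod_eq_permCrossing {l : List (Fin (n - 1))} {w : Equiv.Perm (Fin n)}
    (h : IsReducedWord l w) : (l.map D.U).prod = D.permCrossing w :=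
  prod_eq_of_isReducedWord D.U D.U_braid D.U_far h (exists_isReducedWord w).choose_spec

theorem permCrossing_one : D.permCrossing 1 = 1 :=
  (D.prod_eq_permCrossing (l := []) (isReducedWord_iff.2 ⟨rfl, inv_one.symm⟩)).symm

theorem U_mul_permCrossing_of_isAscent {i : Fin (n - 1)} {w : Equiv.Perm (Fin n)}
    (h : IsAscent i w) : D.U i * D.permCrossing w = D.permCrossing (simpleTransposition i * w) := by
  obtain ⟨l, hl⟩ := exists_isReducedWord w
  rw [← D.prod_eq_permCrossing hl, ← D.prod_eq_permCrossing (isReducedWord_cons_mul h hl)]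
  simp

theorem U_mul_permCrossing_of_not_isAscent {i : Fin (n - 1)} {w : Equiv.Perm (Fin n)}
    (h : ¬ IsAscent i w) : D.U i * D.permCrossing w = 0 := by
  have := D.U_mul_permCrossing_of_isAscent ((isAscent_mul_iff i w).2 h)
  rw [simpleTransposition_mul_cancel] at this
  rw [← this, ← mul_assoc, D.U_sq, zero_mul]

/-- The standard monomials. -/
noncomputable def monomial (L L' : List (Fin n))
    (q : (Fin n → ι) × (Fin n → ℕ) × Equiv.Perm (Fin n)) : E :=
  D.tokenMon L (fun j => F.basis (q.1 j)) * D.dotMon L' q.2.1 * D.permCrossing q.2.2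

/-- The product of the subalgebra of dots and tokens with the span `S` of the `u_w` contains `1` and
is a left ideal: dots and tokens are absorbed on the left, and a crossing moves through to `S`,
which it preserves. -/
theorem span_monomial_eq_top (htop : Algebra.adjoin k (D.gens ∪ Set.range D.U) = ⊤)
    {L L' : List (Fin n)} (hL : L.Nodup) (hL' : L'.Nodup) (h : ∀ j, j ∈ L) (h' : ∀ j, j ∈ L') :
    Submodule.span k (Set.range (D.monomial L L')) = ⊤ := by
  set S := Submodule.span k (Set.range D.permCrossing) with hS
  have hUS : ∀ i, ∀ y ∈ S, D.U i * y ∈ S := by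
    intro i y hy
    induction hy using Submodule.span_induction with
    | mem y hy =>
      obtain ⟨w, rfl⟩ := hy
      by_cases hw : IsAscent i w
      · rw [D.U_mul_permCrossing_of_isAscent hw]
        exact Submodule.subset_span ⟨_, rfl⟩
      · rw [D.U_mul_permCrossing_of_not_isAscent hw]
        exact zero_mem _
    | zero => rw [mul_zero]; exact zero_mem _
    | add x y _ _ hx hy => rw [mul_add]; exact add_mem hx hy
    | smul r x _ hx => rw [mul_smul_comm]; exact Submodule.smul_mem _ r hx
  have h1 : Subalgebra.toSubmodule (Algebra.adjoin k (D.gens ∪ Set.range D.U)) ≤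
      Subalgebra.toSubmodule (Algebra.adjoin k D.gens) * S := by
    refine adjoin_le_of_mul_mem ?_ ?_
    · rw [← mul_one (1 : E)]
      exact Submodule.mul_mem_mul (one_mem (Algebra.adjoin k D.gens))
        (Submodule.subset_span ⟨1, D.permCrossing_one⟩)
    · rintro g hg y hy
      induction hy using Submodule.mul_induction_on' with
      | mem_mul_mem y hy z hz =>
        obtain hg | ⟨i, rfl⟩ := hg
        · rw [← mul_assoc]
          exact Submodule.mul_mem_mul
            (Subalgebra.mul_mem _ (Algebra.subset_adjoin hg) hy) hz
        · obtain ⟨y', hy', y'', hy'', e⟩ := D.U_mul_adjoin i hy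
          rw [← mul_assoc, e, add_mul, mul_assoc]
          exact add_mem (Submodule.mul_mem_mul hy' (hUS i z hz)) (Submodule.mul_mem_mul hy'' hz)
      | add x _ y _ hx hy => rw [mul_add]; exact add_mem hx hy
  have h2 : D.tokenSpan L * D.dotSpan L' * S = Submodule.span k (Set.range (D.monomial L L')) := by
    rw [DotTokens.tokenSpan, DotTokens.dotSpan, hS, Submodule.span_mul_span,
      Submodule.span_mul_span]
    congr 1
    ext y
    simp only [Set.mem_mul, Set.mem_range, monomial, Prod.exists]
    constructor
    · rintro ⟨_, ⟨_, ⟨c, rfl⟩, _, ⟨e, rfl⟩, rfl⟩, _, ⟨w, rfl⟩, rfl⟩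
      exact ⟨c, e, w, rfl⟩
    · rintro ⟨c, e, w, rfl⟩
      exact ⟨_, ⟨_, ⟨c, rfl⟩, _, ⟨e, rfl⟩, rfl⟩, _, ⟨w, rfl⟩, rfl⟩
  rw [← h2, eq_top_iff]
  calc (⊤ : Submodule k E) = Subalgebra.toSubmodule (Algebra.adjoin k (D.gens ∪ Set.range D.U)) := by
        rw [htop, Algebra.top_toSubmodule]
    _ ≤ _ := h1
    _ ≤ _ := mul_le_mul_left (D.adjoin_gens_le hL hL' h h') _

end NilHeckeFamily

end FrobNilHecke
-- The algebra of dots and tokens, divided differences and the model space.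
namespace FrobNilHecke

universe u v w

variable {k : Type u} {A : Type v} [CommRing k] [Ring A] [Algebra k A]
  {𝒜 : ZMod 2 → Submodule k A} [GradedAlgebra 𝒜] {ι : Type w} [Fintype ι] [DecidableEq ι]

section DotTokenAlgebra

variable (F : SymmFrobenius k 𝒜 ι) (J : Type)

/-- The defining relations of the algebra generated by dots and tokens. -/
inductive DotTokenRel : FreeAlgebra k (J ⊕ J × A) → FreeAlgebra k (J ⊕ J × A) → Prop
  | T_add (j : J) (a b : A) : DotTokenRel (FreeAlgebra.ι k (.inr (j, a + b)))
      (FreeAlgebra.ι k (.inr (j, a)) + FreeAlgebra.ι k (.inr (j, b)))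
  | T_smul (j : J) (r : k) (a : A) : DotTokenRel (FreeAlgebra.ι k (.inr (j, r • a)))
      (r • FreeAlgebra.ι k (.inr (j, a)))
  | T_one (j : J) : DotTokenRel (FreeAlgebra.ι k (.inr (j, 1))) 1
  | T_mul (j : J) (a b : A) : DotTokenRel (FreeAlgebra.ι k (.inr (j, a * b)))
      (FreeAlgebra.ι k (.inr (j, a)) * FreeAlgebra.ι k (.inr (j, b)))
  | T_T (i j : J) (c d : ZMod 2) (a b : A) : i ≠ j → a ∈ 𝒜 c → b ∈ 𝒜 d →
      DotTokenRel (FreeAlgebra.ι k (.inr (i, a)) * FreeAlgebra.ι k (.inr (j, b)))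
        (sgn k (c * d) • (FreeAlgebra.ι k (.inr (j, b)) * FreeAlgebra.ι k (.inr (i, a))))
  | T_X (i j : J) (c : ZMod 2) (a : A) : a ∈ 𝒜 c →
      DotTokenRel (FreeAlgebra.ι k (.inr (i, a)) * FreeAlgebra.ι k (.inl j))
        (sgn k (F.trp * c) • (FreeAlgebra.ι k (.inl j) * FreeAlgebra.ι k (.inr (i, a))))
  | X_X (i j : J) : i ≠ j →
      DotTokenRel (FreeAlgebra.ι k (.inl i) * FreeAlgebra.ι k (.inl j))
        (sgn k F.trp • (FreeAlgebra.ι k (.inl j) * FreeAlgebra.ι k (.inl i)))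

/-- The algebra generated by dots and tokens on strands labelled by `J`. -/
def DotTokenAlgebra : Type (max u v) := RingQuot (DotTokenRel F J)

namespace DotTokenAlgebra

instance : Ring (DotTokenAlgebra F J) := inferInstanceAs (Ring (RingQuot (DotTokenRel F J)))

instance : Algebra k (DotTokenAlgebra F J) :=
  inferInstanceAs (Algebra k (RingQuot (DotTokenRel F J)))

/-- The quotient map from the free algebra. -/
def mk : FreeAlgebra k (J ⊕ J × A) →ₐ[k] DotTokenAlgebra F J :=
  RingQuot.mkAlgHom k (DotTokenRel F J)

variable {F J}

theorem mk_eq {f g : FreeAlgebra k (J ⊕ J × A)} (h : DotTokenRel F J f g) :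
    mk F J f = mk F J g :=
  RingQuot.mkAlgHom_rel k h

variable (F J)

/-- The generators of the algebra of dots and tokens. -/
def generators : DotTokens F J (DotTokenAlgebra F J) where
  X j := mk F J (FreeAlgebra.ι k (.inl j))
  T j :=
    { toFun := fun a => mk F J (FreeAlgebra.ι k (.inr (j, a)))
      map_add' := fun a b => by rw [mk_eq (.T_add j a b), map_add]
      map_smul' := fun r a => by rw [mk_eq (.T_smul j r a), map_smul]; rfl }
  T_one j := by
    change mk F J _ = _
    rw [mk_eq (.T_one j), map_one]
  T_mul j a b := by
    change mk F J _ = mk F J _ * mk F J _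
    rw [mk_eq (.T_mul j a b), map_mul]
  T_T h ha hb := by
    change mk F J _ * mk F J _ = _ • (mk F J _ * mk F J _)
    rw [← map_mul, mk_eq (.T_T _ _ _ _ _ _ h ha hb), map_smul, map_mul]
  T_X i j _ _ ha := by
    change mk F J _ * mk F J _ = _ • (mk F J _ * mk F J _)
    rw [← map_mul, mk_eq (.T_X i j _ _ ha), map_smul, map_mul]
  X_X h := by
    change mk F J _ * mk F J _ = _ • (mk F J _ * mk F J _)
    rw [← map_mul, mk_eq (.X_X _ _ h), map_smul, map_mul]

variable {F J} {E : Type*} [Ring E] [Algebra k E]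

/-- The universal property of the algebra of dots and tokens. -/
noncomputable def lift (D : DotTokens F J E) : DotTokenAlgebra F J →ₐ[k] E :=
  RingQuot.liftAlgHom k ⟨FreeAlgebra.lift k (Sum.elim D.X fun q => D.T q.1 q.2), by
    intro f g h
    induction h with
    | T_add j a b => simp
    | T_smul j r a => simp
    | T_one j => simp [D.T_one]
    | T_mul j a b => simp [D.T_mul]
    | T_T i j c d a b h ha hb => simp [D.T_T h ha hb]
    | T_X i j c a ha => simp [D.T_X i j ha]
    | X_X i j h => simp [D.X_X h]⟩

@[simp] theorem lift_X (D : DotTokens F J E) (j : J) : lift D ((generators F J).X j) = D.X j :=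
  (RingQuot.liftAlgHom_mkAlgHom_apply k _ _ _).trans (by simp)

@[simp] theorem lift_T (D : DotTokens F J E) (j : J) (a : A) :
    lift D ((generators F J).T j a) = D.T j a :=
  (RingQuot.liftAlgHom_mkAlgHom_apply k _ _ _).trans (by simp)

theorem adjoin_gens : Algebra.adjoin k (generators F J).gens = ⊤ := by
  rw [eq_top_iff]
  rintro f -
  obtain ⟨f, rfl⟩ := RingQuot.mkAlgHom_surjective k (DotTokenRel F J) f
  induction f using FreeAlgebra.induction with
  | grade0 r => rw [AlgHom.commutes]; exact Subalgebra.algebraMap_mem _ r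
  | grade1 x =>
    refine Algebra.subset_adjoin ?_
    rcases x with j | ⟨j, a⟩
    exacts [Or.inl ⟨j, rfl⟩, Or.inr ⟨j, a, rfl⟩]
  | mul f g hf hg => rw [map_mul]; exact mul_mem hf hg
  | add f g hf hg => rw [map_add]; exact add_mem hf hg

end DotTokenAlgebra

end DotTokenAlgebra

namespace DotTokenAlgebra

open Matrix

variable (F : SymmFrobenius k 𝒜 ι) {n : ℕ}

/-- This is the upper right entry of the supercommutation of two dots in `crossingMatrices`, that
is, the compatibility of the twisted Leibniz rule with that relation. -/
theorem X_X_delta (i : Fin (n - 1)) {p q : Fin n} (h : p ≠ q) :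
    (generators F (Fin n)).X (simpleTransposition i p) * (generators F (Fin n)).delta i q +
        (generators F (Fin n)).delta i p * (generators F (Fin n)).X q =
      sgn k F.trp • ((generators F (Fin n)).X (simpleTransposition i q) *
        (generators F (Fin n)).delta i p +
          (generators F (Fin n)).delta i q * (generators F (Fin n)).X p) := by
  set D := generators F (Fin n)
  have hd : ∀ p q, D.delta i p * D.X q = sgn k F.trp • (D.X q * D.delta i p) := by
    intro p q
    rw [DotTokens.delta]
    split_ifs
    · exact D.tau_mul_X _ _ _
    · rw [neg_mul, D.tau_mul_X, mul_neg, smul_neg]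
    · simp
  rw [hd, hd, smul_add, smul_smul, sgn_mul_self, one_smul]
  by_cases hp : p ≠ lo i ∧ p ≠ hi i
  · rw [D.delta_of_ne hp.1 hp.2, simpleTransposition_of_ne hp.1 hp.2]
    simp
  · by_cases hq : q ≠ lo i ∧ q ≠ hi i
    · rw [D.delta_of_ne hq.1 hq.2, simpleTransposition_of_ne hq.1 hq.2]
      simp
    -- When the two dots are exactly those on the crossing, the corrections are proportional by
    -- `tau_swap`, and the terms cancel.
    · have hdl : D.delta i (lo i) = -(sgn k F.trp • D.delta i (hi i)) := by
        rw [D.delta_lo, D.delta_hi, D.tau_swap (lo_ne_hi i).symm]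
      have hp' : p = lo i ∨ p = hi i := by tauto
      have hq' : q = lo i ∨ q = hi i := by tauto
      rcases hp' with rfl | rfl <;> rcases hq' with rfl | rfl
      · exact absurd rfl h
      · rw [hdl]
        simp [smul_smul]
      · rw [hdl]
        simp
      · exact absurd rfl h

/-- The upper right entry of the relation between a token and a dot in `crossingMatrices`. It holds
because a token changes strands when it passes a teleporter attached to its strand. -/
theorem T_delta (i : Fin (n - 1)) (p q : Fin n) {c : ZMod 2} {a : A} (ha : a ∈ 𝒜 c) :
    (generators F (Fin n)).T (simpleTransposition i p) a * (generators F (Fin n)).delta i q =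
      sgn k (F.trp * c) • ((generators F (Fin n)).delta i q * (generators F (Fin n)).T p a) := by
  set D := generators F (Fin n)
  have key : D.T (simpleTransposition i p) a * D.tau (hi i) (lo i) =
      sgn k (F.trp * c) • (D.tau (hi i) (lo i) * D.T p a) := by
    by_cases hp : p = lo i
    · subst hp
      rw [simpleTransposition_lo]
      exact D.T_mul_tau' (lo_ne_hi i).symm ha
    · by_cases hp' : p = hi i
      · subst hp'
        rw [simpleTransposition_hi]
        exact D.T_mul_tau (lo_ne_hi i).symm ha
      · rw [simpleTransposition_of_ne hp hp']
        exact D.T_mul_tau_of_ne hp' hp ha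
  rw [DotTokens.delta]
  split_ifs
  · exact key
  · rw [D.tau_swap (lo_ne_hi i).symm, mul_neg, mul_smul_comm, key, neg_mul, smul_mul_assoc, smul_neg,
      smul_comm]
  · simp

/-- The matrices describing how dots and tokens move through the `i`-th crossing. -/
noncomputable def crossingMatrices (i : Fin (n - 1)) :
    DotTokens F (Fin n) (Matrix (Fin 2) (Fin 2) (DotTokenAlgebra F (Fin n))) where
  -- Multiplying upper triangular matrices with diagonal `s f, f` and corner `∂ f` gives the corner
  -- `s f * ∂ g + ∂ f * g`. Checking the defining relations for these matrices therefore constructs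
  -- the endomorphism `s` and the `s`-twisted derivation `∂` at once.
  X j := !![(generators F (Fin n)).X (simpleTransposition i j), (generators F (Fin n)).delta i j;
    0, (generators F (Fin n)).X j]
  T j :=
    { toFun := fun a => !![(generators F (Fin n)).T (simpleTransposition i j) a, 0;
        0, (generators F (Fin n)).T j a]
      map_add' := fun a b => by simp
      map_smul' := fun r a => by simp }
  T_one j := by simp [DotTokens.T_one, Matrix.one_fin_two]
  T_mul j a b := by simp [DotTokens.T_mul]
  T_T h ha hb := by
    simp [DotTokens.T_T _ h ha hb,
      DotTokens.T_T _ ((simpleTransposition i).injective.ne h) ha hb]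
  T_X p q c a ha := by
    simp [DotTokens.T_X _ _ _ ha, T_delta F i p q ha]
  X_X {p q} h := by
    simp [X_X_delta F i h, DotTokens.X_X _ h,
      DotTokens.X_X _ ((simpleTransposition i).injective.ne h)]

/-- The homomorphism to matrices describing how elements move through the `i`-th crossing. -/
noncomputable def crossingHom (i : Fin (n - 1)) :
    DotTokenAlgebra F (Fin n) →ₐ[k] Matrix (Fin 2) (Fin 2) (DotTokenAlgebra F (Fin n)) :=
  lift (crossingMatrices F i)

/-- Holds on generators and is preserved by sums and products; it is what makes the other two
entries an algebra endomorphism and a twisted derivation. -/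
theorem crossingHom_diag (i : Fin (n - 1)) (f : DotTokenAlgebra F (Fin n)) :
    crossingHom F i f 1 0 = 0 ∧ crossingHom F i f 1 1 = f := by
  have hf : f ∈ Algebra.adjoin k (generators F (Fin n)).gens := by
      rw [adjoin_gens]
      exact Algebra.mem_top
  induction hf using Algebra.adjoin_induction with
  | mem g hg =>
    obtain ⟨j, rfl⟩ | ⟨j, a, rfl⟩ := hg <;> simp [crossingHom, crossingMatrices]
  | algebraMap r => simp [Matrix.algebraMap_matrix_apply]
  | add f g _ _ hf hg => simp [hf, hg]
  | mul f g _ _ hf hg => simp [Matrix.mul_apply, hf, hg]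

/-- The interchange of two strands. -/
noncomputable def swapStrands (i : Fin (n - 1)) :
    DotTokenAlgebra F (Fin n) →ₗ[k] DotTokenAlgebra F (Fin n) :=
  Matrix.entryLinearMap k _ 0 0 ∘ₗ (crossingHom F i).toLinearMap

/-- The divided difference operator. -/
noncomputable def divDiff (i : Fin (n - 1)) :
    DotTokenAlgebra F (Fin n) →ₗ[k] DotTokenAlgebra F (Fin n) :=
  Matrix.entryLinearMap k _ 0 1 ∘ₗ (crossingHom F i).toLinearMap

theorem swapStrands_mul (i : Fin (n - 1)) (f g : DotTokenAlgebra F (Fin n)) :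
    swapStrands F i (f * g) = swapStrands F i f * swapStrands F i g := by
  simp [swapStrands, Matrix.mul_apply, crossingHom_diag]

theorem divDiff_mul (i : Fin (n - 1)) (f g : DotTokenAlgebra F (Fin n)) :
    divDiff F i (f * g) = swapStrands F i f * divDiff F i g + divDiff F i f * g := by
  simp [swapStrands, divDiff, Matrix.mul_apply, crossingHom_diag]

theorem swapStrands_one (i : Fin (n - 1)) : swapStrands F i 1 = 1 := by
  simp [swapStrands]

theorem divDiff_one (i : Fin (n - 1)) : divDiff F i 1 = 0 := by
  simp [divDiff]

theorem swapStrands_X (i : Fin (n - 1)) (j : Fin n) :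
    swapStrands F i ((generators F (Fin n)).X j) =
      (generators F (Fin n)).X (simpleTransposition i j) := by
  simp [swapStrands, crossingHom, crossingMatrices]

theorem swapStrands_T (i : Fin (n - 1)) (j : Fin n) (a : A) :
    swapStrands F i ((generators F (Fin n)).T j a) =
      (generators F (Fin n)).T (simpleTransposition i j) a := by
  simp [swapStrands, crossingHom, crossingMatrices]

theorem divDiff_X (i : Fin (n - 1)) (j : Fin n) :
    divDiff F i ((generators F (Fin n)).X j) = (generators F (Fin n)).delta i j := by
  simp [divDiff, crossingHom, crossingMatrices]

theorem divDiff_T (i : Fin (n - 1)) (j : Fin n) (a : A) :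
    divDiff F i ((generators F (Fin n)).T j a) = 0 := by
  simp [divDiff, crossingHom, crossingMatrices]

end DotTokenAlgebra

/-- The space on which the Frobenius nilHecke algebra acts. -/
abbrev ModelSpace (F : SymmFrobenius k 𝒜 ι) (n : ℕ) : Type (max u v) :=
  Equiv.Perm (Fin n) →₀ DotTokenAlgebra F (Fin n)

namespace ModelSpace

open DotTokenAlgebra

variable (F : SymmFrobenius k 𝒜 ι) (n : ℕ)

/-- Left multiplication by dots and tokens. -/
noncomputable def leftMul :
    DotTokenAlgebra F (Fin n) →ₐ[k] Module.End k (ModelSpace F n) :=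
  Algebra.lsmul k k (ModelSpace F n)

variable {n}

theorem leftMul_single (f g : DotTokenAlgebra F (Fin n)) (w : Equiv.Perm (Fin n)) :
    leftMul F n f (Finsupp.single w g) = Finsupp.single w (f * g) := by
  simp [leftMul]

/-- The action of a crossing. -/
noncomputable def crossing (i : Fin (n - 1)) : Module.End k (ModelSpace F n) :=
  -- With `single w f` read as `f u_w`, this is `u_i f u_w = ∂_i(f) u_w + s_i(f) u_i u_w`, where
  -- `u_i u_w` is zero at a descent.
  Finsupp.lsum k fun w => Finsupp.lsingle w ∘ₗ divDiff F i +
    if IsAscent i w then Finsupp.lsingle (simpleTransposition i * w) ∘ₗ swapStrands F i else 0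

theorem crossing_single (i : Fin (n - 1)) (w : Equiv.Perm (Fin n))
    (f : DotTokenAlgebra F (Fin n)) :
    crossing F i (Finsupp.single w f) = Finsupp.single w (divDiff F i f) +
      if IsAscent i w then Finsupp.single (simpleTransposition i * w) (swapStrands F i f) else 0 := by
  rw [crossing, Finsupp.lsum_single]
  split_ifs <;> simp

theorem crossing_leftMul (i : Fin (n - 1)) (f : DotTokenAlgebra F (Fin n)) :
    crossing F i * leftMul F n f =
      leftMul F n (swapStrands F i f) * crossing F i + leftMul F n (divDiff F i f) := by
  refine Finsupp.lhom_ext fun w g => ?_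
  simp only [Module.End.mul_apply, LinearMap.add_apply, leftMul_single, crossing_single, map_add,
    divDiff_mul, swapStrands_mul, Finsupp.single_add]
  split_ifs <;> simp only [map_zero, leftMul_single] <;> abel

variable (n) in
/-- The dots, tokens and crossings acting on the model space. -/
noncomputable def crossingFamily : CrossingFamily F n (Module.End k (ModelSpace F n)) where
  toDotTokens := (generators F (Fin n)).map (leftMul F n)
  U := crossing F
  U_T i j a := by
    simp only [DotTokens.map, LinearMap.comp_apply, AlgHom.toLinearMap_apply]
    rw [crossing_leftMul, swapStrands_T, divDiff_T, map_zero, add_zero]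
  U_X i j := by
    rw [show ((generators F (Fin n)).map (leftMul F n)).delta i j =
      leftMul F n ((generators F (Fin n)).delta i j) by
        simp only [DotTokens.delta, DotTokens.map_tau]
        split_ifs <;> simp]
    simp only [DotTokens.map]
    rw [crossing_leftMul, swapStrands_X, divDiff_X]

/-- Being movable past generators, possibly turning them into other operators, extends to all of
`DotTokenAlgebra`. Since `single w f` is `f` applied to `single w 1`, such an operator vanishes as
soon as it kills the vectors `single w 1`. -/
theorem eq_zero_of_commutes (B : Module.End k (ModelSpace F n))
    (hX : ∀ j, ∃ f, B * (crossingFamily F n).X j = f * B)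
    (hT : ∀ j a, ∃ f, B * (crossingFamily F n).T j a = f * B)
    (h : ∀ w, B (Finsupp.single w 1) = 0) : B = 0 := by
  have key : ∀ f, ∃ f', B * leftMul F n f = f' * B := by
    intro f
    have hf : f ∈ Algebra.adjoin k (generators F (Fin n)).gens := by
      rw [adjoin_gens]
      exact Algebra.mem_top
    induction hf using Algebra.adjoin_induction with
    | mem g hg =>
      obtain ⟨j, rfl⟩ | ⟨j, a, rfl⟩ := hg
      exacts [hX j, hT j a]
    | algebraMap r =>
      exact ⟨algebraMap k _ r, by rw [AlgHom.commutes, Algebra.commutes]⟩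
    | add f g _ _ hf hg =>
      obtain ⟨f', hf⟩ := hf
      obtain ⟨g', hg⟩ := hg
      exact ⟨f' + g', by rw [map_add, mul_add, hf, hg, add_mul]⟩
    | mul f g _ _ hf hg =>
      obtain ⟨f', hf⟩ := hf
      obtain ⟨g', hg⟩ := hg
      exact ⟨f' * g', by rw [map_mul, ← mul_assoc, hf, mul_assoc, hg, mul_assoc]⟩
  refine Finsupp.lhom_ext fun w f => ?_
  obtain ⟨f', hf⟩ := key f
  have := LinearMap.congr_fun hf (Finsupp.single w 1)
  rw [Module.End.mul_apply, Module.End.mul_apply, leftMul_single, mul_one, h, map_zero] at this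
  rw [this, LinearMap.zero_apply]

theorem crossing_single_one (i : Fin (n - 1)) (w : Equiv.Perm (Fin n)) :
    crossing F i (Finsupp.single w 1) =
      if IsAscent i w then Finsupp.single (simpleTransposition i * w) 1 else 0 := by
  rw [crossing_single, divDiff_one, swapStrands_one, Finsupp.single_zero, zero_add]

end ModelSpace

namespace CrossingFamily

variable {F : SymmFrobenius k 𝒜 ι} {n : ℕ} {E : Type*} [Ring E] [Algebra k E]
  (D : CrossingFamily F n E)

theorem U_X_hi (i : Fin (n - 1)) :
    D.U i * D.X (hi i) = D.X (lo i) * D.U i + D.tau (hi i) (lo i) := by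
  rw [D.U_X, simpleTransposition_hi, D.delta_hi]

theorem U_X_lo (i : Fin (n - 1)) :
    D.U i * D.X (lo i) = D.X (hi i) * D.U i - D.tau (lo i) (hi i) := by
  rw [D.U_X, simpleTransposition_lo, D.delta_lo, sub_eq_add_neg]

theorem U_X_of_ne {i : Fin (n - 1)} {j : Fin n} (h : j ≠ lo i) (h' : j ≠ hi i) :
    D.U i * D.X j = D.X j * D.U i := by
  rw [D.U_X, simpleTransposition_of_ne h h', D.delta_of_ne h h', add_zero]

/-- The two teleporters created by passing both crossings cancel, because a crossing exchanges the
ends of a teleporter. -/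
theorem U_sq_mul_X (i : Fin (n - 1)) (j : Fin n) :
    D.U i * D.U i * D.X j = D.X j * (D.U i * D.U i) := by
  by_cases h : j = lo i
  · subst h
    rw [mul_assoc, D.U_X_lo, mul_sub, ← mul_assoc, D.U_X_hi, D.U_tau, add_mul, simpleTransposition_hi,
      simpleTransposition_lo, mul_assoc, add_sub_cancel_right]
  · by_cases h' : j = hi i
    · subst h'
      rw [mul_assoc, D.U_X_hi, mul_add, ← mul_assoc, D.U_X_lo, D.U_tau, sub_mul,
        simpleTransposition_hi, simpleTransposition_lo, mul_assoc, sub_add_cancel]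
    · rw [mul_assoc, D.U_X_of_ne h h', ← mul_assoc, D.U_X_of_ne h h', mul_assoc]

/-- A crossing commutes with the correction term of a distant crossing, so both orders produce the
same corrections and they cancel in the difference. -/
theorem U_far_mul_X {i j : Fin (n - 1)} (h : (i : ℕ) + 1 < j) (l : Fin n) :
    (D.U i * D.U j - D.U j * D.U i) * D.X l =
      D.X (simpleTransposition i (simpleTransposition j l)) * (D.U i * D.U j - D.U j * D.U i) := by
  obtain ⟨h1, h2, h3, h4⟩ := simpleTransposition_far h
  have hdel : ∀ i j : Fin (n - 1), simpleTransposition i (lo j) = lo j →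
      simpleTransposition i (hi j) = hi j → ∀ l,
      D.U i * D.delta j l = D.delta j l * D.U i := by
    intro i j h1 h2 l
    rw [DotTokens.delta]
    split_ifs
    · rw [D.U_tau, h1, h2]
    · rw [mul_neg, D.U_tau, h1, h2, neg_mul]
    · simp
  have hd2 : ∀ i j : Fin (n - 1), simpleTransposition i (lo j) = lo j →
      simpleTransposition i (hi j) = hi j → ∀ l,
      D.delta j (simpleTransposition i l) = D.delta j l := by
    intro i j h1 h2 l
    have e1 : simpleTransposition i l = lo j ↔ l = lo j :=
      ⟨fun h => (simpleTransposition i).injective (h.trans h1.symm), fun h => by rw [h, h1]⟩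
    have e2 : simpleTransposition i l = hi j ↔ l = hi j :=
      ⟨fun h => (simpleTransposition i).injective (h.trans h2.symm), fun h => by rw [h, h2]⟩
    simp only [DotTokens.delta, e1, e2]
  have hs : simpleTransposition j (simpleTransposition i l) =
      simpleTransposition i (simpleTransposition j l) :=
    (DFunLike.congr_fun (simpleTransposition_comm h) l).symm
  have e1 : D.U i * D.U j * D.X l = D.X (simpleTransposition i (simpleTransposition j l)) *
      (D.U i * D.U j) + (D.delta i l * D.U j + D.delta j l * D.U i) := by
    rw [mul_assoc, D.U_X, mul_add, ← mul_assoc, D.U_X, hdel i j h1 h2, hd2 j i h3 h4]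
    noncomm_ring
  have e2 : D.U j * D.U i * D.X l = D.X (simpleTransposition i (simpleTransposition j l)) *
      (D.U j * D.U i) + (D.delta i l * D.U j + D.delta j l * D.U i) := by
    rw [mul_assoc, D.U_X, mul_add, ← mul_assoc, D.U_X, hdel j i h3 h4, hd2 i j h1 h2, hs]
    noncomm_ring
  rw [sub_mul, e1, e2, mul_sub]
  abel

end CrossingFamily

end FrobNilHecke
-- The relations between crossings on the model space.
namespace FrobNilHecke

universe u v w

variable {k : Type u} {A : Type v} [CommRing k] [Ring A] [Algebra k A]
  {𝒜 : ZMod 2 → Submodule k A} [GradedAlgebra 𝒜] {ι : Type w} [Fintype ι] [DecidableEq ι]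

namespace CrossingFamily

variable {F : SymmFrobenius k 𝒜 ι} {n : ℕ} {E : Type*} [Ring E] [Algebra k E]
  (D : CrossingFamily F n E)

/-- Moving a dot through three crossings from right to left leaves one correction per crossing met
by its strand. The corrections of the two sides cancel, except for terms with a squared crossing
when the dot starts on an outer strand; these vanish by `hsq`. The witness is the dot on the image
strand under the transposition of the outer strands. -/
theorem U_braid_mul_X (hsq : ∀ i, D.U i * D.U i = 0) {i j : Fin (n - 1)} (h : (i : ℕ) + 1 = j)
    (l : Fin n) : ∃ f, (D.U i * (D.U j * D.U i) - D.U j * (D.U i * D.U j)) * D.X l =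
      f * (D.U i * (D.U j * D.U i) - D.U j * (D.U i * D.U j)) := by
  obtain ⟨h1, h2, h3⟩ := simpleTransposition_near h
  have hne1 : lo i ≠ hi j := by simp only [lo, hi, ne_eq, Fin.ext_iff]; omega
  have aa := hsq i
  have bb := hsq j
  have ax1 := D.U_X_lo i
  have ax2 := D.U_X_hi i
  have ax3 := D.U_X_of_ne (i := i) (j := hi j) hne1.symm (h1 ▸ (lo_ne_hi j).symm)
  have bx1 := D.U_X_of_ne (i := j) (j := lo i) (h1 ▸ lo_ne_hi i) hne1
  have bx2 := D.U_X_lo j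
  have bx3 := D.U_X_hi j
  have at13 := D.U_tau i (lo i) (hi j)
  have at31 := D.U_tau i (hi j) (lo i)
  have at23 := D.U_tau i (hi i) (hi j)
  have at32 := D.U_tau i (hi j) (hi i)
  have bt12 := D.U_tau j (lo i) (lo j)
  have bt21 := D.U_tau j (lo j) (lo i)
  have bt13 := D.U_tau j (lo i) (hi j)
  have bt31 := D.U_tau j (hi j) (lo i)
  have bhi : simpleTransposition j (hi j) = hi i := by rw [simpleTransposition_hi, h1]
  rw [simpleTransposition_lo, h2] at at13
  rw [simpleTransposition_lo, h2] at at31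
  rw [simpleTransposition_hi, h2] at at23
  rw [simpleTransposition_hi, h2] at at32
  rw [simpleTransposition_lo, h3, h1] at bt12
  rw [simpleTransposition_lo, h3, h1] at bt21
  rw [bhi, h3] at bt13
  rw [bhi, h3] at bt31
  rw [h1] at bx2
  rw [h1] at bx3
  have al := D.U_X_of_ne (i := i) (j := l)
  have bl := D.U_X_of_ne (i := j) (j := l)
  rw [h1] at bl
  generalize D.U i = a at *
  generalize D.U j = b at *
  by_cases hl1 : l = lo i
  · subst hl1
    refine ⟨D.X (hi j), ?_⟩
    linear_combination (norm := noncomm_ring) a * b * ax1 + a * bx2 * a + ax3 * b * a - at23 * a -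
      D.tau (lo i) (hi j) * aa - a * bt12 - at13 * b - (b * a * bx1 + b * ax1 * b + bx2 * a * b -
        bt12 * b - D.tau (lo i) (hi j) * bb)
  by_cases hl2 : l = hi i
  · subst hl2
    refine ⟨D.X (hi i), ?_⟩
    linear_combination (norm := noncomm_ring) a * b * ax2 + a * bx1 * a + ax1 * b * a + a * bt21 +
      at31 * b - (b * a * bx2 + b * ax3 * b + bx3 * a * b - b * at23 - bt13 * a)
  by_cases hl3 : l = hi j
  · subst hl3
    refine ⟨D.X (lo i), ?_⟩
    linear_combination (norm := noncomm_ring) a * b * ax3 + a * bx3 * a + ax2 * b * a + at32 * a +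
      D.tau (hi j) (lo i) * aa - (b * a * bx3 + b * ax2 * b + bx1 * a * b + b * at32 + bt21 * b +
        D.tau (hi j) (lo i) * bb + bt31 * a)
  · refine ⟨D.X l, ?_⟩
    have al := al hl1 hl2
    have bl := bl hl2 hl3
    linear_combination (norm := noncomm_ring) a * b * al + a * bl * a + al * b * a -
      (b * a * bl + b * al * b + bl * a * b)

theorem U_braid_mul_T {i j : Fin (n - 1)} (h : (i : ℕ) + 1 = j) (l : Fin n) (a : A) :
    (D.U i * (D.U j * D.U i) - D.U j * (D.U i * D.U j)) * D.T l a =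
      D.T ((simpleTransposition i * (simpleTransposition j * simpleTransposition i)) l) a *
        (D.U i * (D.U j * D.U i) - D.U j * (D.U i * D.U j)) := by
  rw [sub_mul, mul_sub]
  congr 1
  · simp only [mul_assoc, Equiv.Perm.mul_apply, D.U_T]
    rw [← mul_assoc (D.U j), D.U_T, mul_assoc, ← mul_assoc (D.U i), D.U_T, mul_assoc]
  · rw [simpleTransposition_braid h]
    simp only [mul_assoc, Equiv.Perm.mul_apply, D.U_T]
    rw [← mul_assoc (D.U i), D.U_T, mul_assoc, ← mul_assoc (D.U j), D.U_T, mul_assoc]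

theorem U_far_mul_T {i j : Fin (n - 1)} (h : (i : ℕ) + 1 < j) (l : Fin n) (a : A) :
    (D.U i * D.U j - D.U j * D.U i) * D.T l a =
      D.T ((simpleTransposition i * simpleTransposition j) l) a *
        (D.U i * D.U j - D.U j * D.U i) := by
  rw [sub_mul, mul_sub]
  congr 1
  · rw [mul_assoc, D.U_T, ← mul_assoc, D.U_T, mul_assoc, Equiv.Perm.mul_apply]
  · rw [mul_assoc, D.U_T, ← mul_assoc, D.U_T, mul_assoc, simpleTransposition_comm h,
      Equiv.Perm.mul_apply]

end CrossingFamily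

namespace ModelSpace

variable (F : SymmFrobenius k 𝒜 ι) {n : ℕ}

theorem crossing_sq (i : Fin (n - 1)) : crossing F i * crossing F i = 0 := by
  refine eq_zero_of_commutes F _ (fun j => ⟨_, (crossingFamily F n).U_sq_mul_X i j⟩)
    (fun j a => ⟨(crossingFamily F n).T j a, ?_⟩) fun w => ?_
  · change (crossingFamily F n).U i * (crossingFamily F n).U i * _ =
      _ * ((crossingFamily F n).U i * (crossingFamily F n).U i)
    rw [mul_assoc, CrossingFamily.U_T, ← mul_assoc, CrossingFamily.U_T,
      simpleTransposition_apply_apply, mul_assoc]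
  · rw [Module.End.mul_apply, crossing_single_one]
    split_ifs with h
    · rw [crossing_single_one, if_neg (by rwa [isAscent_mul_iff, not_not])]
    · rw [map_zero]

theorem crossing_far {i j : Fin (n - 1)} (h : (i : ℕ) + 1 < j) :
    crossing F i * crossing F j = crossing F j * crossing F i := by
  rw [← sub_eq_zero]
  refine eq_zero_of_commutes F _ (fun l => ⟨_, (crossingFamily F n).U_far_mul_X h l⟩)
    (fun l a => ⟨_, (crossingFamily F n).U_far_mul_T h l a⟩) fun w => ?_
  obtain ⟨h1, h2, h3, h4⟩ := simpleTransposition_far h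
  have e1 : IsAscent i (simpleTransposition j * w) ↔ IsAscent i w := by
    rw [isAscent_simpleTransposition_mul, h3, h4, IsAscent]
  have e2 : IsAscent j (simpleTransposition i * w) ↔ IsAscent j w := by
    rw [isAscent_simpleTransposition_mul, h1, h2, IsAscent]
  rw [LinearMap.sub_apply, Module.End.mul_apply, Module.End.mul_apply, crossing_single_one,
    crossing_single_one, sub_eq_zero]
  by_cases hi : IsAscent i w <;> by_cases hj : IsAscent j w
  · rw [if_pos hi, if_pos hj, crossing_single_one, crossing_single_one, if_pos (e1.2 hi),
      if_pos (e2.2 hj), ← mul_assoc, simpleTransposition_comm h, mul_assoc]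
  · rw [if_pos hi, if_neg hj, crossing_single_one, map_zero, if_neg (mt e2.1 hj)]
  · rw [if_neg hi, if_pos hj, crossing_single_one, map_zero, if_neg (mt e1.1 hi)]
  · rw [if_neg hi, if_neg hj, map_zero, map_zero]

/-- On `single w 1` either composite is nonzero exactly when `w⁻¹` increases along the three strands
involved, and then both give the same basis vector. -/
theorem crossing_braid {i j : Fin (n - 1)} (h : (i : ℕ) + 1 = j) :
    crossing F i * (crossing F j * crossing F i) =
      crossing F j * (crossing F i * crossing F j) := by
  rw [← sub_eq_zero]
  refine eq_zero_of_commutes F _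
    (fun l => (crossingFamily F n).U_braid_mul_X (crossing_sq F) h l)
    (fun l a => ⟨_, (crossingFamily F n).U_braid_mul_T h l a⟩) fun w => ?_
  obtain ⟨h1, h2, h3⟩ := simpleTransposition_near h
  have hs : simpleTransposition i * (simpleTransposition j * (simpleTransposition i * w)) =
      simpleTransposition j * (simpleTransposition i * (simpleTransposition j * w)) := by
    have := congrArg (· * w) (simpleTransposition_braid h)
    simpa only [mul_assoc] using this
  have e1 : IsAscent j (simpleTransposition i * w) ↔ w⁻¹ (lo i) < w⁻¹ (hi j) := by
    rw [isAscent_simpleTransposition_mul, h1, h2, simpleTransposition_hi]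
  have e2 : IsAscent i (simpleTransposition j * w) ↔ w⁻¹ (lo i) < w⁻¹ (hi j) := by
    rw [isAscent_simpleTransposition_mul, h3, ← h1, simpleTransposition_lo]
  have e3 : IsAscent i (simpleTransposition j * (simpleTransposition i * w)) ↔ IsAscent j w := by
    rw [isAscent_simpleTransposition_mul, h3, ← h1, simpleTransposition_lo, mul_inv_rev,
      simpleTransposition_inv, Equiv.Perm.mul_apply, Equiv.Perm.mul_apply, h2,
      simpleTransposition_lo, IsAscent, h1]
  have e4 : IsAscent j (simpleTransposition i * (simpleTransposition j * w)) ↔ IsAscent i w := by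
    rw [isAscent_simpleTransposition_mul, h1, h2, simpleTransposition_hi, mul_inv_rev,
      simpleTransposition_inv, Equiv.Perm.mul_apply, Equiv.Perm.mul_apply, h3,
      simpleTransposition_hi, IsAscent, h1]
  simp only [LinearMap.sub_apply, Module.End.mul_apply, sub_eq_zero]
  have key : ∀ (i j : Fin (n - 1)), crossing F i (crossing F j (crossing F i
      (Finsupp.single w 1))) = if IsAscent i w ∧ IsAscent j (simpleTransposition i * w) ∧
        IsAscent i (simpleTransposition j * (simpleTransposition i * w)) then
        Finsupp.single (simpleTransposition i * (simpleTransposition j *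
          (simpleTransposition i * w))) 1 else 0 := by
    intro i j
    rw [crossing_single_one]
    by_cases a1 : IsAscent i w
    · rw [if_pos a1, crossing_single_one]
      by_cases a2 : IsAscent j (simpleTransposition i * w)
      · rw [if_pos a2, crossing_single_one]
        simp only [a1, a2, true_and]
      · rw [if_neg a2, map_zero, if_neg (by tauto)]
    · rw [if_neg a1, map_zero, map_zero, if_neg (by tauto)]
  rw [key, key, hs]
  exact if_congr (by tauto) rfl rfl

variable (n) in
/-- The dots, tokens and crossings acting on the model space satisfy the relations of the
Frobenius nilHecke algebra. -/
noncomputable def family : NilHeckeFamily F n (Module.End k (ModelSpace F n)) where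
  toCrossingFamily := crossingFamily F n
  U_sq := crossing_sq F
  U_braid _ _ := crossing_braid F
  U_far _ _ := crossing_far F

theorem prod_crossing_single {l : List (Fin (n - 1))} {w : Equiv.Perm (Fin n)}
    (h : IsReducedWord l w) :
    (l.map (crossing F)).prod (Finsupp.single 1 1) = Finsupp.single w 1 := by
  induction l generalizing w with
  | nil =>
    obtain rfl : 1 = w := h.1
    rfl
  | cons i l ih =>
    rw [isReducedWord_cons] at h
    rw [List.map_cons, List.prod_cons, Module.End.mul_apply, ih h.2, crossing_single_one,
      if_pos ((isAscent_mul_iff i w).2 h.1), simpleTransposition_mul_cancel]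

theorem permCrossing_single (w : Equiv.Perm (Fin n)) :
    (family F n).permCrossing w (Finsupp.single 1 1) = Finsupp.single w 1 :=
  prod_crossing_single F (exists_isReducedWord w).choose_spec

end ModelSpace

end FrobNilHecke
-- Independence of the monomials in dots and tokens.
namespace FrobNilHecke

universe u v w

variable {k : Type u} {A : Type v} [CommRing k] [Ring A] [Algebra k A]
  {𝒜 : ZMod 2 → Submodule k A} [GradedAlgebra 𝒜] {ι : Type w} [Fintype ι] [DecidableEq ι]

section ParityTwist

variable (𝒜)

/-- The projection onto the homogeneous component of a given parity. -/
def component (i : ZMod 2) : A →ₗ[k] A := GradedAlgebra.proj 𝒜 i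

theorem component_of_mem {i : ZMod 2} {a : A} (h : a ∈ 𝒜 i) : component 𝒜 i a = a := by
  simp [component, GradedAlgebra.proj_apply, DirectSum.decompose_of_mem_same _ h]

theorem component_of_mem_of_ne {i j : ZMod 2} {a : A} (h : a ∈ 𝒜 i) (hij : i ≠ j) :
    component 𝒜 j a = 0 := by
  simp [component, GradedAlgebra.proj_apply, DirectSum.decompose_of_mem_ne _ h hij]

/-- The automorphism of a superalgebra that multiplies elements of parity `j` by `(-1) ^ (i * j)`. -/
def parityTwist (i : ZMod 2) : A →ₗ[k] A := component 𝒜 0 + sgn k i • component 𝒜 1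

theorem parityTwist_of_mem {i j : ZMod 2} {a : A} (h : a ∈ 𝒜 j) :
    parityTwist 𝒜 i a = sgn k (i * j) • a := by
  have hj : ∀ j : ZMod 2, j = 0 ∨ j = 1 := by decide
  rcases hj j with rfl | rfl
  · simp [parityTwist, component_of_mem 𝒜 h, component_of_mem_of_ne 𝒜 h zero_ne_one]
  · simp [parityTwist, component_of_mem 𝒜 h, component_of_mem_of_ne 𝒜 h one_ne_zero]

theorem parityTwist_mul (i : ZMod 2) (a b : A) :
    parityTwist 𝒜 i (a * b) = parityTwist 𝒜 i a * parityTwist 𝒜 i b := by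
  induction a using parity_induction 𝒜 with
  | hom c a ha =>
    induction b using parity_induction 𝒜 with
    | hom d b hb =>
      rw [parityTwist_of_mem 𝒜 ha, parityTwist_of_mem 𝒜 hb,
        parityTwist_of_mem 𝒜 (SetLike.mul_mem_graded ha hb), smul_mul_smul_comm, mul_add, sgn_add]
    | add b c hb hc => simp only [mul_add, map_add, hb, hc]
  | add a c ha hc => simp only [add_mul, map_add, ha, hc]

theorem parityTwist_comm (i j : ZMod 2) (a : A) :
    parityTwist 𝒜 i (parityTwist 𝒜 j a) = parityTwist 𝒜 (i + j) a := by
  induction a using parity_induction 𝒜 with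
  | hom c a ha =>
    rw [parityTwist_of_mem 𝒜 ha, parityTwist_of_mem 𝒜 ha, map_smul, parityTwist_of_mem 𝒜 ha,
      smul_smul, add_mul, sgn_add, mul_comm]
  | add a c ha hc => simp only [map_add, ha, hc]

theorem parityTwist_one (i : ZMod 2) : parityTwist 𝒜 i 1 = 1 := by
  rw [parityTwist_of_mem 𝒜 (SetLike.one_mem_graded 𝒜), mul_zero, sgn_zero, one_smul]

theorem parityTwist_zero (a : A) : parityTwist 𝒜 0 a = a := by
  induction a using parity_induction 𝒜 with
  | hom c a ha => rw [parityTwist_of_mem 𝒜 ha, zero_mul, sgn_zero, one_smul]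
  | add a c ha hc => simp only [map_add, ha, hc]

end ParityTwist

/-- The space on which the algebra of dots and tokens acts: functions of the exponents of the dots
with values in multilinear forms in the labels of the tokens. -/
abbrev DualSpace (k : Type u) (A : Type v) [CommRing k] [Ring A] [Algebra k A] (n : ℕ) :
    Type (max u v) :=
  (Fin n → ℕ) → MultilinearMap k (fun _ : Fin n => A) k

namespace DualSpace

variable (F : SymmFrobenius k 𝒜 ι) (n : ℕ)

variable (𝒜) in
/-- The linear map on the factor `i` in the action of a token of parity `s` labelled `a` on strand
`j`. -/
def tokenFactor {n : ℕ} (j : Fin n) (s : ZMod 2) (a : A) (i : Fin n) : A →ₗ[k] A :=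
  -- The action is the transpose of right multiplication: to reach factor `j` from the right, `a`
  -- has to pass the factors with smaller index, whence their twists. Transposing right
  -- multiplication gives a left action.
  if i = j then LinearMap.mulRight k a else if i < j then parityTwist 𝒜 s else LinearMap.id

/-- Confines the dependence on `a` to the single argument `j`, so that linearity in `a` follows from
multilinearity. -/
theorem tokenFactor_eq_update {n : ℕ} (j : Fin n) (s : ZMod 2) (a : A) (v : Fin n → A) :
    (fun i => tokenFactor 𝒜 j s a i (v i)) =
      Function.update (fun i => tokenFactor 𝒜 j s 1 i (v i)) j (v j * a) := by
  ext i
  by_cases h : i = j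
  · subst h
    simp [tokenFactor]
  · simp [tokenFactor, h]

/-- The action of a token of parity `s` labelled `a`. -/
def homToken {n : ℕ} (𝒜 : ZMod 2 → Submodule k A) [GradedAlgebra 𝒜] (j : Fin n) (s : ZMod 2) :
    A →ₗ[k] Module.End k (DualSpace k A n) where
  toFun a :=
    { toFun := fun φ d => (φ d).compLinearMap (tokenFactor 𝒜 j s a)
      map_add' := fun φ ψ => by ext; simp
      map_smul' := fun r φ => by ext; simp }
  map_add' a b := by
    ext φ d v
    simp only [LinearMap.coe_mk, AddHom.coe_mk, MultilinearMap.compLinearMap_apply,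
      LinearMap.add_apply, Pi.add_apply, _root_.add_apply]
    rw [tokenFactor_eq_update j s (a + b), tokenFactor_eq_update j s a,
      tokenFactor_eq_update j s b, mul_add, MultilinearMap.map_update_add]
  map_smul' r a := by
    ext φ d v
    simp only [LinearMap.coe_mk, AddHom.coe_mk, MultilinearMap.compLinearMap_apply,
      LinearMap.smul_apply, Pi.smul_apply, _root_.smul_apply, RingHom.id_apply]
    rw [tokenFactor_eq_update j s (r • a), tokenFactor_eq_update j s a, mul_smul_comm,
      MultilinearMap.map_update_smul]

theorem homToken_apply {n : ℕ} (j : Fin n) (s : ZMod 2) (a : A) (φ : DualSpace k A n)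
    (d : Fin n → ℕ) (v : Fin n → A) :
    homToken 𝒜 j s a φ d v = φ d fun i => tokenFactor 𝒜 j s a i (v i) := rfl

/-- The action of a token. -/
def token {n : ℕ} (𝒜 : ZMod 2 → Submodule k A) [GradedAlgebra 𝒜] (j : Fin n) :
    A →ₗ[k] Module.End k (DualSpace k A n) :=
  homToken 𝒜 j 0 ∘ₗ component 𝒜 0 + homToken 𝒜 j 1 ∘ₗ component 𝒜 1

theorem token_of_mem {n : ℕ} (j : Fin n) {s : ZMod 2} {a : A} (h : a ∈ 𝒜 s) :
    token 𝒜 j a = homToken 𝒜 j s a := by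
  have hj : ∀ j : ZMod 2, j = 0 ∨ j = 1 := by decide
  rcases hj s with rfl | rfl
  · simp [token, component_of_mem 𝒜 h, component_of_mem_of_ne 𝒜 h zero_ne_one]
  · simp [token, component_of_mem 𝒜 h, component_of_mem_of_ne 𝒜 h one_ne_zero]

theorem apply_eq_mul_apply {n : ℕ} (f : MultilinearMap k (fun _ : Fin n => A) k) {v v' : Fin n → A}
    (i : Fin n) (r : k) (h : v i = r • v' i) (h' : ∀ j, j ≠ i → v j = v' j) :
    f v = r * f v' := by
  have : v = Function.update v' i (r • v' i) := by
    ext j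
    by_cases hj : j = i
    · subst hj
      simp [h]
    · simp [hj, h' j hj]
  rw [this, MultilinearMap.map_update_smul, Function.update_eq_self, smul_eq_mul]

/-- The two composites differ only in argument `i`, where the token on the higher strand `j` twists
`a` in one order but not in the other. -/
theorem homToken_mul_homToken {n : ℕ} {i j : Fin n} (hij : i < j) {c d : ZMod 2} {a : A} (b : A)
    (ha : a ∈ 𝒜 c) : homToken 𝒜 i c a * homToken 𝒜 j d b =
      sgn k (c * d) • (homToken 𝒜 j d b * homToken 𝒜 i c a) := by
  ext φ e v
  simp only [Module.End.mul_apply, LinearMap.smul_apply, Pi.smul_apply, _root_.smul_apply,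
    homToken_apply, smul_eq_mul]
  refine apply_eq_mul_apply _ i _ ?_ fun l hl => ?_
  · simp only [tokenFactor, if_pos, hij.ne, hij, if_false, LinearMap.mulRight_apply,
      parityTwist_mul, parityTwist_of_mem 𝒜 ha, mul_smul_comm, mul_comm d c]
  · simp only [tokenFactor, if_neg hl]
    by_cases hlj : l = j
    · subst hlj
      simp [hij.not_gt]
    · by_cases hli : l < i
      · simp [hlj, hli, hli.trans hij, parityTwist_comm, add_comm]
      · simp [hlj, hli]

/-- The sign in the action of a dot on strand `j`. -/
def dotSign {n : ℕ} (k : Type u) [CommRing k] (p : ZMod 2) (j : Fin n) (d : Fin n → ℕ) : k :=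
  -- The sign for moving a new dot on strand `j` from the right past all dots on strands of smaller
  -- index.
  sgn k (p * ∑ i ∈ Finset.Iio j, (d i : ZMod 2))

/-- The action of a dot. -/
def dot {n : ℕ} (𝒜 : ZMod 2 → Submodule k A) [GradedAlgebra 𝒜] (p : ZMod 2) (j : Fin n) :
    Module.End k (DualSpace k A n) where
  toFun φ d := dotSign k p j d •
    (φ (d + Pi.single j 1)).compLinearMap fun _ => parityTwist 𝒜 p
  map_add' φ ψ := by ext; simp [mul_add]
  map_smul' r φ := by ext; simp [mul_left_comm]

theorem dot_apply {n : ℕ} (p : ZMod 2) (j : Fin n) (φ : DualSpace k A n)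
    (d : Fin n → ℕ) (v : Fin n → A) :
    dot 𝒜 p j φ d v =
      dotSign k p j d * φ (d + Pi.single j 1) fun i => parityTwist 𝒜 p (v i) := rfl

theorem dotSign_add_single (p : ZMod 2) {n : ℕ} (i j : Fin n) (d : Fin n → ℕ) :
    dotSign k p j (d + Pi.single i 1) = dotSign k p j d * if i < j then sgn k p else 1 := by
  simp only [dotSign, Pi.add_apply, Nat.cast_add, Finset.sum_add_distrib, mul_add, sgn_add]
  congr 1
  simp only [Pi.single_apply, Nat.cast_ite, Nat.cast_one, Nat.cast_zero]
  rw [Finset.sum_ite_eq']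
  simp only [Finset.mem_Iio]
  split_ifs <;> simp

/-- The dots and tokens acting on the dual space. -/
def family : DotTokens F (Fin n) (Module.End k (DualSpace k A n)) where
  X := dot 𝒜 F.trp
  T := token 𝒜
  T_one j := by
    rw [token_of_mem j (SetLike.one_mem_graded 𝒜)]
    ext φ d v
    rw [homToken_apply]
    congr 1
    ext i
    simp only [tokenFactor]
    split_ifs <;> simp [parityTwist_zero]
  T_mul j a b := by
    induction a using parity_induction 𝒜 with
    | hom s a ha =>
      induction b using parity_induction 𝒜 with
      | hom t b hb =>
        rw [token_of_mem j ha, token_of_mem j hb, token_of_mem j (SetLike.mul_mem_graded ha hb)]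
        ext φ d v
        rw [Module.End.mul_apply, homToken_apply, homToken_apply, homToken_apply]
        congr 1
        ext i
        simp only [tokenFactor]
        split_ifs <;> simp [parityTwist_comm, mul_assoc, add_comm]
      | add b c hb hc => simp only [mul_add, map_add, hb, hc]
    | add a c ha hc => simp only [add_mul, map_add, ha, hc]
  T_T {i j c d a b} h ha hb := by
    rw [token_of_mem i ha, token_of_mem j hb]
    rcases lt_or_gt_of_ne h with h | h
    · exact homToken_mul_homToken h b ha
    · rw [homToken_mul_homToken h a hb, smul_smul, mul_comm d c, sgn_mul_self, one_smul]
  T_X i j c a ha := by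
    rw [token_of_mem i ha]
    ext φ d v
    simp only [Module.End.mul_apply, LinearMap.smul_apply, Pi.smul_apply,
      _root_.smul_apply, homToken_apply, smul_eq_mul, dot_apply]
    rw [mul_left_comm]
    congr 1
    refine apply_eq_mul_apply _ i _ ?_ fun l hl => ?_
    · simp [tokenFactor, parityTwist_mul, parityTwist_of_mem 𝒜 ha]
    · simp only [tokenFactor, if_neg hl]
      split_ifs
      · simp [parityTwist_comm, add_comm]
      · simp
  X_X {i j} h := by
    ext φ d v
    simp only [Module.End.mul_apply, LinearMap.smul_apply, Pi.smul_apply,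
      _root_.smul_apply, smul_eq_mul, dot_apply, dotSign_add_single]
    rw [add_right_comm d (Pi.single i 1)]
    simp only [← mul_assoc]
    congr 1
    rcases lt_or_gt_of_ne h with h | h
    · rw [if_pos h, if_neg h.not_gt]
      ring
    · rw [if_pos h, if_neg h.not_gt]
      linear_combination (-dotSign k F.trp i d * dotSign k F.trp j d) *
        sgn_mul_self (k := k) F.trp

variable {n}

/-- An operator shifts exponents by `e`, up to signs. -/
def IsShift (𝒜 : ZMod 2 → Submodule k A) [GradedAlgebra 𝒜] (B : Module.End k (DualSpace k A n))
    (e : Fin n → ℕ) : Prop :=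
  ∀ d, ∃ (r : k) (q : ZMod 2), r * r = 1 ∧
    ∀ φ v, B φ d v = r * φ (d + e) fun i => parityTwist 𝒜 q (v i)

theorem isShift_one : IsShift 𝒜 (1 : Module.End k (DualSpace k A n)) 0 := fun d =>
  ⟨1, 0, one_mul 1, fun φ v => by simp [parityTwist_zero]⟩

theorem IsShift.mul {B B' : Module.End k (DualSpace k A n)} {e e' : Fin n → ℕ}
    (h : IsShift 𝒜 B e) (h' : IsShift 𝒜 B' e') : IsShift 𝒜 (B * B') (e + e') := fun d => by
  obtain ⟨r, q, hr, hB⟩ := h d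
  obtain ⟨r', q', hr', hB'⟩ := h' (d + e)
  refine ⟨r * r', q' + q, by rw [mul_mul_mul_comm, hr, hr', one_mul], fun φ v => ?_⟩
  rw [Module.End.mul_apply, hB, hB']
  simp only [parityTwist_comm, add_assoc, mul_assoc]

theorem IsShift.pow {B : Module.End k (DualSpace k A n)} {e : Fin n → ℕ} (h : IsShift 𝒜 B e)
    (m : ℕ) : IsShift 𝒜 (B ^ m) (m • e) := by
  induction m with
  | zero => rw [pow_zero, zero_smul]; exact isShift_one
  | succ m ih => rw [pow_succ, succ_nsmul]; exact ih.mul h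

theorem isShift_dot (p : ZMod 2) (j : Fin n) :
    IsShift 𝒜 (dot 𝒜 p j : Module.End k (DualSpace k A n)) (Pi.single j 1) := fun d =>
  ⟨dotSign k p j d, p, sgn_mul_self _, fun φ v => dot_apply p j φ d v⟩

theorem isShift_dotMon (L : List (Fin n)) (e : Fin n → ℕ) :
    IsShift 𝒜 ((family F n).dotMon L e) (L.map fun j => Pi.single j (e j)).sum := by
  induction L with
  | nil => exact isShift_one
  | cons j L ih =>
    rw [DotTokens.dotMon_cons, List.map_cons, List.sum_cons]
    refine IsShift.mul ?_ ih
    have := (isShift_dot (k := k) (𝒜 := 𝒜) F.trp j).pow (e j)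
    rwa [← Pi.single_smul, smul_eq_mul, mul_one] at this

/-- The leftmost token, which has the largest index, acts on the arguments first. The arguments it
twists are still equal to `1`, and twists fix `1`, so no signs arise. -/
theorem tokenMon_apply {L : List (Fin n)} (hL : L.Pairwise (· > ·)) (c : Fin n → ι)
    (φ : DualSpace k A n) (d : Fin n → ℕ) (v : Fin n → A)
    (hv : ∀ i, ∀ j ∈ L, i ≤ j → v i = 1) :
    (family F n).tokenMon L (fun i => F.basis (c i)) φ d v =
      φ d fun i => if i ∈ L then F.basis (c i) else v i := by
  induction L generalizing v with
  | nil => simp [DotTokens.tokenMon]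
  | cons j L ih =>
    rw [List.pairwise_cons] at hL
    have hT : (family F n).T j (F.basis (c j)) = homToken 𝒜 j (F.par (c j)) (F.basis (c j)) :=
      token_of_mem j (F.basis_mem _)
    rw [DotTokens.tokenMon_cons, Module.End.mul_apply, hT, homToken_apply, ih hL.2]
    · congr 1
      ext i
      by_cases hi : i ∈ L
      · simp [hi]
      · by_cases hij : i = j
        · subst hij
          simp [hi, tokenFactor, hv i i]
        · simp only [hi, hij, tokenFactor, List.mem_cons, or_self, if_false]
          split_ifs with h
          · rw [hv i j (by simp) h.le, parityTwist_one]
          · rfl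
    · intro i j' hj' hij'
      have hij := hij'.trans_lt (hL.1 j' hj')
      rw [tokenFactor, if_neg hij.ne, if_pos hij, hv i j (by simp) hij.le, parityTwist_one]

end DualSpace

namespace DotTokenAlgebra

open DualSpace

variable (F : SymmFrobenius k 𝒜 ι) (n : ℕ)

/-- The standard monomials in dots and tokens. -/
noncomputable def monomial (q : (Fin n → ι) × (Fin n → ℕ)) : DotTokenAlgebra F (Fin n) :=
  (generators F (Fin n)).tokenMon (List.finRange n).reverse (fun j => F.basis (q.1 j)) *
    (generators F (Fin n)).dotMon (List.finRange n) q.2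

/-- Applied to `φ` and evaluated at exponent `0` and labels `1`, the tokens insert their labels and
the dots shift the exponent to `e`; all signs collect in the invertible scalar `r`. -/
theorem lift_monomial_apply (c : Fin n → ι) (e : Fin n → ℕ) :
    ∃ r : k, r * r = 1 ∧ ∀ φ : DualSpace k A n,
      lift (family F n) (monomial F n (c, e)) φ 0 (fun _ => 1) =
        r * φ e fun i => F.basis (c i) := by
  obtain ⟨r, q, hr, h⟩ := isShift_dotMon F (List.finRange n) e 0
  refine ⟨r * ∏ i, sgn k (q * F.par (c i)), ?_, fun φ => ?_⟩
  · rw [mul_mul_mul_comm, hr, ← Finset.prod_mul_distrib, one_mul]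
    simp
  · have h1 : lift (family F n) (monomial F n (c, e)) =
        (family F n).tokenMon (List.finRange n).reverse (fun j => F.basis (c j)) *
          (family F n).dotMon (List.finRange n) e := by
      simp [monomial, DotTokens.tokenMon, DotTokens.dotMon, map_list_prod, Function.comp_def]
    have hp : (List.finRange n).reverse.Pairwise (· > ·) := by
      rw [List.pairwise_reverse]
      exact List.pairwise_lt_finRange n
    rw [h1, Module.End.mul_apply, tokenMon_apply F hp _ _ _ _ fun _ _ _ _ => rfl, h, zero_add,
      ← Fin.sum_univ_def, Finset.univ_sum_single]
    simp only [List.mem_reverse, List.mem_finRange, if_true, parityTwist_of_mem 𝒜 (F.basis_mem _)]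
    rw [MultilinearMap.map_smul_univ, smul_eq_mul, mul_assoc]

theorem linearIndependent_monomial : LinearIndependent k (monomial F n) := by
  classical
  rw [linearIndependent_iff']
  rintro s g hg ⟨c, e⟩ hs
  -- The coordinate functional of the monomial `(c, e)`: a delta function at `e` times the product
  -- of the coordinate forms of the `c i`.
  let φ : DualSpace k A n := fun d => if d = e then
    (MultilinearMap.mkPiAlgebra k (Fin n) k).compLinearMap fun i => F.basis.coord (c i) else 0
  have hφ : ∀ c' e', φ e' (fun i => F.basis (c' i)) = if (c', e') = (c, e) then 1 else 0 := by
    intro c' e'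
    by_cases he : e' = e
    · simp only [φ, he, if_true, MultilinearMap.compLinearMap_apply,
        MultilinearMap.mkPiAlgebra_apply, Module.Basis.coord_apply, Module.Basis.repr_self,
        Finsupp.single_apply, Prod.mk.injEq, and_true]
      rw [Finset.prod_ite_zero]
      simp [funext_iff]
    · simp [φ, he]
  have h := congrArg (fun f => lift (family F n) f φ 0 fun _ => 1) hg
  simp only [map_sum, map_smul, LinearMap.sum_apply, Finset.sum_apply, _root_.sum_apply,
    LinearMap.smul_apply, Pi.smul_apply, _root_.smul_apply, map_zero,
    LinearMap.zero_apply, Pi.zero_apply, _root_.zero_apply] at h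
  rw [Finset.sum_eq_single (c, e)] at h
  · obtain ⟨r, hr, h'⟩ := lift_monomial_apply F n c e
    rw [h', hφ, if_pos rfl, mul_one, smul_eq_mul] at h
    have := congrArg (· * r) h
    simpa [mul_assoc, hr] using this
  · rintro ⟨c', e'⟩ _ hne
    obtain ⟨r, hr, h'⟩ := lift_monomial_apply F n c' e'
    rw [h', hφ, if_neg hne, mul_zero, smul_zero]
  · exact fun h => absurd hs h

end DotTokenAlgebra

end FrobNilHecke
-- Evaluating diagrams in an algebra that satisfies the relations.
namespace FrobNilHecke

universe u v w

variable {k : Type u} {A : Type v} [CommRing k] [Ring A] [Algebra k A]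
  {𝒜 : ZMod 2 → Submodule k A} [GradedAlgebra 𝒜] {ι : Type w} [Fintype ι] [DecidableEq ι]

namespace NilHeckeFamily

variable {F : SymmFrobenius k 𝒜 ι} {N : ℕ} {E : Type*} [Ring E] [Algebra k E]
  (D : NilHeckeFamily F N E)

/-- The element of `E` given by an expression with `r` strands to its right. -/
def eval : ∀ {m n : ℕ}, Tm k A m n → ℕ → E
  | _, _, .id _, _ => 1
  | _, _, .comp g f, r => eval g r * eval f r
  -- This uses `f ⊗ g = (f ⊗ 1) ∘ (1 ⊗ g)`. Using the source `m'` of `g` as its width is harmless: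
  -- if the target differs, `g` evaluates to zero.
  | _, _, .tensor (m' := m') f g, r => eval f (r + m') * eval g r
  | _, _, .zero _ _, _ => 0
  | _, _, .add f g, r => eval f r + eval g r
  | _, _, .smul c f, r => c • eval f r
  -- Generators that stick out beyond the `N` strands get the junk value zero; `eval_eq_of_rel`
  -- excludes this case by a bound on `r`.
  | _, _, .cross, r => if h : r < N - 1 then D.U ⟨r, h⟩ else 0
  | _, _, .dot, r => if h : r < N then D.X ⟨r, h⟩ else 0
  | _, _, .tok a, r => if h : r < N then D.T ⟨r, h⟩ a else 0

/-- Every generator has equal source and target, so an expression between different powers must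
contain a zero. -/
theorem eval_of_ne {m n : ℕ} (f : Tm k A m n) (h : m ≠ n) (r : ℕ) : D.eval f r = 0 := by
  induction f generalizing r with
  | id n => exact absurd rfl h
  | @comp l m n g f hg hf =>
    rw [eval]
    by_cases h' : l = m
    · rw [hg (h' ▸ h), zero_mul]
    · rw [hf h', mul_zero]
  | @tensor m n m' n' f g hf hg =>
    rw [eval]
    by_cases h' : m = n
    · rw [hg (by omega), mul_zero]
    · rw [hf h', zero_mul]
  | zero => rfl
  | add f g hf hg => rw [eval, hf h, hg h, add_zero]
  | smul c f hf => rw [eval, hf h, smul_zero]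
  | cross => exact absurd rfl h
  | dot => exact absurd rfl h
  | tok a => exact absurd rfl h

theorem eval_cast {m n m' n' : ℕ} (hm : m = m') (hn : n = n') (f : Tm k A m n) (r : ℕ) :
    D.eval (f.cast hm hn) r = D.eval f r := by
  subst hm hn
  rfl

/-- `z`, regarded as an element of parity `i`, supercommutes with the generators on the strands
`r, …, r + m - 1`. -/
structure Supercommutes (z : E) (i : ZMod 2) (r m : ℕ) : Prop where
  X : ∀ q : Fin N, r ≤ q → (q : ℕ) < r + m → z * D.X q = sgn k (i * F.trp) • (D.X q * z)
  T : ∀ (q : Fin N) (c : ZMod 2) (a : A), r ≤ q → (q : ℕ) < r + m → a ∈ 𝒜 c →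
    z * D.T q a = sgn k (i * c) • (D.T q a * z)
  U : ∀ q : Fin (N - 1), r ≤ q → (q : ℕ) + 1 < r + m → z * D.U q = D.U q * z

variable {D}

theorem Supercommutes.mono {z : E} {i : ZMod 2} {r m r' m' : ℕ} (h : D.Supercommutes z i r m)
    (h1 : r ≤ r') (h2 : r' + m' ≤ r + m) : D.Supercommutes z i r' m' where
  X q hq hq' := h.X q (by omega) (by omega)
  T q c a hq hq' ha := h.T q c a (by omega) (by omega) ha
  U q hq hq' := h.U q (by omega) (by omega)

/-- An expression on a block of strands evaluates to a combination of products of generators on that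
block, whose signs add up according to parity. -/
theorem Supercommutes.mul_eval {z : E} {i : ZMod 2} {m n : ℕ} {f : Tm k A m n} {j : ZMod 2}
    (hf : HasParity F f j) {r : ℕ} (h : D.Supercommutes z i r m) :
    z * D.eval f r = sgn k (i * j) • (D.eval f r * z) := by
  induction hf generalizing r with
  | id n => simp [eval]
  | @comp l m n g f c d hg hf ihg ihf =>
    rw [eval]
    by_cases hlm : l = m
    · subst hlm
      rw [← mul_assoc, ihg h, smul_mul_assoc, mul_assoc, ihf h, mul_smul_comm, smul_smul, mul_add,
        sgn_add, mul_assoc]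
    · rw [D.eval_of_ne f hlm]
      simp
  | @tensor m n m' n' f g c d hf hg ihf ihg =>
    rw [eval, ← mul_assoc, ihf (h.mono (by omega) (by omega)), smul_mul_assoc, mul_assoc,
      ihg (h.mono (by omega) (by omega)), mul_smul_comm, smul_smul, mul_add, sgn_add, mul_assoc]
  | zero m n c => simp [eval]
  | add hf hg ihf ihg => rw [eval, mul_add, ihf h, ihg h, add_mul, smul_add]
  | smul c hf ihf => rw [eval, mul_smul_comm, ihf h, smul_mul_assoc, smul_comm]
  | cross =>
    rw [eval]
    split_ifs with hr
    · rw [mul_zero, sgn_zero, one_smul, h.U _ le_rfl (by simp)]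
    · simp
  | dot =>
    rw [eval]
    split_ifs with hr
    · rw [h.X _ le_rfl (by simp)]
    · simp
  | tok a c ha =>
    rw [eval]
    split_ifs with hr
    · rw [h.T _ c a le_rfl (by simp) ha]
    · simp

variable (D)

theorem mul_self_parity (p : ZMod 2) : p * p = p := by revert p; decide

theorem supercommutes_X {q : Fin N} {r m : ℕ} (h : (q : ℕ) < r) :
    D.Supercommutes (D.X q) F.trp r m where
  X q' h1 h2 := by rw [mul_self_parity, D.X_X (by rintro rfl; omega)]
  T q' c a h1 h2 ha := by rw [D.T_X q' q ha, smul_smul, sgn_mul_self, one_smul]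
  U q' h1 h2 := by
    rw [D.U_X_of_ne] <;> simp only [lo, hi, ne_eq, Fin.ext_iff] <;> omega

theorem supercommutes_T {q : Fin N} {r m : ℕ} (h : (q : ℕ) < r) {c : ZMod 2} {a : A}
    (ha : a ∈ 𝒜 c) : D.Supercommutes (D.T q a) c r m where
  X q' h1 h2 := by rw [D.T_X q q' ha, mul_comm]
  T q' d b h1 h2 hb := by rw [D.T_T (by rintro rfl; omega) ha hb]
  U q' h1 h2 := by
    rw [D.U_T, simpleTransposition_of_ne] <;> simp only [lo, hi, ne_eq, Fin.ext_iff] <;> omega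

theorem supercommutes_U {q : Fin (N - 1)} {r m : ℕ} (h : (q : ℕ) + 1 < r) :
    D.Supercommutes (D.U q) 0 r m where
  X q' h1 h2 := by
    rw [zero_mul, sgn_zero, one_smul, D.U_X_of_ne] <;>
      simp only [lo, hi, ne_eq, Fin.ext_iff] <;> omega
  T q' c a h1 h2 ha := by
    rw [zero_mul, sgn_zero, one_smul, D.U_T, simpleTransposition_of_ne] <;>
      simp only [lo, hi, ne_eq, Fin.ext_iff] <;> omega
  U q' h1 h2 := D.U_far _ _ (by omega)

/-- A generator to the right of the block supercommutes with all generators in the block, hence with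
the value of `f` by `mul_eval`; reading that identity backwards gives the claim. -/
theorem supercommutes_eval {m n : ℕ} {f : Tm k A m n} {i : ZMod 2} (hf : HasParity F f i)
    {r s l : ℕ} (h : r + l ≤ s) : D.Supercommutes (D.eval f s) i r l where
  X q h1 h2 := by
    rw [(D.supercommutes_X (show (q : ℕ) < s by omega)).mul_eval hf, smul_smul, mul_comm F.trp,
      sgn_mul_self, one_smul]
  T q c a h1 h2 ha := by
    rw [(D.supercommutes_T (show (q : ℕ) < s by omega) ha).mul_eval hf, smul_smul, mul_comm c,
      sgn_mul_self, one_smul]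
  U q h1 h2 := by
    rw [(D.supercommutes_U (show (q : ℕ) + 1 < s by omega)).mul_eval hf, zero_mul, sgn_zero,
      one_smul]

theorem eval_listSum {m n : ℕ} (l : List (Tm k A m n)) (r : ℕ) :
    D.eval (Tm.listSum l) r = (l.map fun f => D.eval f r).sum := by
  induction l with
  | nil => rfl
  | cons f l ih =>
    rw [List.map_cons, List.sum_cons, ← ih]
    rfl

theorem eval_cross {r : ℕ} (h : r < N - 1) : D.eval (.cross : Tm k A 2 2) r = D.U ⟨r, h⟩ := dif_pos h

theorem eval_dot {r : ℕ} (h : r < N) : D.eval (.dot : Tm k A 1 1) r = D.X ⟨r, h⟩ := dif_pos h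

theorem eval_tok {r : ℕ} (h : r < N) (a : A) : D.eval (.tok a : Tm k A 1 1) r = D.T ⟨r, h⟩ a :=
  dif_pos h

theorem eval_teleporter {r : ℕ} (h : r < N - 1) :
    D.eval (teleporter F) r = D.tau (hi ⟨r, h⟩) (lo ⟨r, h⟩) := by
  rw [teleporter, eval_listSum, List.map_map, DotTokens.tau, Finset.sum_map_toList]
  refine Finset.sum_congr rfl fun b _ => ?_
  simp only [Function.comp_apply, eval]
  rw [dif_pos (show r + 1 < N by omega), dif_pos (show r < N by omega)]
  rfl

/-- The bound `hr` guarantees that every generator in a defining relation lies on existing strands,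
so each relation becomes one of the axioms of a family; the super interchange law comes from
`supercommutes_eval`. -/
theorem eval_eq_of_rel {m n : ℕ} {f g : Tm k A m n} (h : Rel F f g) {r : ℕ} (hr : r + m ≤ N) :
    D.eval f r = D.eval g r := by
  induction h generalizing r with
  | refl f => rfl
  | symm _ ih => exact (ih hr).symm
  | trans _ _ ih ih' => exact (ih hr).trans (ih' hr)
  | @comp_congr l m n g g' f f' _ _ ihg ihf =>
    simp only [eval]
    -- The bound speaks of the source `l`, whereas the induction hypothesis for `g` needs it for
    -- `m`; if these differ, both composites are zero.
    by_cases h : l = m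
    · subst h
      rw [ihg hr, ihf hr]
    · rw [D.eval_of_ne f h, D.eval_of_ne f' h, mul_zero, mul_zero]
  | tensor_congr _ _ ihf ihg =>
    simp only [eval]
    rw [ihf (by omega), ihg (by omega)]
  | add_congr _ _ ihf ihg => simp only [eval]; rw [ihf hr, ihg hr]
  | smul_congr c _ ih => simp only [eval]; rw [ih hr]
  | add_assoc f g h => exact add_assoc _ _ _
  | add_comm f g => exact add_comm _ _
  | zero_add f => exact zero_add _
  | one_smul f => exact one_smul _ _
  | mul_smul c d f => exact mul_smul _ _ _
  | smul_add c f g => exact smul_add _ _ _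
  | add_smul c d f => exact add_smul _ _ _
  | zero_smul f => exact zero_smul _ _
  | comp_add g f f' => exact mul_add _ _ _
  | add_comp g g' f => exact add_mul _ _ _
  | comp_smul c g f => exact mul_smul_comm _ _ _
  | smul_comp c g f => exact smul_mul_assoc _ _ _
  | tensor_add f g g' => exact mul_add _ _ _
  | add_tensor f f' g => exact add_mul _ _ _
  | tensor_smul c f g => exact mul_smul_comm _ _ _
  | smul_tensor c f g => exact smul_mul_assoc _ _ _
  | id_comp f => exact one_mul _
  | comp_id f => exact mul_one _
  | comp_assoc h g f => exact mul_assoc _ _ _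
  | id_tensor_id m n => exact one_mul _
  | unit_tensor f => rw [eval_cast]; exact one_mul _
  | tensor_unit f => rw [eval_cast]; exact mul_one _
  | @tensor_assoc m n m' n' m'' n'' f g h =>
    rw [eval_cast]
    simp only [eval]
    rw [mul_assoc, add_assoc r m'' m', add_comm m'' m']
  | @interchange l m n l' m' n' f' f g g' i j hf hg =>
    simp only [eval]
    by_cases h : l' = m'
    · subst h
      have e := (D.supercommutes_eval hf (le_refl (r + l'))).mul_eval hg
      have e' : D.eval g r * D.eval f (r + l') =
          sgn k (i * j) • (D.eval f (r + l') * D.eval g r) := by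
        rw [e, smul_smul, sgn_mul_self, one_smul]
      rw [mul_assoc, ← mul_assoc (D.eval g r), e', smul_mul_assoc, mul_smul_comm]
      simp only [mul_assoc]
    · rw [D.eval_of_ne g' h]
      simp
  | tok_one => rw [D.eval_tok (by omega), D.T_one]; rfl
  | tok_linear c d a b =>
    simp only [eval]
    rw [dif_pos (by omega), dif_pos (by omega), dif_pos (by omega), map_add, map_smul, map_smul]
  | tok_mul a b =>
    simp only [eval]
    rw [dif_pos (by omega), dif_pos (by omega), dif_pos (by omega), D.T_mul]
  | cross_sq =>
    simp only [eval]
    rw [dif_pos (by omega), D.U_sq]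
  | braid =>
    simp only [eval, Tm.crossLeft, Tm.crossRight, one_mul, mul_one]
    rw [dif_pos (by omega), dif_pos (by omega)]
    exact (D.U_braid _ _ rfl).symm
  | cross_tok_left a =>
    simp only [eval, one_mul, mul_one]
    rw [dif_pos (by omega), dif_pos (by omega), dif_pos (by omega)]
    have hN : r < N - 1 := by omega
    exact (D.U_T ⟨r, hN⟩ (hi ⟨r, hN⟩) a).trans (by rw [simpleTransposition_hi]; rfl)
  | cross_tok_right a =>
    simp only [eval, one_mul, mul_one]
    rw [dif_pos (by omega), dif_pos (by omega), dif_pos (by omega)]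
    have hN : r < N - 1 := by omega
    exact (D.U_T ⟨r, hN⟩ (lo ⟨r, hN⟩) a).trans (by rw [simpleTransposition_lo]; rfl)
  | cross_dot =>
    simp only [eval, one_mul, mul_one]
    rw [dif_pos (by omega), dif_pos (by omega), dif_pos (by omega), eval_teleporter D (by omega),
      neg_smul, _root_.one_smul, ← sub_eq_add_neg, sub_eq_iff_eq_add']
    exact D.U_X_hi _
  | dot_cross =>
    simp only [eval, one_mul, mul_one]
    rw [dif_pos (by omega), dif_pos (by omega), dif_pos (by omega), eval_teleporter D (by omega),
      neg_smul, _root_.one_smul, ← D.tau_swap (lo_ne_hi _).symm, ← sub_eq_add_neg,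
      sub_eq_iff_eq_add', ← sub_eq_iff_eq_add]
    exact (D.U_X_lo ⟨r, by omega⟩).symm
  | tok_dot a i ha =>
    simp only [eval]
    rw [dif_pos (by omega), dif_pos (by omega), D.T_X _ _ ha]

/-- The homomorphism from the Frobenius nilHecke algebra determined by a family of dots, tokens and
crossings satisfying its relations. -/
noncomputable def evalHom : NilHecke F N →ₐ[k] E :=
  AlgHom.ofLinearMap
    { toFun := Quotient.lift (fun f : Tm k A N N => D.eval f 0)
        fun _ _ h => D.eval_eq_of_rel h (Nat.zero_add N).le
      map_add' := by rintro ⟨f⟩ ⟨g⟩; rfl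
      map_smul' := by rintro r ⟨f⟩; rfl }
    rfl (by rintro ⟨f⟩ ⟨g⟩; rfl)

theorem evalHom_place {d : ℕ} (l r : ℕ) (h : l + d + r = N) (f : Tm k A d d) :
    D.evalHom (place F l r h f) = D.eval f r := by
  change D.eval _ 0 = _
  rw [eval_cast]
  simp [eval]

theorem evalHom_xAt (i : Fin N) : D.evalHom (xAt F i) = D.X i := by
  rw [xAt, evalHom_place, eval_dot _ i.2]

theorem evalHom_tokenAt (i : Fin N) (a : A) : D.evalHom (tokenAt F i a) = D.T i a := by
  rw [tokenAt, evalHom_place, eval_tok _ i.2]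

theorem evalHom_uAt (i : Fin (N - 1)) : D.evalHom (uAt F i) = D.U i := by
  rw [uAt, evalHom_place, eval_cross _ i.2]

end NilHeckeFamily

end FrobNilHecke
-- Relations and generation inside the category.
namespace FrobNilHecke

universe u v w

variable {k : Type u} {A : Type v} [CommRing k] [Ring A] [Algebra k A]
  {𝒜 : ZMod 2 → Submodule k A} [GradedAlgebra 𝒜] {ι : Type w} [Fintype ι] [DecidableEq ι]
  {F : SymmFrobenius k 𝒜 ι}

section Rel

/-- Equality of morphisms whose sources and targets are only propositionally equal. -/
def HRel (F : SymmFrobenius k 𝒜 ι) {m n m' n' : ℕ} (f : Tm k A m n) (g : Tm k A m' n') : Prop :=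
  ∃ (hm : m = m') (hn : n = n'), Rel F (f.cast hm hn) g

variable {m n m' n' m'' n'' d d' : ℕ}

theorem Rel.hrel {f g : Tm k A m n} (h : Rel F f g) : HRel F f g := ⟨rfl, rfl, h⟩

theorem HRel.refl (f : Tm k A m n) : HRel F f f := (Rel.refl f).hrel

theorem HRel.symm {f : Tm k A m n} {g : Tm k A m' n'} (h : HRel F f g) : HRel F g f := by
  obtain ⟨rfl, rfl, h⟩ := h
  exact ⟨rfl, rfl, Rel.symm h⟩

theorem HRel.trans {f : Tm k A m n} {g : Tm k A m' n'} {h : Tm k A m'' n''} (h1 : HRel F f g)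
    (h2 : HRel F g h) : HRel F f h := by
  obtain ⟨rfl, rfl, h1⟩ := h1
  obtain ⟨rfl, rfl, h2⟩ := h2
  exact ⟨rfl, rfl, Rel.trans h1 h2⟩

theorem HRel.tensor {p q p' q' : ℕ} {f : Tm k A m n} {f' : Tm k A m' n'} {g : Tm k A p q}
    {g' : Tm k A p' q'} (h : HRel F f f') (h' : HRel F g g') :
    HRel F (f.tensor g) (f'.tensor g') := by
  obtain ⟨rfl, rfl, h⟩ := h
  obtain ⟨rfl, rfl, h'⟩ := h'
  exact ⟨rfl, rfl, Rel.tensor_congr h h'⟩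

theorem hrel_assoc {p q : ℕ} (f : Tm k A m n) (g : Tm k A m' n') (h : Tm k A p q) :
    HRel F ((f.tensor g).tensor h) (f.tensor (g.tensor h)) :=
  ⟨_, _, Rel.tensor_assoc f g h⟩

/-- The interchange law is applied to two identities, which are even, so no homogeneity of `f` or
`g` is needed. -/
theorem Rel.tensor_eq_comp (f : Tm k A m n) (g : Tm k A m' n') :
    Rel F (f.tensor g) ((f.tensor (.id n')).comp (Tm.tensor (.id m) g)) := by
  refine Rel.symm ((Rel.interchange f (.id m) (.id n') g 0 0 (.id m) (.id n')).trans ?_)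
  rw [mul_zero, sgn_zero]
  exact (Rel.one_smul _).trans (Rel.tensor_congr (Rel.comp_id f) (Rel.id_comp g))

theorem Rel.comp_eq_smul_tensor {f : Tm k A m n} {g : Tm k A m' n'} {i j : ZMod 2}
    (hf : HasParity F f i) (hg : HasParity F g j) :
    Rel F ((Tm.tensor (.id n) g).comp (f.tensor (.id m')))
      (.smul (sgn k (i * j)) (f.tensor g)) :=
  (Rel.interchange (.id n) f g (.id m') i j hf hg).trans
    (Rel.smul_congr _ (Rel.tensor_congr (Rel.id_comp f) (Rel.comp_id g)))

theorem Rel.id_tensor_comp (l : ℕ) {g : Tm k A n d} (f : Tm k A m n) {j : ZMod 2}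
    (hg : HasParity F g j) :
    Rel F (Tm.tensor (.id l) (g.comp f)) ((Tm.tensor (.id l) g).comp (Tm.tensor (.id l) f)) := by
  refine Rel.symm ((Rel.interchange (.id l) (.id l) g f 0 j (.id l) hg).trans ?_)
  rw [zero_mul, sgn_zero]
  exact (Rel.one_smul _).trans (Rel.tensor_congr (Rel.id_comp _) (Rel.refl _))

theorem Rel.comp_tensor_id (r : ℕ) (g : Tm k A n d) {f : Tm k A m n} {i : ZMod 2}
    (hf : HasParity F f i) :
    Rel F ((g.comp f).tensor (.id r)) ((g.tensor (.id r)).comp (f.tensor (.id r))) := by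
  refine Rel.symm ((Rel.interchange g f (.id r) (.id r) i 0 hf (.id r)).trans ?_)
  rw [mul_zero, sgn_zero]
  exact (Rel.one_smul _).trans (Rel.tensor_congr (Rel.refl _) (Rel.id_comp _))

theorem Rel.smul_zero (r : k) : Rel F (.smul r (.zero m n)) (.zero m n) :=
  (Rel.smul_congr r (Rel.zero_smul (.zero m n)).symm).trans
    ((Rel.mul_smul r 0 _).symm.trans (by rw [mul_zero]; exact Rel.zero_smul _))

theorem Rel.zero_comp (f : Tm k A m n) : Rel F (Tm.comp (.zero n d) f) (.zero m d) :=
  (Rel.comp_congr (Rel.zero_smul (.zero n d)).symm (Rel.refl f)).trans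
    ((Rel.smul_comp 0 _ f).trans (Rel.zero_smul _))

theorem Rel.comp_zero (f : Tm k A m n) : Rel F (Tm.comp f (.zero d m)) (.zero d n) :=
  (Rel.comp_congr (Rel.refl f) (Rel.zero_smul (.zero d m)).symm).trans
    ((Rel.comp_smul 0 f _).trans (Rel.zero_smul _))

theorem Rel.zero_tensor (f : Tm k A m n) :
    Rel F (Tm.tensor (.zero m' n') f) (.zero (m' + m) (n' + n)) :=
  (Rel.tensor_congr (Rel.zero_smul (.zero m' n')).symm (Rel.refl f)).trans
    ((Rel.smul_tensor 0 _ f).trans (Rel.zero_smul _))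

theorem Rel.tensor_zero (f : Tm k A m n) :
    Rel F (Tm.tensor f (.zero m' n')) (.zero (m + m') (n + n')) :=
  (Rel.tensor_congr (Rel.refl f) (Rel.zero_smul (.zero m' n')).symm).trans
    ((Rel.tensor_smul 0 f _).trans (Rel.zero_smul _))

theorem rel_zero_of_ne (f : Tm k A m n) (h : m ≠ n) : Rel F f (.zero m n) := by
  induction f with
  | id n => exact absurd rfl h
  | @comp l m n g f hg hf =>
    by_cases h' : l = m
    · exact (Rel.comp_congr (hg (h' ▸ h)) (Rel.refl f)).trans (Rel.zero_comp f)
    · exact (Rel.comp_congr (Rel.refl g) (hf h')).trans (Rel.comp_zero g)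
  | @tensor m n m' n' f g hf hg =>
    by_cases h' : m = n
    · exact (Rel.tensor_congr (Rel.refl f) (hg (by omega))).trans (Rel.tensor_zero f)
    · exact (Rel.tensor_congr (hf h') (Rel.refl g)).trans (Rel.zero_tensor g)
  | zero => exact Rel.refl _
  | add f g hf hg => exact (Rel.add_congr (hf h) (hg h)).trans (Rel.zero_add _)
  | smul c f hf => exact (Rel.smul_congr c (hf h)).trans (Rel.smul_zero c)
  | cross => exact absurd rfl h
  | dot => exact absurd rfl h
  | tok a => exact absurd rfl h

/-- Every morphism is the sum of an even and an odd one. -/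
theorem exists_parity_add (F : SymmFrobenius k 𝒜 ι) (f : Tm k A m n) :
    ∃ f₀ f₁, HasParity F f₀ 0 ∧ HasParity F f₁ 1 ∧ Rel F f (.add f₀ f₁) := by
  have hom : ∀ {m n : ℕ} (f : Tm k A m n) (i : ZMod 2), HasParity F f i →
      ∃ f₀ f₁, HasParity F f₀ 0 ∧ HasParity F f₁ 1 ∧ Rel F f (.add f₀ f₁) := by
    intro m n f i hf
    have hi : ∀ i : ZMod 2, i = 0 ∨ i = 1 := by decide
    rcases hi i with rfl | rfl
    · exact ⟨f, .zero m n, hf, .zero m n 1,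
        (Rel.zero_add f).symm.trans (Rel.add_comm _ _)⟩
    · exact ⟨.zero m n, f, .zero m n 0, hf, (Rel.zero_add f).symm⟩
  have add4 : ∀ {m n : ℕ} (a b c d : Tm k A m n),
      Rel F (.add (.add a b) (.add c d)) (.add (.add a d) (.add b c)) := by
    intro m n a b c d
    have e : (Mor.mk F a + Mor.mk F b) + (Mor.mk F c + Mor.mk F d) =
        (Mor.mk F a + Mor.mk F d) + (Mor.mk F b + Mor.mk F c) := by abel
    exact Quotient.exact e
  induction f with
  | id n => exact hom _ 0 (.id n)
  | comp g f hg hf =>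
    obtain ⟨g₀, g₁, hg₀, hg₁, hg⟩ := hg
    obtain ⟨f₀, f₁, hf₀, hf₁, hf⟩ := hf
    exact ⟨.add (.comp g₀ f₀) (.comp g₁ f₁), .add (.comp g₀ f₁) (.comp g₁ f₀),
      .add (hg₀.comp hf₀) (hg₁.comp hf₁), .add (hg₀.comp hf₁) (hg₁.comp hf₀),
      (Rel.comp_congr hg hf).trans ((Rel.add_comp _ _ _).trans
        ((Rel.add_congr (Rel.comp_add _ _ _) (Rel.comp_add _ _ _)).trans (add4 _ _ _ _)))⟩
  | tensor g f hg hf =>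
    obtain ⟨g₀, g₁, hg₀, hg₁, hg⟩ := hg
    obtain ⟨f₀, f₁, hf₀, hf₁, hf⟩ := hf
    exact ⟨.add (.tensor g₀ f₀) (.tensor g₁ f₁), .add (.tensor g₀ f₁) (.tensor g₁ f₀),
      .add (hg₀.tensor hf₀) (hg₁.tensor hf₁), .add (hg₀.tensor hf₁) (hg₁.tensor hf₀),
      (Rel.tensor_congr hg hf).trans ((Rel.add_tensor _ _ _).trans
        ((Rel.add_congr (Rel.tensor_add _ _ _) (Rel.tensor_add _ _ _)).trans (add4 _ _ _ _)))⟩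
  | zero m n => exact hom _ 0 (.zero m n 0)
  | add g f hg hf =>
    obtain ⟨g₀, g₁, hg₀, hg₁, hg⟩ := hg
    obtain ⟨f₀, f₁, hf₀, hf₁, hf⟩ := hf
    refine ⟨.add g₀ f₀, .add g₁ f₁, .add hg₀ hf₀, .add hg₁ hf₁, (Rel.add_congr hg hf).trans ?_⟩
    have e : (Mor.mk F g₀ + Mor.mk F g₁) + (Mor.mk F f₀ + Mor.mk F f₁) =
        (Mor.mk F g₀ + Mor.mk F f₀) + (Mor.mk F g₁ + Mor.mk F f₁) := by abel
    exact Quotient.exact e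
  | smul c f hf =>
    obtain ⟨f₀, f₁, hf₀, hf₁, hf⟩ := hf
    exact ⟨.smul c f₀, .smul c f₁, .smul c hf₀, .smul c hf₁,
      (Rel.smul_congr c hf).trans (Rel.smul_add _ _ _)⟩
  | cross => exact hom _ 0 .cross
  | dot => exact hom _ _ .dot
  | tok a =>
    obtain ⟨x, hx, y, hy, rfl⟩ := exists_add_of_parity 𝒜 0 a
    refine ⟨.tok x, .tok y, .tok x _ hx, .tok y _ hy, ?_⟩
    have := Rel.tok_linear (F := F) 1 1 x y
    rw [_root_.one_smul, _root_.one_smul] at this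
    exact Rel.symm ((Rel.add_congr (Rel.one_smul _).symm (Rel.one_smul _).symm).trans this)

end Rel

section Place

variable {n d d' l r l' r' : ℕ}

theorem place_congr_index (hl : l = l') (hr : r = r') (h : l + d + r = n) (h' : l' + d + r' = n)
    (f : Tm k A d d) : place F l r h f = place F l' r' h' f := by
  subst hl hr
  rfl

theorem place_eq_of_hrel (h : l + d + r = n) (h' : l' + d' + r' = n) {f : Tm k A d d}
    {g : Tm k A d' d'} (e : HRel F ((Tm.tensor (.id l) f).tensor (.id r))
      ((Tm.tensor (.id l') g).tensor (.id r'))) : place F l r h f = place F l' r' h' g := by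
  subst h
  obtain ⟨hm, hn, e⟩ := e
  have : HRel F ((Tm.tensor (.id l) f).tensor (.id r))
      (((Tm.tensor (.id l') g).tensor (.id r')).cast h' h') := by
    refine HRel.trans ⟨hm, hn, e⟩ ⟨h', h', Rel.refl _⟩
  obtain ⟨_, _, e⟩ := this
  exact Quotient.sound e

theorem place_congr {h : l + d + r = n} {f g : Tm k A d d} (e : Rel F f g) :
    place F l r h f = place F l r h g :=
  place_eq_of_hrel h h (((HRel.refl _).tensor e.hrel).tensor (HRel.refl _))

theorem place_add (h : l + d + r = n) (f g : Tm k A d d) :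
    place F l r h (.add f g) = place F l r h f + place F l r h g := by
  subst h
  exact Quotient.sound ((Rel.tensor_congr (Rel.tensor_add _ _ _) (Rel.refl _)).trans
    (Rel.add_tensor _ _ _))

theorem place_smul (h : l + d + r = n) (c : k) (f : Tm k A d d) :
    place F l r h (.smul c f) = c • place F l r h f := by
  subst h
  exact Quotient.sound ((Rel.tensor_congr (Rel.tensor_smul _ _ _) (Rel.refl _)).trans
    (Rel.smul_tensor _ _ _))

theorem place_zero (h : l + d + r = n) : place F l r h (.zero d d) = 0 := by
  rw [← place_congr (Rel.zero_smul (.zero d d)), place_smul, zero_smul]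

theorem place_id (h : l + d + r = n) : place F l r h (.id d) = 1 := by
  subst h
  exact Quotient.sound ((Rel.tensor_congr (Rel.id_tensor_id _ _) (Rel.refl _)).trans
    (Rel.id_tensor_id _ _))

theorem place_comp_of_parity (h : l + d + r = n) {g : Tm k A d d} {f : Tm k A d d} {i j : ZMod 2}
    (hg : HasParity F g i) (hf : HasParity F f j) :
    place F l r h (.comp g f) = place F l r h g * place F l r h f := by
  subst h
  exact Quotient.sound ((Rel.tensor_congr (Rel.id_tensor_comp l f hg) (Rel.refl _)).trans
    (Rel.comp_tensor_id r _ ((HasParity.id l).tensor hf)))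

/-- The interchange law is available only for homogeneous morphisms, so both factors are split into
even and odd parts. -/
theorem place_comp (h : l + d + r = n) (g f : Tm k A d d) :
    place F l r h (.comp g f) = place F l r h g * place F l r h f := by
  obtain ⟨g₀, g₁, hg₀, hg₁, hg⟩ := exists_parity_add F g
  obtain ⟨f₀, f₁, hf₀, hf₁, hf⟩ := exists_parity_add F f
  rw [place_congr ((Rel.comp_congr hg hf).trans ((Rel.add_comp _ _ _).trans
    (Rel.add_congr (Rel.comp_add _ _ _) (Rel.comp_add _ _ _)))), place_congr hg, place_congr hf]
  simp only [place_add, place_comp_of_parity h hg₀ hf₀, place_comp_of_parity h hg₀ hf₁,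
    place_comp_of_parity h hg₁ hf₀, place_comp_of_parity h hg₁ hf₁]
  noncomm_ring

theorem place_tensor_id (h : l + (d + d') + r = n) (h' : l + d + (d' + r) = n) (f : Tm k A d d) :
    place F l r h (f.tensor (.id d')) = place F l (d' + r) h' f := by
  refine place_eq_of_hrel h h' ?_
  refine HRel.trans ((hrel_assoc _ _ _).symm.tensor (HRel.refl _)) ?_
  exact (hrel_assoc _ _ _).trans ((HRel.refl _).tensor (Rel.id_tensor_id _ _).hrel)

theorem place_id_tensor (h : l + (d + d') + r = n) (h' : l + d + d' + r = n) (g : Tm k A d' d') :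
    place F l r h (Tm.tensor (.id d) g) = place F (l + d) r h' g := by
  refine place_eq_of_hrel h h' ?_
  exact HRel.trans ((hrel_assoc _ _ _).symm.tensor (HRel.refl _))
    ((((Rel.id_tensor_id _ _).hrel).tensor (HRel.refl _)).tensor (HRel.refl _))

theorem place_tensor (h : l + (d + d') + r = n) (f : Tm k A d d) (g : Tm k A d' d') :
    place F l r h (f.tensor g) =
      place F l (d' + r) (by omega) f * place F (l + d) r (by omega) g := by
  rw [place_congr (Rel.tensor_eq_comp f g), place_comp, place_tensor_id h (by omega),
    place_id_tensor h (by omega)]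

/-- Both morphisms are widened by identities to one common block of strands; there the two orders of
composition are the two sides of the super interchange law. -/
theorem place_mul_place_of_le (h : l + d + r = n) (h' : l' + d' + r' = n) (hle : l + d ≤ l')
    {f : Tm k A d d} {g : Tm k A d' d'} {i j : ZMod 2} (hf : HasParity F f i)
    (hg : HasParity F g j) :
    place F l r h f * place F l' r' h' g =
      sgn k (i * j) • (place F l' r' h' g * place F l r h f) := by
  obtain ⟨c, rfl⟩ := Nat.exists_eq_add_of_le hle
  have hn : l + ((d + c) + d') + r' = n := by omega
  have e1 : place F l r h f = place F l r' hn ((f.tensor (.id c)).tensor (.id d')) := by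
    rw [place_tensor_id hn (by omega), place_tensor_id (by omega) (by omega)]
    exact place_congr_index rfl (by omega) _ _ _
  have e2 : place F (l + d + c) r' h' g = place F l r' hn (Tm.tensor (.id (d + c)) g) := by
    rw [place_id_tensor hn (by omega)]
    exact place_congr_index (by omega) rfl _ _ _
  have hf' : HasParity F (f.tensor (.id c)) i := by
    have := hf.tensor (HasParity.id (F := F) c)
    rwa [add_zero] at this
  rw [e1, e2, ← place_comp, ← place_comp, ← place_congr (Rel.tensor_eq_comp _ _),
    place_congr (Rel.comp_eq_smul_tensor hf' hg), place_smul, smul_smul, sgn_mul_self, one_smul]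

theorem place_mul_place (h : l + d + r = n) (h' : l' + d' + r' = n)
    (hle : l + d ≤ l' ∨ l' + d' ≤ l)
    {f : Tm k A d d} {g : Tm k A d' d'} {i j : ZMod 2} (hf : HasParity F f i)
    (hg : HasParity F g j) :
    place F l r h f * place F l' r' h' g =
      sgn k (i * j) • (place F l' r' h' g * place F l r h f) := by
  rcases hle with hle | hle
  · exact place_mul_place_of_le h h' hle hf hg
  · rw [place_mul_place_of_le h' h hle hg hf, smul_smul, mul_comm j, sgn_mul_self, one_smul]

theorem place_listSum (h : l + d + r = n) (L : List (Tm k A d d)) :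
    place F l r h (Tm.listSum L) = (L.map fun f => place F l r h f).sum := by
  induction L with
  | nil => exact place_zero h
  | cons f L ih =>
    rw [List.map_cons, List.sum_cons, ← ih]
    exact place_add h _ _

theorem place_zero_zero (h : 0 + n + 0 = n) (f : Tm k A n n) :
    place F 0 0 h f = Mor.mk F f := by
  have e : HRel F ((Tm.tensor (.id 0) f).tensor (.id 0)) f :=
    HRel.trans ⟨_, _, Rel.tensor_unit _⟩ ⟨_, _, Rel.unit_tensor f⟩
  obtain ⟨_, _, e⟩ := e
  exact Quotient.sound e

end Place

section Generators

variable {n : ℕ}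

theorem tokenAt_add (i : Fin n) (a b : A) :
    tokenAt F i (a + b) = tokenAt F i a + tokenAt F i b := by
  have := Rel.tok_linear (F := F) 1 1 a b
  rw [one_smul, one_smul] at this
  simp only [tokenAt]
  rw [← place_congr this, place_add, place_smul, place_smul, one_smul, one_smul]

theorem tokenAt_smul (i : Fin n) (c : k) (a : A) :
    tokenAt F i (c • a) = c • tokenAt F i a := by
  have := Rel.tok_linear (F := F) c 0 a 0
  rw [zero_smul, add_zero] at this
  simp only [tokenAt]
  rw [← place_congr this, place_add, place_smul, place_smul, zero_smul, add_zero]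

theorem tokenAt_eq_place (i : Fin n) {l r : ℕ} (h : l + 1 + r = n) (hr : r = i) (a : A) :
    tokenAt F i a = place F l r h (.tok a) :=
  place_congr_index (by omega) hr.symm _ _ _

theorem xAt_eq_place (i : Fin n) {l r : ℕ} (h : l + 1 + r = n) (hr : r = i) :
    xAt F i = place F l r h .dot :=
  place_congr_index (by omega) hr.symm _ _ _

theorem uAt_eq_place (i : Fin (n - 1)) {l r : ℕ} (h : l + 2 + r = n) (hr : r = i) :
    uAt F i = place F l r h .cross :=
  place_congr_index (by omega) hr.symm _ _ _

variable (F n) in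
/-- The dots and tokens in the Frobenius nilHecke algebra. -/
def dotTokens : DotTokens F (Fin n) (NilHecke F n) where
  X := xAt F
  T i :=
    { toFun := tokenAt F i
      map_add' := tokenAt_add i
      map_smul' := tokenAt_smul i }
  T_one i := (place_congr Rel.tok_one).trans (place_id _)
  T_mul i a b := (place_congr (Rel.tok_mul a b).symm).trans (place_comp _ _ _)
  T_T {i j c d a b} h ha hb :=
    place_mul_place _ _ (by have := Fin.val_injective.ne h; omega) (.tok a c ha) (.tok b d hb)
  T_X i j c a ha := by
    by_cases h : i = j
    · subst h
      simp only [LinearMap.coe_mk, AddHom.coe_mk, tokenAt, xAt]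
      rw [← place_comp, place_congr (Rel.tok_dot a c ha), place_smul, place_comp]
    · rw [mul_comm F.trp]
      exact place_mul_place _ _ (by have := Fin.val_injective.ne h; omega) (.tok a c ha) .dot
  X_X {i j} h := by
    rw [← NilHeckeFamily.mul_self_parity F.trp]
    exact place_mul_place _ _ (by have := Fin.val_injective.ne h; omega) .dot .dot

theorem xAt_hi (i : Fin (n - 1)) : xAt F (hi i) =
    place F (n - 2 - i) i (by omega) (Tm.tensor .dot (.id 1)) := by
  rw [place_tensor_id _ (by omega)]
  exact xAt_eq_place _ _ (by simp [hi, add_comm])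

theorem xAt_lo (i : Fin (n - 1)) : xAt F (lo i) =
    place F (n - 2 - i) i (by omega) (Tm.tensor (.id 1) .dot) := by
  rw [place_id_tensor _ (by omega)]
  exact xAt_eq_place _ _ (by simp [lo])

theorem tokenAt_hi (i : Fin (n - 1)) (a : A) : tokenAt F (hi i) a =
    place F (n - 2 - i) i (by omega) (Tm.tensor (.tok a) (.id 1)) := by
  rw [place_tensor_id _ (by omega)]
  exact tokenAt_eq_place _ _ (by simp [hi, add_comm]) a

theorem tokenAt_lo (i : Fin (n - 1)) (a : A) : tokenAt F (lo i) a =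
    place F (n - 2 - i) i (by omega) (Tm.tensor (.id 1) (.tok a)) := by
  rw [place_id_tensor _ (by omega)]
  exact tokenAt_eq_place _ _ (by simp [lo]) a

theorem place_teleporter (i : Fin (n - 1)) :
    place F (n - 2 - i) i (by omega) (teleporter F) = (dotTokens F n).tau (hi i) (lo i) := by
  rw [teleporter, place_listSum, List.map_map, DotTokens.tau, Finset.sum_map_toList]
  refine Finset.sum_congr rfl fun b _ => ?_
  rw [Function.comp_apply, place_smul]
  congr 1
  exact (place_congr (Rel.tensor_eq_comp (.tok _) (.tok _))).trans ((place_comp _ _ _).trans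
    (congrArg₂ (· * ·) (tokenAt_hi i _).symm (tokenAt_lo i _).symm))

theorem uAt_mul_tokenAt (i : Fin (n - 1)) (j : Fin n) (a : A) :
    uAt F i * tokenAt F j a = tokenAt F (simpleTransposition i j) a * uAt F i := by
  by_cases hl : j = lo i
  · subst hl
    rw [simpleTransposition_lo, tokenAt_lo, tokenAt_hi, uAt, ← place_comp, ← place_comp,
      place_congr (Rel.cross_tok_right a)]
  by_cases hh : j = hi i
  · subst hh
    rw [simpleTransposition_hi, tokenAt_lo, tokenAt_hi, uAt, ← place_comp, ← place_comp,
      place_congr (Rel.cross_tok_left a)]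
  rw [simpleTransposition_of_ne hl hh]
  have hle : n - 2 - i + 2 ≤ n - 1 - j ∨ n - 1 - j + 1 ≤ n - 2 - i := by
    simp only [lo, hi, Fin.ext_iff] at hl hh
    omega
  induction a using parity_induction 𝒜 with
  | hom c a ha =>
    have := place_mul_place (F := F) (n := n) (by omega) (by omega) hle .cross (.tok a c ha)
      (r := i) (r' := j)
    rwa [zero_mul, sgn_zero, one_smul] at this
  | add a b ha hb => rw [tokenAt_add, mul_add, add_mul, ha, hb]

theorem uAt_mul_xAt (i : Fin (n - 1)) (j : Fin n) :
    uAt F i * xAt F j = xAt F (simpleTransposition i j) * uAt F i +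
      (dotTokens F n).delta i j := by
  by_cases hl : j = lo i
  · subst hl
    rw [simpleTransposition_lo, DotTokens.delta_lo,
      (dotTokens F n).tau_swap (lo_ne_hi i).symm, ← place_teleporter, ← place_smul,
      ← place_congr Rel.dot_cross, place_add, place_smul, place_comp, place_comp, ← xAt_hi, ← xAt_lo,
      ← uAt_eq_place i _ rfl, neg_smul, one_smul]
    abel
  by_cases hh : j = hi i
  · subst hh
    rw [simpleTransposition_hi, DotTokens.delta_hi, ← place_teleporter,
      ← place_congr Rel.cross_dot, place_add, place_smul, place_comp, place_comp, ← xAt_hi, ← xAt_lo,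
      ← uAt_eq_place i _ rfl, neg_smul, one_smul]
    abel
  rw [simpleTransposition_of_ne hl hh, DotTokens.delta_of_ne _ hl hh, add_zero]
  have hle : n - 2 - i + 2 ≤ n - 1 - j ∨ n - 1 - j + 1 ≤ n - 2 - i := by
    simp only [lo, hi, Fin.ext_iff] at hl hh
    omega
  have := place_mul_place (F := F) (n := n) (by omega) (by omega) hle .cross .dot
    (r := i) (r' := j)
  rwa [zero_mul, sgn_zero, one_smul] at this

theorem uAt_braid {i j : Fin (n - 1)} (h : (i : ℕ) + 1 = j) :
    uAt F i * (uAt F j * uAt F i) = uAt F j * (uAt F i * uAt F j) := by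
  have hn : n - 3 - i + 3 + i = n := by omega
  -- Strands are numbered from the right, so the crossing with smaller index is the right one of the
  -- three-strand block.
  have e1 : uAt F i = place F (n - 3 - i) i hn .crossRight := by
    rw [Tm.crossRight]
    exact (uAt_eq_place i (by omega) rfl).trans (place_id_tensor (d := 1) (d' := 2) hn
      (by omega) _).symm
  have e2 : uAt F j = place F (n - 3 - i) i hn .crossLeft := by
    rw [Tm.crossLeft]
    exact (uAt_eq_place j (by omega) (by omega)).trans (place_tensor_id (d := 2) (d' := 1) hn
      (by omega) _).symm
  rw [e1, e2]
  simp only [← place_comp]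
  exact (place_congr Rel.braid).symm

variable (F n) in
/-- The dots, tokens and crossings in the Frobenius nilHecke algebra. -/
def nilHeckeFamily : NilHeckeFamily F n (NilHecke F n) where
  toDotTokens := dotTokens F n
  U := uAt F
  U_T := uAt_mul_tokenAt
  U_X := uAt_mul_xAt
  U_sq i := by
    rw [uAt, ← place_comp, place_congr Rel.cross_sq, place_zero]
  U_braid _ _ := uAt_braid
  U_far i j h := by
    have := place_mul_place (F := F) (n := n) (l := n - 2 - i) (l' := n - 2 - j) (by omega)
      (by omega) (by omega) .cross .cross (r := i) (r' := j)
    rwa [zero_mul, sgn_zero, one_smul] at this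

/-- Induction over expressions passes through pieces that need not be endomorphisms, hence the
general target and the cast. Composites and tensor products involving a piece with different source
and target are zero by `rel_zero_of_ne`. -/
theorem place_mem_adjoin {m m' : ℕ} (f : Tm k A m m') (hm : m' = m) {l r : ℕ} (h : l + m + r = n) :
    place F l r h (f.cast rfl hm) ∈
      Algebra.adjoin k ((nilHeckeFamily F n).gens ∪ Set.range (uAt F)) := by
  induction f generalizing l r with
  | id m =>
    change place F l r h (.id _) ∈ _
    rw [place_id]
    exact one_mem _
  | @comp a b c g f hg hf =>
    subst hm
    by_cases hab : c = b
    · subst hab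
      change place F l r h (.comp g f) ∈ _
      rw [place_comp]
      exact mul_mem (hg rfl h) (hf rfl h)
    · change place F l r h (.comp g f) ∈ _
      rw [place_congr ((Rel.comp_congr (rel_zero_of_ne g (Ne.symm hab)) (Rel.refl f)).trans
        (Rel.zero_comp f)), place_zero]
      exact zero_mem _
  | @tensor a b c d f g hf hg =>
    by_cases hab : b = a
    · subst hab
      obtain rfl : d = c := by omega
      change place F l r h (.tensor f g) ∈ _
      rw [place_tensor]
      exact mul_mem (hf rfl _) (hg rfl _)
    · have e : Rel F (f.tensor g) (.zero _ _) :=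
        (Rel.tensor_congr (rel_zero_of_ne f (Ne.symm hab)) (Rel.refl g)).trans (Rel.zero_tensor g)
      have e' : Rel F ((f.tensor g).cast rfl hm) (.zero _ _) := by
        generalize f.tensor g = t at e
        generalize b + d = q at *
        subst hm
        exact e
      rw [place_congr e', place_zero]
      exact zero_mem _
  | zero a b =>
    subst hm
    change place F l r h (.zero _ _) ∈ _
    rw [place_zero]
    exact zero_mem _
  | add f g hf hg =>
    subst hm
    change place F l r h (.add f g) ∈ _
    rw [place_add]
    exact add_mem (hf rfl h) (hg rfl h)
  | smul c f hf =>
    subst hm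
    change place F l r h (.smul c f) ∈ _
    rw [place_smul]
    exact Subalgebra.smul_mem _ (hf rfl h) c
  | cross =>
    refine Algebra.subset_adjoin (Or.inr ⟨⟨r, by omega⟩, ?_⟩)
    exact uAt_eq_place _ h rfl
  | dot =>
    refine Algebra.subset_adjoin (Or.inl (Or.inl ⟨⟨r, by omega⟩, ?_⟩))
    exact xAt_eq_place _ h rfl
  | tok a =>
    refine Algebra.subset_adjoin (Or.inl (Or.inr ⟨⟨r, by omega⟩, a, ?_⟩))
    exact tokenAt_eq_place _ h rfl a

theorem adjoin_generators_eq_top :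
    Algebra.adjoin k ((nilHeckeFamily F n).gens ∪ Set.range (nilHeckeFamily F n).U) = ⊤ := by
  rw [eq_top_iff]
  rintro ⟨f⟩ -
  have := place_mem_adjoin (F := F) f rfl (l := 0) (r := 0) (Nat.zero_add n)
  rwa [Tm.cast, place_zero_zero] at this

end Generators

end FrobNilHecke
-- The basis theorem.
namespace FrobNilHecke

universe u v w

variable {k : Type u} {A : Type v} [CommRing k] [Ring A] [Algebra k A]
  {𝒜 : ZMod 2 → Submodule k A} [GradedAlgebra 𝒜] {ι : Type w} [Fintype ι] [DecidableEq ι]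
  (F : SymmFrobenius k 𝒜 ι) (n : ℕ)

/-- The standard monomials of the Frobenius nilHecke algebra. -/
noncomputable def standardMonomial :
    (Fin n → ι) × (Fin n → ℕ) × Equiv.Perm (Fin n) → NilHecke F n :=
  (nilHeckeFamily F n).monomial (List.finRange n).reverse (List.finRange n)

theorem standardMonomial_apply (c : Fin n → ι) (e : Fin n → ℕ) (w : Equiv.Perm (Fin n)) :
    standardMonomial F n (c, e, w) =
      pureTensor F (fun i => F.basis (c i)) * xMonomial F e * uPerm F w := by
  have h1 : pureTensor F (fun i => F.basis (c i)) = (nilHeckeFamily F n).tokenMon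
      (List.finRange n).reverse (fun i => F.basis (c i)) := by
    rw [pureTensor, DotTokens.tokenMon, List.finRange_reverse, List.map_map, List.ofFn_eq_map]
    rfl
  have h2 : xMonomial F e = (nilHeckeFamily F n).dotMon (List.finRange n) e := by
    rw [xMonomial, DotTokens.dotMon, List.ofFn_eq_map]
    rfl
  rw [h1, h2]
  rfl

theorem span_standardMonomial : Submodule.span k (Set.range (standardMonomial F n)) = ⊤ :=
  (nilHeckeFamily F n).span_monomial_eq_top adjoin_generators_eq_top
    (List.nodup_reverse.2 (List.nodup_finRange n)) (List.nodup_finRange n) (by simp) (by simp)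

/-- The vector `single 1 1` plays the role of the unit: the crossings along a reduced word of `w`
carry it to `single w 1`, and dots and tokens then multiply the coefficient. This reduces
independence to that in `DotTokenAlgebra`. -/
theorem evalHom_standardMonomial (c : Fin n → ι) (e : Fin n → ℕ) (w : Equiv.Perm (Fin n)) :
    (ModelSpace.family F n).evalHom (standardMonomial F n (c, e, w)) (Finsupp.single 1 1) =
      Finsupp.single w (DotTokenAlgebra.monomial F n (c, e)) := by
  set D := ModelSpace.family F n with hD
  have hT : ∀ i a, D.evalHom ((nilHeckeFamily F n).T i a) =
      ModelSpace.leftMul F n ((DotTokenAlgebra.generators F (Fin n)).T i a) := D.evalHom_tokenAt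
  have hX : ∀ i, D.evalHom ((nilHeckeFamily F n).X i) =
      ModelSpace.leftMul F n ((DotTokenAlgebra.generators F (Fin n)).X i) := D.evalHom_xAt
  have hU : ∀ i, D.evalHom ((nilHeckeFamily F n).U i) = D.U i := D.evalHom_uAt
  have h1 : D.evalHom (standardMonomial F n (c, e, w)) =
      ModelSpace.leftMul F n (DotTokenAlgebra.monomial F n (c, e)) * D.permCrossing w := by
    simp only [standardMonomial, NilHeckeFamily.monomial, DotTokenAlgebra.monomial,
      DotTokens.tokenMon, DotTokens.dotMon, NilHeckeFamily.permCrossing, map_mul, map_list_prod,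
      List.map_map, Function.comp_def, map_pow, hT, hX, hU]
  rw [h1, Module.End.mul_apply, hD, ModelSpace.permCrossing_single, ModelSpace.leftMul_single,
    mul_one]

theorem linearIndependent_standardMonomial : LinearIndependent k (standardMonomial F n) := by
  have h : LinearIndependent k fun q : Equiv.Perm (Fin n) × ((Fin n → ι) × (Fin n → ℕ)) =>
      (Finsupp.single q.1 (DotTokenAlgebra.monomial F n q.2) : ModelSpace F n) :=
    (Finsupp.linearIndependent_single (R := k)
      (fun _ : Equiv.Perm (Fin n) => DotTokenAlgebra.monomial F n)
      fun _ => DotTokenAlgebra.linearIndependent_monomial F n).comp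
      (Equiv.sigmaEquivProd _ _).symm (Equiv.sigmaEquivProd _ _).symm.injective
  let f : NilHecke F n →ₗ[k] ModelSpace F n :=
    LinearMap.applyₗ (Finsupp.single 1 1 : ModelSpace F n) ∘ₗ
      (ModelSpace.family F n).evalHom.toLinearMap
  refine LinearIndependent.of_comp f ?_
  let s : (Fin n → ι) × (Fin n → ℕ) × Equiv.Perm (Fin n) →
      Equiv.Perm (Fin n) × ((Fin n → ι) × (Fin n → ℕ)) := fun q => (q.2.2, q.1, q.2.1)
  have hs : Function.Injective s := by
    rintro ⟨c, e, w⟩ ⟨c', e', w'⟩ h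
    simp only [s, Prod.mk.injEq] at h
    obtain ⟨rfl, rfl, rfl⟩ := h
    rfl
  convert h.comp s hs using 1
  ext1 ⟨c, e, w⟩
  exact evalHom_standardMonomial F n c e w

end FrobNilHecke

theorem mainTheorem2 {k A ι : Type*} [CommRing k] [Ring A] [Algebra k A]
    (𝒜 : ZMod 2 → Submodule k A) [GradedAlgebra 𝒜] [Fintype ι] [DecidableEq ι]
    (F : FrobNilHecke.SymmFrobenius k 𝒜 ι) (n : ℕ) :
    (∀ (w : Equiv.Perm (Fin n)) (l : List (Fin (n - 1))),
      FrobNilHecke.IsReducedWord l w → FrobNilHecke.uWord F l = FrobNilHecke.uPerm F w) ∧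
    ∃ B : Module.Basis ((Fin n → ι) × (Fin n → ℕ) × Equiv.Perm (Fin n)) k
        (FrobNilHecke.NilHecke F n),
      ∀ (c : Fin n → ι) (e : Fin n → ℕ) (w : Equiv.Perm (Fin n)),
        B (c, e, w) =
          FrobNilHecke.pureTensor F (fun i => F.basis (c i)) * FrobNilHecke.xMonomial F e *
            FrobNilHecke.uPerm F w := by
  -- `uPerm` is by definition the `permCrossing` of `nilHeckeFamily`, so independence of the reduced
  -- word is Matsumoto's theorem.
  refine ⟨fun w l h => (FrobNilHecke.nilHeckeFamily F n).prod_eq_permCrossing h,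
    Module.Basis.mk (FrobNilHecke.linearIndependent_standardMonomial F n)
      (FrobNilHecke.span_standardMonomial F n).ge, fun c e w => ?_⟩
  rw [Module.Basis.mk_apply, FrobNilHecke.standardMonomial_apply]
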